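/- \textbf{Setting.} All systems are finite-dimensional and non-zero; every system $A$ has a fixed orthonormal basis $\{|i\rangle\}$, and composite systems carry the product basis. $\log$ is to base $2$. A state is \emph{incoherent} if it is diagonal in the fixed basis. An \emph{incoherent operation} (IO) is a linear map $\mathcal I(\rho)=\sum_\alpha K_\alpha\rho K_\alpha^\dagger$ with finitely many $K_\alpha$, $\sum_\alpha K_\alpha^\dagger K_\alpha=\mathbf 1$, such that every $K_\alpha\delta K_\alpha^\dagger$ is diagonal whenever $\delta$ is incoherent. Let $|\Psi_d\rangle=d^{-1/2}\sum_{i=0}^{d-1}|i\rangle$ and $\Psi_d=|\Psi_d\rangle\langle\Psi_d|$. Let $\Delta$ denote the dephasing map, $S$ the von Neumann entropy, and $D(\rho\|\sigma)=\operatorname{tr}\rho(\log\rho-\log\sigma)$ the relative entropy ($+\infty$ if $\operatorname{supp}\rho\not\subseteq\operatorname{supp}\sigma$). Put \[ C_r(\rho)=\min_{\sigma\text{ incoherent}}D(\rho\|\sigma)=S(\Delta(\rho))-S(\rho),\qquad C_f(\rho)=\inf\sum_i p_i\,S\bigl(\Delta(|\psi_i\rangle\langle\psi_i|)\bigr), \]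 the infimum being over all finite ensembles of pure states with $\rho=\sum_i p_i|\psi_i\rangle\langle\psi_i|$. For a completely positive trace preserving (CPTP) map $T$ from $A$ to $B$ and $X\in\{r,f\}$ let $P_X(T)=\sup_\rho\bigl(C_X(T(\rho))-C_X(\rho)\bigr)$, over all states $\rho$ on $A$, and let $\mathrm{id}_k$ be the identity map on operators on $\mathbb C^k$. \emph{Coherence generating capacity.} A generation protocol with $n$ uses of $T$ and error $\epsilon$ consists of an incoherent state $\rho_0$ on $A\otimes A_0$ and of IOs $\mathcal I_{t+1}:B\otimes A_t\to A\otimes A_{t+1}$ ($0\le t<n$), with finite-dimensional $A_t$, such that the states $\rho_{t+1}=\mathcal I_{t+1}\bigl((T\otimes\mathrm{id})\rho_t\bigr)$ satisfy $\langle\Psi_d|\operatorname{tr}_A\rho_n|\Psi_d\rangle\ge1-\epsilon$, where $d=|A_n|$; its rate is $\frac1n\log d$. $C_{\rm gen}(T)$ is the supremum of all $R\in\mathbb R$ for which there are protocols for all $n\ge1$ with errors tending to $0$ and rates tending to $R$. \emph{Simulation cost.} An $n$-block incoherent simulation of $T$ with error $\epsilon$ and resource $\Psi_d$ (on a $d$-dimensional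 system $D$, $d\ge1$) is an IO $\mathcal I:A^{\otimes n}\otimes D\to B^{\otimes n}$ such that $T'(\rho)=\mathcal I(\rho\otimes\Psi_d)$ satisfies \[ \|T'-T^{\otimes n}\|_\diamond=\sup_{C,\ |\phi\rangle\in A^{\otimes n}\otimes C,\ \|\phi\|=1}\bigl\|\bigl((T'-T^{\otimes n})\otimes\mathrm{id}_C\bigr)|\phi\rangle\langle\phi|\bigr\|_1\le\epsilon ; \] its rate is $\frac1n\log d$. $C_{\rm sim}(T)$ is the infimum of all $R\in\mathbb R$ for which there are $n$-block incoherent simulations for all $n\ge1$ with errors tending to $0$ and rates tending to $R$. \textbf{Theorem.} For every CPTP map $T:A\to B$, \[ C_{\rm gen}(T)\le C_{\rm sim}(T)\le\log|B| , \] and \[ C_{\rm sim}(T)\ \ge\ \max\Bigl\{\sup_{k\ge1}P_r(T\otimes\mathrm{id}_k),\ \sup_{k\ge1}P_f(T\otimes\mathrm{id}_k)\Bigr\}. \] -/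

import Mathlib

open Matrix Filter Topology
open scoped Kronecker ComplexOrder

noncomputable section

namespace CoherenceTheory

/-! A quantum system is given by a finite index type `a`, its Hilbert space is `ℂ^a` with the fixed
(incoherent) basis indexed by `a`, operators are matrices, and a composite system has index type
`a × b` with the product basis. All entropic quantities are in bits. -/

section States

variable {a b c : Type*} [Fintype a] [Fintype b] [Fintype c]

/-- Density matrices. -/
def IsState (ρ : Matrix a a ℂ) : Prop :=
  ρ.PosSemidef ∧ ρ.trace = 1

/-- Incoherent states: density matrices that are diagonal in the fixed basis. -/
def IsIncoherentState (ρ : Matrix a a ℂ) : Prop :=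
  IsState ρ ∧ ρ.IsDiag

/-- Unit vectors of `ℂ^a`. -/
def IsUnitVector (ψ : a → ℂ) : Prop :=
  ∑ i, ‖ψ i‖ ^ 2 = 1

/-- The rank-one operator `|ψ⟩⟨ψ|`. -/
def pureState (ψ : a → ℂ) : Matrix a a ℂ :=
  vecMulVec ψ (star ψ)

/-- The dephasing map `Δ(ρ) = ∑ i, |i⟩⟨i| ρ |i⟩⟨i|`. -/
def dephase [DecidableEq a] (ρ : Matrix a a ℂ) : Matrix a a ℂ :=
  diagonal fun i => ρ i i

/-- The vector `|Ψ_d⟩ = d^{-1/2} ∑ i, |i⟩`. -/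
def maxCoherentVector (d : ℕ) : Fin d → ℂ :=
  fun _ => ((1 / Real.sqrt d : ℝ) : ℂ)

/-- The partial trace over the first factor. -/
def traceFst (ρ : Matrix (a × c) (a × c) ℂ) : Matrix c c ℂ :=
  of fun x y => ∑ i, ρ (i, x) (i, y)

/-- The trace norm `‖X‖₁ = tr √(X† X)`. -/
def traceNorm [DecidableEq a] (X : Matrix a a ℂ) : ℝ :=
  (cfc Real.sqrt (Xᴴ * X)).trace.re

/-- The von Neumann entropy `S(ρ) = - tr ρ log₂ ρ`. -/
def entropy [DecidableEq a] (ρ : Matrix a a ℂ) : ℝ :=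
  -(ρ * cfc Real.log ρ).trace.re / Real.log 2

open Classical in
/-- The relative entropy `D(ρ‖σ) = tr ρ (log₂ ρ - log₂ σ)`, which is `+∞` unless the support of `ρ`
is contained in that of `σ`. -/
def relEntropy [DecidableEq a] (ρ σ : Matrix a a ℂ) : EReal :=
  if ∀ v : a → ℂ, σ *ᵥ v = 0 → ρ *ᵥ v = 0 then
    (((ρ * (cfc Real.log ρ - cfc Real.log σ)).trace.re / Real.log 2 : ℝ) : EReal)
  else ⊤

/-- The relative entropy of coherence, the minimum of `D(ρ‖σ)` over the incoherent states `σ`; see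
`relEntropyCoherence_eq` for its value. -/
def relEntropyCoherence [DecidableEq a] (ρ : Matrix a a ℂ) : ℝ :=
  (⨅ σ : {σ : Matrix a a ℂ // IsIncoherentState σ}, relEntropy ρ σ).toReal

/-- The entropy of coherence `C(ψ) = S(Δ(ψ))` of a pure state. -/
def entropyOfCoherence [DecidableEq a] (ψ : a → ℂ) : ℝ :=
  entropy (dephase (pureState ψ))

/-- The coherence of formation: the least average entropy of coherence of a pure state ensemble
that realizes `ρ`. -/
def coherenceOfFormation [DecidableEq a] (ρ : Matrix a a ℂ) : ℝ :=
  sInf {x : ℝ | ∃ (m : ℕ) (p : Fin m → ℝ) (ψ : Fin m → a → ℂ),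
    (∀ j, 0 ≤ p j) ∧ ∑ j, p j = 1 ∧ (∀ j, IsUnitVector (ψ j)) ∧
    ρ = ∑ j, (p j : ℂ) • pureState (ψ j) ∧
    x = ∑ j, p j * entropyOfCoherence (ψ j)}

end States

section RelEntropyCoherence

variable {a : Type*} [Fintype a] [DecidableEq a]

theorem cfc_diagonal_ofReal (f : ℝ → ℝ) (s : a → ℝ) :
    cfc f (diagonal fun i => (s i : ℂ)) = diagonal fun i => ((f (s i) : ℝ) : ℂ) := by
  have hsa : IsSelfAdjoint (diagonal fun i => (s i : ℂ) : Matrix a a ℂ) := by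
    rw [IsSelfAdjoint, star_eq_conjTranspose, diagonal_conjTranspose]
    congr 1
    ext i
    simp
  set S : Finset ℝ := Finset.univ.image s with hS
  set p : Polynomial ℝ := Lagrange.interpolate S id f with hp
  have hpe : ∀ i, p.eval (s i) = f (s i) := fun i =>
    Lagrange.eval_interpolate_at_node f (v := id) (s := S) (i := s i)
      (Function.injective_id.injOn) (by simp [hS])
  have hspec : ∀ x ∈ spectrum ℝ (diagonal fun i => (s i : ℂ) : Matrix a a ℂ), ∃ i, s i = x := by
    intro x hx
    have hx' : (algebraMap ℝ ℂ x) ∈ spectrum ℂ (diagonal fun i => (s i : ℂ) : Matrix a a ℂ) :=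
      spectrum.algebraMap_mem ℂ hx
    rw [spectrum_diagonal] at hx'
    obtain ⟨i, hi⟩ := hx'
    exact ⟨i, by simpa using hi⟩
  have hcongr : cfc f (diagonal fun i => (s i : ℂ) : Matrix a a ℂ) =
      cfc (fun x => p.eval x) (diagonal fun i => (s i : ℂ) : Matrix a a ℂ) := by
    refine cfc_congr fun x hx => ?_
    obtain ⟨i, rfl⟩ := hspec x hx
    exact (hpe i).symm
  rw [hcongr, cfc_polynomial p _ hsa]
  have hd : (diagonal fun i => (s i : ℂ) : Matrix a a ℂ) =
      diagonalAlgHom ℝ (fun i => (s i : ℂ)) := rfl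
  rw [hd, Polynomial.aeval_algHom_apply, diagonalAlgHom_apply]
  congr 1
  ext i
  rw [← hpe i]
  have := Polynomial.aeval_algHom_apply (Pi.evalAlgHom ℝ (fun _ : a => ℂ) i)
    (fun i => (s i : ℂ)) p
  rw [Pi.evalAlgHom_apply, Pi.evalAlgHom_apply] at this
  rw [← this]
  exact Polynomial.aeval_algebraMap_apply_eq_algebraMap_eval (s i) p

theorem IsState.diag_nonneg {ρ : Matrix a a ℂ} (h : IsState ρ) (i : a) : 0 ≤ (ρ i i).re :=
  (Complex.le_def.1 h.1.diag_nonneg).1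

theorem IsState.diag_eq {ρ : Matrix a a ℂ} (h : IsState ρ) (i : a) :
    ρ i i = ((ρ i i).re : ℂ) := by
  have := (Complex.le_def.1 (h.1.diag_nonneg (i := i))).2
  apply Complex.ext <;> simp [← this]

theorem IsState.sum_diag {ρ : Matrix a a ℂ} (h : IsState ρ) : ∑ i, (ρ i i).re = 1 := by
  have := congrArg Complex.re h.2
  simpa [Matrix.trace] using this

theorem IsState.dephase {ρ : Matrix a a ℂ} (h : IsState ρ) : IsIncoherentState (dephase ρ) := by
  refine ⟨⟨?_, ?_⟩, isDiag_diagonal _⟩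
  · exact PosSemidef.diagonal fun i => h.1.diag_nonneg
  · simpa [CoherenceTheory.dephase, Matrix.trace] using h.2

theorem IsIncoherentState.eq_diagonal {σ : Matrix a a ℂ} (h : IsIncoherentState σ) :
    σ = diagonal fun i => ((σ i i).re : ℂ) := by
  ext i j
  by_cases hij : i = j
  · subst hij
    rw [diagonal_apply_eq]
    exact h.1.diag_eq i
  · rw [diagonal_apply_ne _ hij]
    exact h.2 hij

theorem trace_mul_cfc_log_diagonal (ρ : Matrix a a ℂ) (s : a → ℝ) :
    (ρ * cfc Real.log (diagonal fun i => (s i : ℂ))).trace.re =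
      ∑ i, (ρ i i).re * Real.log (s i) := by
  rw [cfc_diagonal_ofReal]
  simp only [Matrix.trace, diag_apply, mul_diagonal, Complex.re_sum, Complex.re_mul_ofReal]

theorem entropy_dephase {ρ : Matrix a a ℂ} (h : IsState ρ) :
    entropy (dephase ρ) = -(∑ i, (ρ i i).re * Real.log (ρ i i).re) / Real.log 2 := by
  have hd : dephase ρ = diagonal fun i => ((ρ i i).re : ℂ) := by
    unfold CoherenceTheory.dephase
    congr 1
    ext i
    exact h.diag_eq i
  rw [entropy, hd, trace_mul_cfc_log_diagonal]
  simp

theorem support_le_dephase {ρ : Matrix a a ℂ} (h : IsState ρ) (v : a → ℂ)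
    (hv : dephase ρ *ᵥ v = 0) : ρ *ᵥ v = 0 := by
  have hcol : ∀ j, v j ≠ 0 → ∀ i, ρ i j = 0 := by
    intro j hj i
    have h1 := congrFun hv j
    rw [CoherenceTheory.dephase, mulVec_diagonal] at h1
    have h2 : ρ j j = 0 := by simpa [hj] using h1
    have h3 : star (Pi.single j (1 : ℂ)) ⬝ᵥ (ρ *ᵥ Pi.single j 1) = 0 := by
      simp [h2]
    have h4 := congrFun (h.1.dotProduct_mulVec_zero_iff _ |>.1 h3) i
    simpa using h4
  ext i
  simp only [mulVec, dotProduct, Pi.zero_apply]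
  refine Finset.sum_eq_zero fun j _ => ?_
  by_cases hj : v j = 0
  · simp [hj]
  · simp [hcol j hj i]

/-- The minimum in the definition of the relative entropy of coherence is `S(Δ(ρ)) - S(ρ)`. -/
theorem relEntropyCoherence_eq {ρ : Matrix a a ℂ} (h : IsState ρ) :
    relEntropyCoherence ρ = entropy (dephase ρ) - entropy ρ := by
  have hlog2 : 0 < Real.log 2 := Real.log_pos one_lt_two
  have hval : ∀ s : a → ℝ, (ρ * (cfc Real.log ρ - cfc Real.log (diagonal fun i => (s i : ℂ)))).trace.re
      / Real.log 2 = -(∑ i, (ρ i i).re * Real.log (s i)) / Real.log 2 - entropy ρ := by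
    intro s
    rw [mul_sub, trace_sub, Complex.sub_re, trace_mul_cfc_log_diagonal, entropy]
    ring
  have key : (⨅ σ : {σ : Matrix a a ℂ // IsIncoherentState σ}, relEntropy ρ σ) =
      ((entropy (dephase ρ) - entropy ρ : ℝ) : EReal) := by
    apply le_antisymm
    · refine (iInf_le _ ⟨dephase ρ, h.dephase⟩).trans ?_
      rw [relEntropy, if_pos (support_le_dephase h)]
      have hd : dephase ρ = diagonal fun i => ((ρ i i).re : ℂ) := by
        unfold CoherenceTheory.dephase
        congr 1
        ext i
        exact h.diag_eq i
      rw [entropy_dephase h]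
      simp only [hd]
      rw [hval]
    · refine le_iInf fun ⟨σ, hσ⟩ => ?_
      rw [relEntropy]
      split_ifs with hsupp
      · have hd := hσ.eq_diagonal
        have hzero : ∀ i, (σ i i).re = 0 → (ρ i i).re = 0 := by
          intro i hi
          have h1 : σ *ᵥ Pi.single i 1 = 0 := by
            rw [hd]
            ext j
            by_cases hj : j = i
            · subst hj
              simp [mulVec_diagonal, hi]
            · simp [mulVec_diagonal, hj]
          have h2 := congrFun (hsupp _ h1) i
          simp at h2
          simp [h2]
        have hgibbs : ∑ i, (ρ i i).re * Real.log (σ i i).re ≤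
            ∑ i, (ρ i i).re * Real.log (ρ i i).re := by
          have hterm : ∀ i, (ρ i i).re * Real.log (σ i i).re - (ρ i i).re * Real.log (ρ i i).re ≤
              (σ i i).re - (ρ i i).re := by
            intro i
            rcases (h.diag_nonneg i).eq_or_lt with hp | hp
            · rw [← hp]
              simpa using hσ.1.diag_nonneg i
            · have hs : 0 < (σ i i).re :=
                (hσ.1.diag_nonneg i).lt_of_ne fun hs => hp.ne' (hzero i hs.symm)
              have := Real.log_le_sub_one_of_pos (div_pos hs hp)
              rw [Real.log_div hs.ne' hp.ne'] at this
              have h3 := mul_le_mul_of_nonneg_left this hp.le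
              have h4 : (ρ i i).re * ((σ i i).re / (ρ i i).re - 1) = (σ i i).re - (ρ i i).re := by
                field_simp
              linarith
          have hsum := Finset.sum_le_sum fun i (_ : i ∈ Finset.univ) => hterm i
          rw [Finset.sum_sub_distrib, Finset.sum_sub_distrib, h.sum_diag, hσ.1.sum_diag] at hsum
          linarith
        rw [EReal.coe_le_coe_iff, entropy_dephase h]
        have hv := hval fun i => (σ i i).re
        rw [← hd] at hv
        rw [hv]
        gcongr
      · exact le_top
  rw [relEntropyCoherence, key, EReal.toReal_coe]

end RelEntropyCoherence

section Maps

variable {a b : Type*}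

/-- The map `T ⊗ id_c`. -/
def tensorId (T : Matrix a a ℂ →ₗ[ℂ] Matrix b b ℂ) (c : Type*) :
    Matrix (a × c) (a × c) ℂ →ₗ[ℂ] Matrix (b × c) (b × c) ℂ where
  toFun ρ := of fun x y => T (of fun i j => ρ (i, x.2) (j, y.2)) x.1 y.1
  map_add' ρ σ := by
    ext x y
    have h : (of fun i j => (ρ + σ) (i, x.2) (j, y.2) : Matrix a a ℂ) =
        (of fun i j => ρ (i, x.2) (j, y.2)) + of fun i j => σ (i, x.2) (j, y.2) := rfl
    rw [of_apply, h, map_add]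
    rfl
  map_smul' r ρ := by
    ext x y
    have h : (of fun i j => (r • ρ) (i, x.2) (j, y.2) : Matrix a a ℂ) =
        r • of fun i j => ρ (i, x.2) (j, y.2) := rfl
    rw [of_apply, h, map_smul]
    rfl

/-- The tensor power `T^{⊗n}` on the `n`-fold composite system with index type `Fin n → a`, written
out on matrix units; see `tensorPower_prod` for its action on product operators. -/
def tensorPower [Fintype a] [DecidableEq a] (T : Matrix a a ℂ →ₗ[ℂ] Matrix b b ℂ) (n : ℕ) :
    Matrix (Fin n → a) (Fin n → a) ℂ →ₗ[ℂ] Matrix (Fin n → b) (Fin n → b) ℂ where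
  toFun ρ := of fun x y => ∑ i, ∑ j, ρ i j * ∏ l, T (single (i l) (j l) 1) (x l) (y l)
  map_add' ρ σ := by
    ext x y
    simp only [of_apply, Matrix.add_apply, add_mul, Finset.sum_add_distrib]
  map_smul' r ρ := by
    ext x y
    simp only [of_apply, Matrix.smul_apply, smul_eq_mul, mul_assoc, Finset.mul_sum,
      RingHom.id_apply]

theorem tensorPower_prod [Fintype a] [DecidableEq a] (T : Matrix a a ℂ →ₗ[ℂ] Matrix b b ℂ) (n : ℕ)
    (X : Fin n → Matrix a a ℂ) :
    tensorPower T n (of fun i j => ∏ l, X l (i l) (j l)) =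
      of fun x y => ∏ l, T (X l) (x l) (y l) := by
  ext x y
  have h : ∀ l, T (X l) (x l) (y l) =
      ∑ z : a × a, X l z.1 z.2 * T (single z.1 z.2 1) (x l) (y l) := by
    intro l
    conv_lhs => rw [matrix_eq_sum_single (X l)]
    simp only [map_sum, Matrix.sum_apply, Fintype.sum_prod_type]
    refine Finset.sum_congr rfl fun i _ => Finset.sum_congr rfl fun j _ => ?_
    have : single i j (X l i j) = X l i j • (single i j 1 : Matrix a a ℂ) := by simp
    rw [this, map_smul, Matrix.smul_apply, smul_eq_mul]
  simp only [tensorPower, LinearMap.coe_mk, AddHom.coe_mk, of_apply]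
  rw [Finset.prod_congr rfl fun l _ => h l, Fintype.prod_sum]
  rw [← Fintype.sum_prod_type', ← (Equiv.arrowProdEquivProdArrow (Fin n) (fun _ => a)
    (fun _ => a)).sum_comp]
  refine Finset.sum_congr rfl fun z _ => ?_
  simp [Equiv.arrowProdEquivProdArrow, Finset.prod_mul_distrib]

/-- The map `ρ ↦ I (ρ ⊗ ω)`, for a fixed resource state `ω`. -/
def withResource {c : Type*} (I : Matrix (a × c) (a × c) ℂ →ₗ[ℂ] Matrix b b ℂ)
    (ω : Matrix c c ℂ) : Matrix a a ℂ →ₗ[ℂ] Matrix b b ℂ where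
  toFun ρ := I (ρ ⊗ₖ ω)
  map_add' ρ σ := by rw [add_kronecker, map_add]
  map_smul' r ρ := by rw [smul_kronecker, map_smul, RingHom.id_apply]

/-- Quantum channels: completely positive and trace preserving linear maps. -/
def IsCPTP [Fintype a] [Fintype b] (T : Matrix a a ℂ →ₗ[ℂ] Matrix b b ℂ) : Prop :=
  (∀ (k : ℕ) (ρ : Matrix (a × Fin k) (a × Fin k) ℂ),
    ρ.PosSemidef → (tensorId T (Fin k) ρ).PosSemidef) ∧
  ∀ ρ, (T ρ).trace = ρ.trace

/-- Incoherent Kraus operators: `K δ K†` is diagonal for every incoherent state `δ`. -/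
def IsIncoherentKraus [Fintype a] (K : Matrix b a ℂ) : Prop :=
  ∀ δ : Matrix a a ℂ, IsIncoherentState δ → (K * δ * Kᴴ).IsDiag

/-- Incoherent operations (IO): maps with a Kraus representation by incoherent Kraus operators. -/
def IsIncoherentOperation [Fintype a] [DecidableEq a] [Fintype b]
    (I : Matrix a a ℂ →ₗ[ℂ] Matrix b b ℂ) : Prop :=
  ∃ (m : ℕ) (K : Fin m → Matrix b a ℂ),
    ∑ α, (K α)ᴴ * K α = 1 ∧ (∀ α, IsIncoherentKraus (K α)) ∧
    ∀ ρ, I ρ = ∑ α, K α * ρ * (K α)ᴴ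

variable [Fintype a] [DecidableEq a] [Fintype b] [DecidableEq b]

/-- The diamond norm: the supremum of `‖(Φ ⊗ id_c)(|φ⟩⟨φ|)‖₁` over all finite-dimensional ancillas
`c` and all unit vectors `φ` on `a ⊗ c`. -/
def diamondNorm (Φ : Matrix a a ℂ →ₗ[ℂ] Matrix b b ℂ) : EReal :=
  ⨆ (k : ℕ) (φ : {φ : a × Fin k → ℂ // IsUnitVector φ}),
    ((traceNorm (tensorId Φ (Fin k) (pureState φ.1)) : ℝ) : EReal)

/-- The relative entropy coherence power `P_r(T)`, the largest value of `C_r(T(ρ)) - C_r(ρ)`. -/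
def relEntropyPower (T : Matrix a a ℂ →ₗ[ℂ] Matrix b b ℂ) : EReal :=
  ⨆ ρ : {ρ : Matrix a a ℂ // IsState ρ},
    ((relEntropyCoherence (T ρ.1) - relEntropyCoherence ρ.1 : ℝ) : EReal)

/-- The coherence of formation power `P_f(T)`, the largest value of `C_f(T(ρ)) - C_f(ρ)`. -/
def formationPower (T : Matrix a a ℂ →ₗ[ℂ] Matrix b b ℂ) : EReal :=
  ⨆ ρ : {ρ : Matrix a a ℂ // IsState ρ},
    ((coherenceOfFormation (T ρ.1) - coherenceOfFormation ρ.1 : ℝ) : EReal)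

/-- The complete coherence power `sup_k P_r(T ⊗ id_k)`. There is no state on a system of dimension
zero, so that `k = 0` contributes nothing to the supremum. -/
def completeRelEntropyPower (T : Matrix a a ℂ →ₗ[ℂ] Matrix b b ℂ) : EReal :=
  ⨆ k : ℕ, relEntropyPower (tensorId T (Fin k))

/-- The complete coherence power `sup_k P_f(T ⊗ id_k)`. -/
def completeFormationPower (T : Matrix a a ℂ →ₗ[ℂ] Matrix b b ℂ) : EReal :=
  ⨆ k : ℕ, formationPower (tensorId T (Fin k))

/-- `Generates T t k ρ` says that `ρ` is a state on `a ⊗ ℂ^k` that can be produced by `t` uses of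
`T`: one starts from an incoherent state, and after each use of `T` an incoherent operation is
applied, which may change the dimension of the ancilla. -/
inductive Generates (T : Matrix a a ℂ →ₗ[ℂ] Matrix b b ℂ) :
    ℕ → (k : ℕ) → Matrix (a × Fin k) (a × Fin k) ℂ → Prop
  | init (k : ℕ) (ρ : Matrix (a × Fin k) (a × Fin k) ℂ) (hρ : IsIncoherentState ρ) :
      Generates T 0 k ρ
  | step (t k k' : ℕ) (ρ : Matrix (a × Fin k) (a × Fin k) ℂ) (hρ : Generates T t k ρ)
      (I : Matrix (b × Fin k) (b × Fin k) ℂ →ₗ[ℂ] Matrix (a × Fin k') (a × Fin k') ℂ)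
      (hI : IsIncoherentOperation I) :
      Generates T (t + 1) k' (I (tensorId T (Fin k) ρ))

/-- A coherence generation protocol with `n` uses of `T` that produces `Ψ_d` with error `ε`. -/
def HasGenerationProtocol (T : Matrix a a ℂ →ₗ[ℂ] Matrix b b ℂ) (n d : ℕ) (ε : ℝ) : Prop :=
  ∃ ρ : Matrix (a × Fin d) (a × Fin d) ℂ, Generates T n d ρ ∧
    1 - ε ≤ (star (maxCoherentVector d) ⬝ᵥ (traceFst ρ *ᵥ maxCoherentVector d)).re

/-- `R` is a limit of rates `(1/n) log₂ d` of coherence generation protocols with vanishing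
error. -/
def IsGenerationRate (T : Matrix a a ℂ →ₗ[ℂ] Matrix b b ℂ) (R : ℝ) : Prop :=
  ∃ (d : ℕ → ℕ) (ε : ℕ → ℝ), (∀ n, 0 < d n) ∧
    (∀ n, 1 ≤ n → HasGenerationProtocol T n (d n) (ε n)) ∧
    Tendsto ε atTop (𝓝 0) ∧ Tendsto (fun n => Real.logb 2 (d n) / n) atTop (𝓝 R)

/-- The coherence generating capacity. -/
def generatingCapacity (T : Matrix a a ℂ →ₗ[ℂ] Matrix b b ℂ) : EReal :=
  ⨆ R : {R : ℝ // IsGenerationRate T R}, ((R.1 : ℝ) : EReal)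

/-- An `n`-block incoherent simulation of `T` with error `ε` and coherent resource `Ψ_d`. -/
def HasSimulation (T : Matrix a a ℂ →ₗ[ℂ] Matrix b b ℂ) (n d : ℕ) (ε : ℝ) : Prop :=
  ∃ I : Matrix ((Fin n → a) × Fin d) ((Fin n → a) × Fin d) ℂ →ₗ[ℂ]
      Matrix (Fin n → b) (Fin n → b) ℂ,
    IsIncoherentOperation I ∧
    diamondNorm (withResource I (pureState (maxCoherentVector d)) - tensorPower T n) ≤ (ε : EReal)

/-- `R` is a limit of rates `(1/n) log₂ d` of incoherent simulations with vanishing error. -/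
def IsSimulationRate (T : Matrix a a ℂ →ₗ[ℂ] Matrix b b ℂ) (R : ℝ) : Prop :=
  ∃ (d : ℕ → ℕ) (ε : ℕ → ℝ), (∀ n, 0 < d n) ∧
    (∀ n, 1 ≤ n → HasSimulation T n (d n) (ε n)) ∧
    Tendsto ε atTop (𝓝 0) ∧ Tendsto (fun n => Real.logb 2 (d n) / n) atTop (𝓝 R)

/-- The simulation cost. -/
def simulationCost (T : Matrix a a ℂ →ₗ[ℂ] Matrix b b ℂ) : EReal :=
  ⨅ R : {R : ℝ // IsSimulationRate T R}, ((R.1 : ℝ) : EReal)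

end Maps


end CoherenceTheory

end

set_option linter.unusedSectionVars false

/-! Upper bound: take Kraus operators `K_α` of `T^{⊗n}` (Choi–Kraus) and a bijection `e` of the
output basis with the basis of `D`, `d = |B|^n`. The operators `∑_y |y⟩⟨y| K_α ⊗ ⟨e(y)+s|` are
incoherent because the label on `D` fixes the output `y`. On `Ψ_d` each acts as `K_α/√d`, so the sum
over the `d` shifts `s` gives the channel exactly (`withResource_shiftKraus`).

Lower bound: let `C` be `C_r` or `C_f`. A simulation sends `ρ^{⊗n} ⊗ Ψ_d` to a state `τ` near `((T ⊗
id)ρ)^{⊗n}`. Monotonicity of `C` under IO, subadditivity on products and `C(Ψ_d) ≤ log d` give `C(τ)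
≤ n C(ρ) + log d`. Asymptotic continuity and `n C(ω) ≤ C(ω^{⊗n})` turn this into `C((T ⊗ id)ρ) ≤
C(ρ) + R` after division by `n`. For `C_r` additivity is direct; for `C_f` the last inequality is
strong superadditivity, which is the chain rule for Shannon entropy.

Generation: `C_f` starts at 0, rises by at most the complete power `P_f` per use of `T`, and does
not rise under IO. A state close to `Ψ_d` has `C_f` at least `(1 - o(1)) log d - O(1)`. So the
generating capacity is at most the complete power `P_f`, which the lower bound places below the
simulation cost.

The substantial ingredients are: monotonicity of `C_f`, reduced to pure states in
`sum_vecEntropy_kraus_le`; monotonicity of `C_r`, which is data processing for relative entropy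
against a diagonal state, proved through a variational formula for resolvents
(`resolventForm_kraus_le`, `sum_log_le_of_resolvent_le`); and continuity of `C_f`, where an ensemble
is carried from one state to the other through square roots and controlled by Powers–Størmer
(`coherenceOfFormation_le_of_close`). -/

namespace CoherenceTheory

/-! ### Shannon entropy of unnormalized non-negative vectors. -/

section ClassicalEntropy

variable {a b ι : Type*} [Fintype a] [Fintype b] [Fintype ι]

/-- The Shannon entropy, in nats, of a non-negative vector that need not be normalized; it is
homogeneous of degree one. -/
noncomputable def massEntropy (f : a → ℝ) : ℝ :=
  ∑ i, Real.negMulLog (f i) - Real.negMulLog (∑ i, f i)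

theorem massEntropy_eq_sum (f : a → ℝ) :
    massEntropy f = ∑ i, f i * (Real.log (∑ j, f j) - Real.log (f i)) := by
  simp only [massEntropy, Real.negMulLog, mul_sub, Finset.sum_sub_distrib, ← Finset.sum_mul]
  simp [Finset.sum_neg_distrib]
  ring

theorem massEntropy_nonneg {f : a → ℝ} (hf : ∀ i, 0 ≤ f i) : 0 ≤ massEntropy f := by
  rw [massEntropy_eq_sum]
  refine Finset.sum_nonneg fun i _ => ?_
  rcases (hf i).eq_or_lt with h | h
  · simp [← h]
  · refine mul_nonneg h.le (sub_nonneg.2 (Real.log_le_log h ?_))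
    exact Finset.single_le_sum (f := f) (fun j _ => hf j) (Finset.mem_univ i)

theorem massEntropy_const_mul (c : ℝ) (f : a → ℝ) :
    massEntropy (fun i => c * f i) = c * massEntropy f := by
  simp only [massEntropy, ← Finset.mul_sum, Real.negMulLog_mul, Finset.sum_add_distrib,
    ← Finset.sum_mul]
  ring

/-- Gibbs' inequality. -/
theorem massEntropy_le_cross {f g : a → ℝ} (hf : ∀ i, 0 ≤ f i) (hg : ∀ i, 0 ≤ g i)
    (h : ∀ i, g i = 0 → f i = 0) :
    massEntropy f ≤ ∑ i, f i * (Real.log (∑ j, g j) - Real.log (g i)) := by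
  rw [massEntropy_eq_sum]
  set F := ∑ j, f j with hF
  set G := ∑ j, g j with hG
  have key : ∀ i, f i * (Real.log F - Real.log (f i)) - f i * (Real.log G - Real.log (g i)) ≤
      F * g i / G - f i := by
    intro i
    rcases (hf i).eq_or_lt with hi | hi
    · rw [← hi]
      have : 0 ≤ F * g i / G := div_nonneg (mul_nonneg (Finset.sum_nonneg fun j _ => hf j) (hg i))
        (Finset.sum_nonneg fun j _ => hg j)
      simpa using this
    · have hgi : 0 < g i := (hg i).lt_of_ne fun hh => hi.ne' (h i hh.symm)
      have hFp : 0 < F := hi.trans_le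
        (Finset.single_le_sum (f := f) (fun j _ => hf j) (Finset.mem_univ i))
      have hGp : 0 < G := hgi.trans_le
        (Finset.single_le_sum (f := g) (fun j _ => hg j) (Finset.mem_univ i))
      have h1 := Real.log_le_sub_one_of_pos (show 0 < F * g i / (G * f i) by positivity)
      rw [Real.log_div (by positivity) (by positivity), Real.log_mul hFp.ne' hgi.ne',
        Real.log_mul hGp.ne' hi.ne'] at h1
      have h2 := mul_le_mul_of_nonneg_left h1 hi.le
      have h3 : f i * (F * g i / (G * f i) - 1) = F * g i / G - f i := by field_simp
      linarith
  have hsum := Finset.sum_le_sum fun i (_ : i ∈ Finset.univ) => key i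
  rw [Finset.sum_sub_distrib, Finset.sum_sub_distrib, ← Finset.sum_div, ← Finset.mul_sum, ← hF,
    ← hG] at hsum
  have : F * G / G - F ≤ 0 := by
    rcases eq_or_ne G 0 with h0 | h0
    · simpa [h0] using Finset.sum_nonneg fun j (_ : j ∈ Finset.univ) => hf j
    · simp [h0]
  linarith

theorem massEntropy_le_neg_log {f g : a → ℝ} (hf : ∀ i, 0 ≤ f i) (hg : ∀ i, 0 ≤ g i)
    (h : ∀ i, g i = 0 → f i = 0) (hg1 : ∑ i, g i ≤ 1) :
    massEntropy f ≤ ∑ i, f i * -Real.log (g i) := by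
  refine (massEntropy_le_cross hf hg h).trans (Finset.sum_le_sum fun i _ => ?_)
  refine mul_le_mul_of_nonneg_left ?_ (hf i)
  have := Real.log_nonpos (Finset.sum_nonneg fun j _ => hg j) hg1
  linarith

theorem massEntropy_le_log_card {f : a → ℝ} (hf : ∀ i, 0 ≤ f i) :
    massEntropy f ≤ (∑ i, f i) * Real.log (Fintype.card a) := by
  refine (massEntropy_le_cross (g := fun _ => 1) hf (fun _ => zero_le_one)
    fun i h => absurd h one_ne_zero).trans ?_
  simp [Finset.sum_mul]

/-- Gibbs' inequality against `g` bounds the left side by `∑ f_i log(G/g_i)` with `G = ∑ g_j`; these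
logarithms are non-negative where `g_i > 0`, so `f_i` may be raised to `g_i`. -/
theorem massEntropy_mono {f g : a → ℝ} (hf : ∀ i, 0 ≤ f i) (h : ∀ i, f i ≤ g i) :
    massEntropy f ≤ massEntropy g := by
  have hg : ∀ i, 0 ≤ g i := fun i => (hf i).trans (h i)
  refine (massEntropy_le_cross hf hg fun i hi => le_antisymm (hi ▸ h i) (hf i)).trans ?_
  rw [massEntropy_eq_sum]
  refine Finset.sum_le_sum fun i _ => ?_
  rcases (hg i).eq_or_lt with h0 | h0
  · have : f i = 0 := le_antisymm (h0 ▸ h i) (hf i)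
    simp [this, ← h0]
  · refine mul_le_mul_of_nonneg_right (h i) (sub_nonneg.2 (Real.log_le_log h0 ?_))
    exact Finset.single_le_sum (f := g) (fun j _ => hg j) (Finset.mem_univ i)

/-- Concavity of entropy in homogeneous form: Gibbs' inequality for each `f j` against the common
total vector. It also says that conditioning does not increase entropy. -/
theorem sum_massEntropy_le {f : ι → a → ℝ} (hf : ∀ j i, 0 ≤ f j i) :
    ∑ j, massEntropy (f j) ≤ massEntropy fun i => ∑ j, f j i := by
  have h1 : ∀ j, massEntropy (f j) ≤ ∑ i, f j i * (Real.log (∑ i, ∑ j, f j i) -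
      Real.log (∑ j, f j i)) := fun j =>
    massEntropy_le_cross (g := fun i => ∑ j, f j i) (hf j)
      (fun i => Finset.sum_nonneg fun j _ => hf j i)
      fun i hi => (Finset.sum_eq_zero_iff_of_nonneg fun j _ => hf j i).1 hi j (Finset.mem_univ j)
  refine (Finset.sum_le_sum fun j _ => h1 j).trans_eq ?_
  rw [Finset.sum_comm, massEntropy_eq_sum]
  simp only [Finset.sum_mul]

theorem negMulLog_add_le {x y : ℝ} (hx : 0 ≤ x) (hy : 0 ≤ y) :
    Real.negMulLog (x + y) ≤ Real.negMulLog x + Real.negMulLog y := by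
  have key : ∀ {u v : ℝ}, 0 ≤ u → 0 ≤ v → u * Real.log u ≤ u * Real.log (u + v) := by
    intro u v hu hv
    rcases hu.eq_or_lt with h | h
    · simp [← h]
    · exact mul_le_mul_of_nonneg_left (Real.log_le_log h (by linarith)) hu
  have h1 := key hx hy
  have h2 := key hy hx
  rw [add_comm y x] at h2
  simp only [Real.negMulLog]
  linarith

/-- Midpoint concavity, with the factor `1/2` pulled out by the product rule for `negMulLog`; the
loss `log 2` per unit of mass is the entropy of a fair bit. -/
theorem negMulLog_add_ge {x y : ℝ} (hx : 0 ≤ x) (hy : 0 ≤ y) :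
    Real.negMulLog x + Real.negMulLog y - (x + y) * Real.log 2 ≤ Real.negMulLog (x + y) := by
  obtain ⟨-, hc⟩ := Real.concaveOn_negMulLog
  have h := hc (Set.mem_Ici.2 hx) (Set.mem_Ici.2 hy) (show (0 : ℝ) ≤ 1 / 2 by norm_num)
    (show (0 : ℝ) ≤ 1 / 2 by norm_num) (by norm_num)
  have h2 := Real.negMulLog_mul (1 / 2) (x + y)
  have h3 : Real.negMulLog (1 / 2) = 1 / 2 * Real.log 2 := by
    simp [Real.negMulLog, Real.log_inv]
  simp only [smul_eq_mul] at h
  rw [← mul_add, ← mul_add, h2, h3] at h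
  linarith

theorem massEntropy_add_le {f g : a → ℝ} (hf : ∀ i, 0 ≤ f i) (hg : ∀ i, 0 ≤ g i) :
    massEntropy (fun i => f i + g i) ≤
      massEntropy f + massEntropy g + (∑ i, f i + ∑ i, g i) * Real.log 2 := by
  have h1 := Finset.sum_le_sum fun i (_ : i ∈ Finset.univ) => negMulLog_add_le (hf i) (hg i)
  have h2 := negMulLog_add_ge (Finset.sum_nonneg fun i (_ : i ∈ Finset.univ) => hf i)
    (Finset.sum_nonneg fun i (_ : i ∈ Finset.univ) => hg i)
  simp only [massEntropy, Finset.sum_add_distrib] at h1 h2 ⊢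
  linarith

/-- Uniform continuity of the conditional Shannon entropy. -/
theorem sum_massEntropy_le_of_close {f g : ι → a → ℝ} (hf : ∀ j i, 0 ≤ f j i)
    (hg : ∀ j i, 0 ≤ g j i) {δ : ℝ} (hδ : ∑ j, ∑ i, |g j i - f j i| ≤ δ)
    (hf1 : ∑ j, ∑ i, f j i = 1) [Nonempty a] :
    ∑ j, massEntropy (g j) ≤ ∑ j, massEntropy (f j) + δ * Real.log (Fintype.card a) +
      (1 + δ) * Real.log 2 := by
  have hl : 0 ≤ Real.log (Fintype.card a) :=
    Real.log_nonneg (by exact_mod_cast Fintype.card_pos)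
  have hl2 : 0 ≤ Real.log 2 := Real.log_nonneg one_le_two
  have h : ∀ j, massEntropy (g j) ≤ massEntropy (f j) +
      (∑ i, |g j i - f j i|) * Real.log (Fintype.card a) +
      (∑ i, f j i + ∑ i, |g j i - f j i|) * Real.log 2 := by
    intro j
    -- Since entropy is monotone in the vector, the domination `g ≤ f + |g - f|` suffices. The
    -- resulting bound keeps a term `log 2` even at `δ = 0`, which is harmless because it will be
    -- divided by the number of copies.
    have h1 := massEntropy_mono (f := g j) (g := fun i => f j i + |g j i - f j i|) (hg j)
      fun i => by have := le_abs_self (g j i - f j i); linarith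
    have h2 := massEntropy_add_le (hf j) fun i => abs_nonneg (g j i - f j i)
    have h3 := massEntropy_le_log_card fun i => abs_nonneg (g j i - f j i)
    linarith
  have hs := Finset.sum_le_sum fun j (_ : j ∈ Finset.univ) => h j
  simp only [Finset.sum_add_distrib, ← Finset.sum_mul, hf1] at hs
  have h4 := mul_le_mul_of_nonneg_right hδ hl
  have h5 := mul_le_mul_of_nonneg_right hδ hl2
  linarith

/-- The chain rule `H(X,Y) = H(X) + H(Y|X)`; homogeneity makes the second sum the conditional
entropy without normalizing the slices. -/
theorem massEntropy_prod (f : a × b → ℝ) :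
    massEntropy f = massEntropy (fun x => ∑ y, f (x, y)) + ∑ x, massEntropy fun y => f (x, y) := by
  simp only [massEntropy, Fintype.sum_prod_type, Finset.sum_sub_distrib]
  ring

theorem massEntropy_mul (f : a → ℝ) (g : b → ℝ) :
    massEntropy (fun z : a × b => f z.1 * g z.2) =
      (∑ y, g y) * massEntropy f + (∑ x, f x) * massEntropy g := by
  rw [massEntropy_prod]
  simp only [← Finset.mul_sum, massEntropy_const_mul, ← Finset.sum_mul]
  simp only [mul_comm _ (∑ i, g i), massEntropy_const_mul]

theorem massEntropy_of_sum_eq_one {f : a → ℝ} (h : ∑ i, f i = 1) :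
    massEntropy f = ∑ i, Real.negMulLog (f i) := by
  simp [massEntropy, h]

end ClassicalEntropy

/-! ### Pure state ensembles as families of unnormalized vectors. -/

section Ensembles

variable {a b c ι κ : Type*} [Fintype a] [Fintype b] [Fintype c] [Fintype ι] [Fintype κ]

/-- The vectors `V j`, not normalized, form a pure state decomposition of `ρ`. -/
def IsEnsemble (V : ι → a → ℂ) (ρ : Matrix a a ℂ) : Prop :=
  ∀ x y, ρ x y = ∑ j, V j x * star (V j y)

/-- The entropy of coherence, in nats, of a vector that need not be normalized. -/
noncomputable def vecEntropy (v : a → ℂ) : ℝ :=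
  massEntropy fun i => ‖v i‖ ^ 2

theorem vecEntropy_nonneg (v : a → ℂ) : 0 ≤ vecEntropy v :=
  massEntropy_nonneg fun _ => sq_nonneg _

theorem vecEntropy_smul (c : ℂ) (v : a → ℂ) : vecEntropy (c • v) = ‖c‖ ^ 2 * vecEntropy v := by
  simp only [vecEntropy, Pi.smul_apply, smul_eq_mul, norm_mul, mul_pow, massEntropy_const_mul]

theorem mul_star_self_eq (z : ℂ) : z * star z = ((‖z‖ ^ 2 : ℝ) : ℂ) := by
  rw [Complex.star_def, Complex.mul_conj, Complex.normSq_eq_norm_sq]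

theorem IsEnsemble.diag_eq {V : ι → a → ℂ} {ρ : Matrix a a ℂ} (h : IsEnsemble V ρ) (x : a) :
    ρ x x = ((∑ j, ‖V j x‖ ^ 2 : ℝ) : ℂ) := by
  rw [h x x, Complex.ofReal_sum]
  exact Finset.sum_congr rfl fun j _ => mul_star_self_eq _

theorem IsEnsemble.sum_norm_sq {V : ι → a → ℂ} {ρ : Matrix a a ℂ} (h : IsEnsemble V ρ)
    (hρ : ρ.trace = 1) : ∑ j, ∑ x, ‖V j x‖ ^ 2 = 1 := by
  have h1 : ((∑ x, ∑ j, ‖V j x‖ ^ 2 : ℝ) : ℂ) = 1 := by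
    rw [← hρ, Matrix.trace, Complex.ofReal_sum]
    exact Finset.sum_congr rfl fun x _ => (h.diag_eq x).symm
  rw [Finset.sum_comm]
  exact_mod_cast h1

theorem IsEnsemble.posSemidef {V : ι → a → ℂ} {ρ : Matrix a a ℂ} (h : IsEnsemble V ρ) :
    ρ.PosSemidef := by
  have : ρ = (of fun x j => V j x : Matrix a ι ℂ) * (of fun x j => V j x : Matrix a ι ℂ)ᴴ := by
    ext x y
    simp [h x y, mul_apply]
  rw [this]
  exact posSemidef_self_mul_conjTranspose _

theorem exists_isEnsemble {ρ : Matrix a a ℂ} (h : ρ.PosSemidef) :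
    ∃ V : a → a → ℂ, IsEnsemble V ρ := by
  classical
  open scoped MatrixOrder Matrix.Norms.L2Operator in
  obtain ⟨B, hB⟩ := CStarAlgebra.nonneg_iff_eq_star_mul_self.1 h.nonneg
  refine ⟨fun j x => star (B j x), fun x y => ?_⟩
  simp [hB, mul_apply, star_eq_conjTranspose]

theorem IsUnitVector.isState {ψ : a → ℂ} (h : IsUnitVector ψ) : IsState (pureState ψ) := by
  refine ⟨posSemidef_vecMulVec_self_star ψ, ?_⟩
  simp only [pureState, Matrix.trace, diag_apply, vecMulVec_apply, Pi.star_apply,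
    mul_star_self_eq]
  exact_mod_cast h

theorem IsUnitVector.entropyOfCoherence [DecidableEq a] {ψ : a → ℂ} (h : IsUnitVector ψ) :
    entropyOfCoherence ψ = vecEntropy ψ / Real.log 2 := by
  have hd : ∀ i, (pureState ψ i i).re = ‖ψ i‖ ^ 2 := fun i => by
    rw [pureState, vecMulVec_apply, Pi.star_apply, mul_star_self_eq, Complex.ofReal_re]
  rw [CoherenceTheory.entropyOfCoherence, entropy_dephase h.isState, vecEntropy,
    massEntropy_of_sum_eq_one h]
  simp [hd, Real.negMulLog]

theorem IsEnsemble.exists_normalized [DecidableEq a] {ρ : Matrix a a ℂ} {V : ι → a → ℂ}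
    (h : IsEnsemble V ρ) (hρ : ρ.trace = 1) :
    ∃ (m : ℕ) (p : Fin m → ℝ) (ψ : Fin m → a → ℂ),
      (∀ j, 0 ≤ p j) ∧ ∑ j, p j = 1 ∧ (∀ j, IsUnitVector (ψ j)) ∧
      ρ = ∑ j, (p j : ℂ) • pureState (ψ j) ∧
      (∑ j, vecEntropy (V j)) / Real.log 2 = ∑ j, p j * entropyOfCoherence (ψ j) := by
  have ha : Nonempty a := by
    by_contra hc
    rw [not_nonempty_iff] at hc
    simp [Matrix.trace] at hρ
  obtain ⟨i₀⟩ := ha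
  set p : ι → ℝ := fun j => ∑ x, ‖V j x‖ ^ 2 with hp
  have hp0 : ∀ j, 0 ≤ p j := fun j => Finset.sum_nonneg fun x _ => sq_nonneg _
  -- A zero vector has weight 0 but still needs a unit vector beside it; an arbitrary basis vector
  -- serves.
  set ψ : ι → a → ℂ := fun j => if p j = 0 then Pi.single i₀ 1 else
    (((Real.sqrt (p j))⁻¹ : ℝ) : ℂ) • V j with hψ
  have hz : ∀ j, p j = 0 → V j = 0 := by
    intro j hj
    ext x
    have := (Finset.sum_eq_zero_iff_of_nonneg fun x _ => sq_nonneg ‖V j x‖).1 hj x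
      (Finset.mem_univ x)
    simpa using this
  have hu : ∀ j, IsUnitVector (ψ j) := by
    intro j
    by_cases hj : p j = 0
    · simp [IsUnitVector, hψ, hj, Pi.single_apply, apply_ite]
    · simp only [IsUnitVector, hψ, hj, if_false, Pi.smul_apply, smul_eq_mul, norm_mul, mul_pow,
        ← Finset.mul_sum, Complex.norm_real, Real.norm_eq_abs, sq_abs, inv_pow,
        Real.sq_sqrt (hp0 j)]
      exact inv_mul_cancel₀ hj
  have hV : ∀ j, V j = ((Real.sqrt (p j) : ℝ) : ℂ) • ψ j := by
    intro j
    by_cases hj : p j = 0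
    · simp [hz j hj, hj]
    · have h1 : Real.sqrt (p j) ≠ 0 := by
        rw [Real.sqrt_ne_zero (hp0 j)]
        exact hj
      simp only [hψ, hj, if_false, smul_smul, ← Complex.ofReal_mul, mul_inv_cancel₀ h1,
        Complex.ofReal_one, one_smul]
  have hE : ∀ j, p j * entropyOfCoherence (ψ j) = vecEntropy (V j) / Real.log 2 := by
    intro j
    conv_rhs => rw [hV j]
    rw [vecEntropy_smul, (hu j).entropyOfCoherence, Complex.norm_real, Real.norm_eq_abs, sq_abs,
      Real.sq_sqrt (hp0 j), mul_div_assoc]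
  let e := Fintype.equivFin ι
  refine ⟨Fintype.card ι, fun j => p (e.symm j), fun j => ψ (e.symm j),
    fun j => hp0 _, ?_, fun j => hu _, ?_, ?_⟩
  · rw [e.symm.sum_comp p]
    exact h.sum_norm_sq hρ
  · rw [e.symm.sum_comp fun j => (p j : ℂ) • pureState (ψ j)]
    ext x y
    rw [h x y, Matrix.sum_apply]
    refine Finset.sum_congr rfl fun j _ => ?_
    conv_lhs => rw [hV j]
    simp only [Pi.smul_apply, smul_eq_mul, Matrix.smul_apply, pureState, vecMulVec_apply,
      Pi.star_apply, star_mul']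
    rw [show (p j : ℂ) = ((Real.sqrt (p j) : ℝ) : ℂ) * star ((Real.sqrt (p j) : ℝ) : ℂ) by
      rw [mul_star_self_eq, Complex.norm_real, Real.norm_eq_abs, sq_abs, Real.sq_sqrt (hp0 j)]]
    ring
  · rw [e.symm.sum_comp fun j => p j * entropyOfCoherence (ψ j), Finset.sum_div]
    exact Finset.sum_congr rfl fun j _ => (hE j).symm

theorem coherenceOfFormation_le [DecidableEq a] {ρ : Matrix a a ℂ} {V : ι → a → ℂ}
    (h : IsEnsemble V ρ) (hρ : ρ.trace = 1) :
    coherenceOfFormation ρ ≤ (∑ j, vecEntropy (V j)) / Real.log 2 := by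
  refine csInf_le ⟨0, ?_⟩ (h.exists_normalized hρ)
  rintro x ⟨m, q, φ, hq, -, hφ, -, rfl⟩
  refine Finset.sum_nonneg fun j _ => mul_nonneg (hq j) ?_
  rw [(hφ j).entropyOfCoherence]
  exact div_nonneg (vecEntropy_nonneg _) (Real.log_pos one_lt_two).le

theorem exists_isEnsemble_lt [DecidableEq a] {ρ : Matrix a a ℂ} (hρ : IsState ρ) {η : ℝ}
    (hη : 0 < η) : ∃ (m : ℕ) (V : Fin m → a → ℂ), IsEnsemble V ρ ∧
      (∑ j, vecEntropy (V j)) / Real.log 2 < coherenceOfFormation ρ + η := by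
  obtain ⟨W, hW⟩ := exists_isEnsemble hρ.1
  have hlt : coherenceOfFormation ρ < coherenceOfFormation ρ + η := by linarith
  conv_lhs at hlt => rw [coherenceOfFormation]
  obtain ⟨x, ⟨m, p, ψ, hp, -, hψ, h, rfl⟩, hx⟩ :=
    exists_lt_of_csInf_lt (by exact ⟨_, hW.exists_normalized hρ.2⟩) hlt
  refine ⟨m, fun j => ((Real.sqrt (p j) : ℝ) : ℂ) • ψ j, fun x y => ?_, ?_⟩
  · rw [h, Matrix.sum_apply]
    refine Finset.sum_congr rfl fun j _ => ?_
    simp only [Pi.smul_apply, smul_eq_mul, Matrix.smul_apply, pureState, vecMulVec_apply,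
      Pi.star_apply, star_mul']
    rw [show (p j : ℂ) = ((Real.sqrt (p j) : ℝ) : ℂ) * star ((Real.sqrt (p j) : ℝ) : ℂ) by
      rw [mul_star_self_eq, Complex.norm_real, Real.norm_eq_abs, sq_abs, Real.sq_sqrt (hp j)]]
    ring
  · refine lt_of_eq_of_lt ?_ hx
    rw [Finset.sum_div]
    refine Finset.sum_congr rfl fun j _ => ?_
    rw [vecEntropy_smul, (hψ j).entropyOfCoherence, Complex.norm_real, Real.norm_eq_abs, sq_abs,
      Real.sq_sqrt (hp j), mul_div_assoc]

end Ensembles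

/-! ### Subadditivity and strong superadditivity of the coherence of formation. -/

section FormationProperties

variable {a b c ι κ : Type*} [Fintype a] [Fintype b] [Fintype c] [Fintype ι] [Fintype κ]

/-- The partial trace over the second factor. -/
def traceSnd (ρ : Matrix (a × c) (a × c) ℂ) : Matrix a a ℂ :=
  of fun x y => ∑ i, ρ (x, i) (y, i)

/-- Tracing out a factor is measuring it in the fixed basis and forgetting the outcome, so the
slices of the ensemble vectors form an ensemble. -/
theorem IsEnsemble.traceFst {V : ι → a × c → ℂ} {ρ : Matrix (a × c) (a × c) ℂ}
    (h : IsEnsemble V ρ) :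
    IsEnsemble (fun z : ι × a => fun y => V z.1 (z.2, y)) (traceFst ρ) := by
  intro x y
  simp only [CoherenceTheory.traceFst, of_apply, h _ _, Fintype.sum_prod_type]
  exact Finset.sum_comm

theorem IsEnsemble.traceSnd {V : ι → a × c → ℂ} {ρ : Matrix (a × c) (a × c) ℂ}
    (h : IsEnsemble V ρ) :
    IsEnsemble (fun z : ι × c => fun x => V z.1 (x, z.2)) (traceSnd ρ) := by
  intro x y
  simp only [CoherenceTheory.traceSnd, of_apply, h _ _, Fintype.sum_prod_type]
  exact Finset.sum_comm

theorem trace_traceFst (ρ : Matrix (a × c) (a × c) ℂ) : (traceFst ρ).trace = ρ.trace := by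
  simp only [Matrix.trace, diag_apply, traceFst, of_apply, Fintype.sum_prod_type]
  exact Finset.sum_comm

theorem trace_traceSnd (ρ : Matrix (a × c) (a × c) ℂ) : (traceSnd ρ).trace = ρ.trace := by
  simp only [Matrix.trace, diag_apply, traceSnd, of_apply, Fintype.sum_prod_type]

theorem IsEnsemble.prod {V : ι → a → ℂ} {W : κ → c → ℂ} {ρ : Matrix a a ℂ} {σ : Matrix c c ℂ}
    (hV : IsEnsemble V ρ) (hW : IsEnsemble W σ) :
    IsEnsemble (fun z : ι × κ => fun x => V z.1 x.1 * W z.2 x.2) (ρ ⊗ₖ σ) := by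
  intro x y
  rw [kroneckerMap_apply, hV, hW, Finset.sum_mul_sum, Fintype.sum_prod_type]
  refine Finset.sum_congr rfl fun i _ => Finset.sum_congr rfl fun j _ => ?_
  rw [star_mul']
  ring

theorem IsState.kronecker {ρ : Matrix a a ℂ} {σ : Matrix c c ℂ} (hρ : IsState ρ)
    (hσ : IsState σ) : IsState (ρ ⊗ₖ σ) := by
  obtain ⟨V, hV⟩ := exists_isEnsemble hρ.1
  obtain ⟨W, hW⟩ := exists_isEnsemble hσ.1
  exact ⟨(hV.prod hW).posSemidef, by rw [trace_kronecker, hρ.2, hσ.2, mul_one]⟩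

theorem vecEntropy_prod (v : a → ℂ) (w : c → ℂ) :
    vecEntropy (fun x : a × c => v x.1 * w x.2) =
      (∑ y, ‖w y‖ ^ 2) * vecEntropy v + (∑ x, ‖v x‖ ^ 2) * vecEntropy w := by
  simp only [vecEntropy, norm_mul, mul_pow]
  exact massEntropy_mul (fun x => ‖v x‖ ^ 2) fun y => ‖w y‖ ^ 2

theorem sum_norm_sq_eq_dotProduct (w : a → ℂ) :
    ((∑ i, ‖w i‖ ^ 2 : ℝ) : ℂ) = star w ⬝ᵥ w := by
  rw [Complex.ofReal_sum, dotProduct]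
  refine Finset.sum_congr rfl fun i _ => ?_
  rw [← mul_star_self_eq, mul_comm, Pi.star_apply]

theorem mul_pureState_mul (K : Matrix b a ℂ) (v : a → ℂ) :
    K * pureState v * Kᴴ = pureState (K *ᵥ v) := by
  rw [pureState, pureState, mul_vecMulVec, vecMulVec_mul, star_mulVec]

theorem isEnsemble_iff {V : κ → a → ℂ} {ρ : Matrix a a ℂ} :
    IsEnsemble V ρ ↔ ρ = ∑ j, pureState (V j) := by
  simp only [IsEnsemble, ← Matrix.ext_iff, Matrix.sum_apply, pureState, vecMulVec_apply,
    Pi.star_apply]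

variable [DecidableEq a] [DecidableEq b] [DecidableEq c]

theorem coherenceOfFormation_kronecker_le {ρ : Matrix a a ℂ} {σ : Matrix c c ℂ} (hρ : IsState ρ)
    (hσ : IsState σ) :
    coherenceOfFormation (ρ ⊗ₖ σ) ≤ coherenceOfFormation ρ + coherenceOfFormation σ := by
  refine le_of_forall_pos_lt_add fun η hη => ?_
  obtain ⟨m, V, hV, hV'⟩ := exists_isEnsemble_lt hρ (half_pos hη)
  obtain ⟨l, W, hW, hW'⟩ := exists_isEnsemble_lt hσ (half_pos hη)
  have h := coherenceOfFormation_le (hV.prod hW) (hρ.kronecker hσ).2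
  simp only [vecEntropy_prod, Fintype.sum_prod_type, Finset.sum_add_distrib, ← Finset.sum_mul,
    ← Finset.mul_sum, hV.sum_norm_sq hρ.2, hW.sum_norm_sq hσ.2, one_mul, add_div] at h
  linarith

/-- The coherence of formation is strongly superadditive. -/
theorem coherenceOfFormation_superadditive {ρ : Matrix (a × c) (a × c) ℂ} (hρ : IsState ρ) :
    coherenceOfFormation (traceSnd ρ) + coherenceOfFormation (traceFst ρ) ≤
      coherenceOfFormation ρ := by
  refine le_of_forall_pos_lt_add fun η hη => ?_
  obtain ⟨m, V, hV, hV'⟩ := exists_isEnsemble_lt hρ hη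
  have hlog2 : 0 < Real.log 2 := Real.log_pos one_lt_two
  have h1 := coherenceOfFormation_le hV.traceSnd ((trace_traceSnd ρ).trans hρ.2)
  have h2 := coherenceOfFormation_le hV.traceFst ((trace_traceFst ρ).trans hρ.2)
  rw [Fintype.sum_prod_type] at h1 h2
  refine lt_of_le_of_lt (add_le_add h1 h2) (lt_of_le_of_lt ?_ hV')
  rw [← add_div, ← Finset.sum_add_distrib]
  refine div_le_div_of_nonneg_right (Finset.sum_le_sum fun j _ => ?_) hlog2.le
  -- In the chain rule the conditional term is exactly the entropy of the slices for `traceFst`, and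
  -- the marginal term dominates that of the slices for `traceSnd` by concavity.
  rw [vecEntropy, massEntropy_prod]
  exact add_le_add (sum_massEntropy_le fun _ _ => sq_nonneg _) le_rfl

theorem isUnitVector_maxCoherentVector {d : ℕ} (hd : 0 < d) :
    IsUnitVector (maxCoherentVector d) := by
  have : (d : ℝ) ≠ 0 := by positivity
  simp only [IsUnitVector, maxCoherentVector, Complex.norm_real, Real.norm_eq_abs, sq_abs,
    div_pow, one_pow, Real.sq_sqrt (Nat.cast_nonneg d)]
  simp [this]

theorem isEnsemble_pureState (v : a → ℂ) : IsEnsemble (fun _ : Unit => v) (pureState v) := by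
  intro x y
  simp [pureState, vecMulVec_apply]

theorem coherenceOfFormation_maxCoherent_le {d : ℕ} (hd : 0 < d) :
    coherenceOfFormation (pureState (maxCoherentVector d)) ≤ Real.logb 2 d := by
  have hu := isUnitVector_maxCoherentVector hd
  refine (coherenceOfFormation_le (isEnsemble_pureState _) hu.isState.2).trans ?_
  rw [Real.logb]
  refine div_le_div_of_nonneg_right ?_ (Real.log_pos one_lt_two).le
  have h := massEntropy_le_log_card (f := fun i => ‖maxCoherentVector d i‖ ^ 2)
    fun i => sq_nonneg _
  rw [IsUnitVector] at hu
  simpa [hu, vecEntropy] using h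

end FormationProperties

/-! ### Monotonicity of the coherence of formation under incoherent operations. -/

section IncoherentOperations

variable {a b c ι κ : Type*} [Fintype a] [Fintype b] [Fintype c] [Fintype ι] [Fintype κ]
variable [DecidableEq a]

/-- Tested on basis states, incoherence says that each column of `K` has at most one non-zero entry.
All later arguments use this combinatorial form. -/
theorem isIncoherentKraus_iff {K : Matrix b a ℂ} :
    IsIncoherentKraus K ↔ ∀ j y y', K y j ≠ 0 → K y' j ≠ 0 → y = y' := by
  constructor
  · intro h j y y' hy hy'
    by_contra hne
    have hs : IsIncoherentState (diagonal (Pi.single j (1 : ℂ)) : Matrix a a ℂ) := by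
      refine ⟨⟨PosSemidef.diagonal fun i => ?_, by simp⟩, isDiag_diagonal _⟩
      by_cases hi : i = j
      · subst hi; simp
      · simp [hi]
    have h1 : (K * diagonal (Pi.single j (1 : ℂ)) * Kᴴ) y y' = 0 := h _ hs hne
    rw [Matrix.mul_apply] at h1
    simp only [mul_diagonal, Pi.single_apply, mul_ite, mul_one, mul_zero,
      Finset.sum_ite_eq', Finset.mem_univ, if_true, conjTranspose_apply, ite_mul, zero_mul] at h1
    rcases mul_eq_zero.1 h1 with h2 | h2
    · exact hy h2
    · exact hy' (star_eq_zero.1 h2)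
  · intro h δ hδ y y' hne
    rw [hδ.eq_diagonal]
    rw [Matrix.mul_apply]
    simp only [mul_diagonal, conjTranspose_apply]
    refine Finset.sum_eq_zero fun j _ => ?_
    by_cases h1 : K y j = 0
    · simp [h1]
    · by_cases h2 : K y' j = 0
      · simp [h2]
      · exact absurd (h j y y' h1 h2) hne

theorem isIncoherentOperation_of_kraus {I : Matrix a a ℂ →ₗ[ℂ] Matrix b b ℂ} {K : ι → Matrix b a ℂ}
    (h1 : ∑ α, (K α)ᴴ * K α = 1) (h2 : ∀ α, IsIncoherentKraus (K α))
    (h3 : ∀ ρ, I ρ = ∑ α, K α * ρ * (K α)ᴴ) : IsIncoherentOperation I := by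
  let e := Fintype.equivFin ι
  refine ⟨Fintype.card ι, fun α => K (e.symm α), ?_, fun α => h2 _, fun ρ => ?_⟩
  · rw [← h1, e.symm.sum_comp fun α => (K α)ᴴ * K α]
  · rw [h3, e.symm.sum_comp fun α => K α * ρ * (K α)ᴴ]

theorem sum_norm_sq_kraus {K : ι → Matrix b a ℂ} (hK : ∑ α, (K α)ᴴ * K α = 1) (v : a → ℂ) :
    ∑ α, ∑ y, ‖(K α *ᵥ v) y‖ ^ 2 = ∑ j, ‖v j‖ ^ 2 := by
  have h1 : ∀ α, star (K α *ᵥ v) ⬝ᵥ (K α *ᵥ v) = star v ⬝ᵥ (((K α)ᴴ * K α) *ᵥ v) := fun α => by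
    rw [star_mulVec, dotProduct_mulVec, vecMul_vecMul, ← dotProduct_mulVec]
  have h2 : ((∑ α, ∑ y, ‖(K α *ᵥ v) y‖ ^ 2 : ℝ) : ℂ) = ((∑ j, ‖v j‖ ^ 2 : ℝ) : ℂ) := by
    rw [Complex.ofReal_sum, sum_norm_sq_eq_dotProduct, Finset.sum_congr rfl fun α _ =>
      (sum_norm_sq_eq_dotProduct _).trans (h1 α),
      ← dotProduct_sum, ← sum_mulVec, hK, one_mulVec]
  exact_mod_cast h2

/-- A sum is determined by its tails: if `w` has smaller tails than `u`, then it has the smaller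
weighted sum. -/
theorem sum_mul_le_of_tail_le {r w : κ → ℝ} {p u : a → ℝ} (hw : ∀ y, 0 ≤ w y) (hu : ∀ j, 0 ≤ u j)
    (h : ∀ t, (∑ y, if t < w y then r y else 0) ≤ ∑ j, if t < u j then p j else 0) :
    ∑ y, r y * w y ≤ ∑ j, p j * u j := by
  -- A common bound for all `w y` and `u j`, so that both sums can be written as layer-cake
  -- integrals `s = ∫ 1_{t<s} dt` over the same bounded interval.
  set W := ∑ y, w y + ∑ j, u j with hW
  have hwW : ∀ y, w y ≤ W := fun y => (Finset.single_le_sum (f := w) (fun i _ => hw i)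
    (Finset.mem_univ y)).trans (le_add_of_nonneg_right (Finset.sum_nonneg fun j _ => hu j))
  have huW : ∀ j, u j ≤ W := fun j => (Finset.single_le_sum (f := u) (fun i _ => hu i)
    (Finset.mem_univ j)).trans (le_add_of_nonneg_left (Finset.sum_nonneg fun j _ => hw j))
  have key : ∀ x s : ℝ, 0 ≤ s → s ≤ W →
      MeasureTheory.IntegrableOn (fun t => if t < s then x else 0) (Set.Ioc 0 W) ∧
      ∫ t in Set.Ioc 0 W, (if t < s then x else 0) = x * s := by
    intro x s hs hsW
    have h1 : (fun t => if t < s then x else 0) = (Set.Iio s).indicator fun _ => x := by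
      ext t
      simp [Set.indicator_apply]
    rw [h1]
    refine ⟨(MeasureTheory.integrableOn_const (by simp)).indicator measurableSet_Iio, ?_⟩
    rw [MeasureTheory.setIntegral_indicator measurableSet_Iio, MeasureTheory.setIntegral_const]
    have h2 : Set.Ioc 0 W ∩ Set.Iio s = Set.Ioo 0 s := by
      ext t
      simp only [Set.mem_inter_iff, Set.mem_Ioc, Set.mem_Iio, Set.mem_Ioo]
      constructor
      · rintro ⟨⟨h1, -⟩, h2⟩; exact ⟨h1, h2⟩
      · rintro ⟨h1, h2⟩; exact ⟨⟨h1, h2.le.trans hsW⟩, h2⟩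
    rw [h2, Real.volume_real_Ioo_of_le hs, smul_eq_mul, sub_zero, mul_comm]
  calc ∑ y, r y * w y = ∫ t in Set.Ioc 0 W, ∑ y, (if t < w y then r y else 0) := by
        rw [MeasureTheory.integral_finsetSum _ fun y _ => (key (r y) (w y) (hw y) (hwW y)).1]
        exact Finset.sum_congr rfl fun y _ => (key (r y) (w y) (hw y) (hwW y)).2.symm
    _ ≤ ∫ t in Set.Ioc 0 W, ∑ j, (if t < u j then p j else 0) :=
        MeasureTheory.integral_mono
          (MeasureTheory.integrable_finsetSum _ fun y _ => (key (r y) (w y) (hw y) (hwW y)).1)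
          (MeasureTheory.integrable_finsetSum _ fun y _ => (key (p y) (u y) (hu y) (huW y)).1) h
    _ = ∑ j, p j * u j := by
        rw [MeasureTheory.integral_finsetSum _ fun y _ => (key (p y) (u y) (hu y) (huW y)).1]
        exact Finset.sum_congr rfl fun y _ => (key (p y) (u y) (hu y) (huW y)).2

/-- For each output `(α, y)` let `g` be the largest input weight `p j` over the non-zero entries of
that row. Rows of one `K α` have disjoint supports, so `∑_y g(α, y) ≤ P`, and Gibbs' inequality
against `g` bounds the output entropy by the average of `w = log P - log g`. Row `(α, y)` only sees
inputs with `u j ≥ w(α, y)`, where `u = log P - log p`, so cutting `v` off at level `t` and using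
that the Kraus family is isometric compares the tails of `w` and `u`. The average of `u` is the
input entropy. -/
theorem sum_vecEntropy_kraus_le {K : ι → Matrix b a ℂ} (hK : ∑ α, (K α)ᴴ * K α = 1)
    (hI : ∀ α, IsIncoherentKraus (K α)) (v : a → ℂ) :
    ∑ α, vecEntropy (K α *ᵥ v) ≤ vecEntropy v := by
  classical
  set p : a → ℝ := fun j => ‖v j‖ ^ 2 with hp
  set P : ℝ := ∑ j, p j with hP
  have hp0 : ∀ j, 0 ≤ p j := fun j => sq_nonneg _
  have hpP : ∀ j, p j ≤ P := fun j =>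
    Finset.single_le_sum (f := p) (fun i _ => hp0 i) (Finset.mem_univ j)
  set W : ℝ := ∑ j, |Real.log P - Real.log (p j)| with hW
  -- Where `p j = 0` the value of `u` does not affect the final sum, but it must still dominate
  -- every `w`; hence `W` in place of the logarithm.
  set u : a → ℝ := fun j => if p j = 0 then W else Real.log P - Real.log (p j) with hu
  have hW0 : 0 ≤ W := Finset.sum_nonneg fun j _ => abs_nonneg _
  have hu0 : ∀ j, 0 ≤ u j := by
    intro j
    by_cases hj : p j = 0
    · simp [hu, hj, hW0]
    · simp only [hu, hj, if_false]
      exact sub_nonneg.2 (Real.log_le_log ((hp0 j).lt_of_ne' hj) (hpP j))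
  have hm : ∀ z : ι × b, ∃ m : Option a, (∀ j, K z.1 z.2 j ≠ 0 → ∃ i ∈ m, p j ≤ p i) ∧
      ∀ i ∈ m, K z.1 z.2 i ≠ 0 := by
    intro z
    by_cases hz : ∃ j, K z.1 z.2 j ≠ 0
    · obtain ⟨i, hi, hmax⟩ := (Finset.univ.filter fun j => K z.1 z.2 j ≠ 0).exists_max_image p
        (by obtain ⟨j, hj⟩ := hz; exact ⟨j, by simpa using hj⟩)
      refine ⟨some i, fun j hj => ⟨i, rfl, hmax j (by simpa using hj)⟩, ?_⟩
      rintro _ ⟨⟩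
      simpa using hi
    · push Not at hz
      exact ⟨none, fun j hj => absurd (hz j) hj, fun i hi => by simp at hi⟩
  choose m hm1 hm2 using hm
  set g : ι × b → ℝ := fun z => (m z).elim 0 p with hg
  have hg0 : ∀ z, 0 ≤ g z := by
    intro z
    simp only [hg]
    cases m z <;> simp [hp0]
  set r : ι × b → ℝ := fun z => ‖(K z.1 *ᵥ v) z.2‖ ^ 2 with hr
  have hr0 : ∀ z, g z = 0 → r z = 0 := by
    intro z hz
    have : (K z.1 *ᵥ v) z.2 = 0 := by
      refine Finset.sum_eq_zero fun j _ => ?_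
      by_cases hj : K z.1 z.2 j = 0
      · simp [hj]
      · obtain ⟨i, hi, hle⟩ := hm1 z j hj
        have h1 : g z = p i := by
          simp only [hg, Option.mem_def.1 hi, Option.elim_some]
        have h2 : p j = 0 := le_antisymm (by rw [← hz, h1]; exact hle) (hp0 j)
        have h3 : v j = 0 := by simpa [hp] using h2
        simp [h3]
    simp [hr, this]
  have hgsum : ∀ α, ∑ y, g (α, y) ≤ P := by
    intro α
    have h1 : ∀ y, g (α, y) = ∑ j, if j ∈ m (α, y) then p j else 0 := by
      intro y
      simp only [hg]
      cases hmy : m (α, y) with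
      | none => simp
      | some i => simp
    simp only [h1]
    rw [Finset.sum_comm]
    refine Finset.sum_le_sum fun j _ => ?_
    -- An index `j` is the chosen maximizer of at most one row, since column `j` of `K α` has at
    -- most one non-zero entry.
    by_cases hj : ∃ y, j ∈ m (α, y)
    · obtain ⟨y, hy⟩ := hj
      rw [Finset.sum_eq_single y]
      · simp only [hy, if_true]; exact le_rfl
      · intro y' _ hne
        refine if_neg fun hy' => hne ?_
        exact isIncoherentKraus_iff.1 (hI α) j y' y (hm2 _ _ hy') (hm2 _ _ hy)
      · simp
    · push Not at hj
      rw [Finset.sum_eq_zero fun y _ => if_neg (hj y)]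
      exact hp0 j
  set w : ι × b → ℝ := fun z => if g z = 0 then 0 else Real.log P - Real.log (g z) with hw
  have hgP : ∀ z, g z ≤ P := fun z => (Finset.single_le_sum (f := fun y => g (z.1, y))
    (fun y _ => hg0 _) (Finset.mem_univ z.2)).trans (hgsum z.1)
  have hw0 : ∀ z, 0 ≤ w z := by
    intro z
    by_cases hz : g z = 0
    · simp [hw, hz]
    · simp only [hw, hz, if_false]
      exact sub_nonneg.2 (Real.log_le_log ((hg0 z).lt_of_ne' hz) (hgP z))
  have hwu : ∀ z j, K z.1 z.2 j ≠ 0 → w z ≤ u j := by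
    intro z j hj
    obtain ⟨i, hi, hle⟩ := hm1 z j hj
    have h1 : g z = p i := by
      simp only [hg, Option.mem_def.1 hi, Option.elim_some]
    by_cases hz : g z = 0
    · simp only [hw, hz, if_true]; exact hu0 j
    · simp only [hw, hz, if_false]
      by_cases hpj : p j = 0
      · simp only [hu, hpj, if_true, h1]
        exact (le_abs_self _).trans (Finset.single_le_sum
          (f := fun j => |Real.log P - Real.log (p j)|) (fun _ _ => abs_nonneg _)
          (Finset.mem_univ i))
      · simp only [hu, hpj, if_false]
        have := Real.log_le_log ((hp0 j).lt_of_ne' hpj) (hle.trans_eq h1.symm)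
        linarith
  have htail : ∀ t, (∑ z, if t < w z then r z else 0) ≤ ∑ j, if t < u j then p j else 0 := by
    intro t
    -- If `t < w z`, every column that row `z` meets has `t < u j`, so the cutoff does not change
    -- that output amplitude.
    set v' : a → ℂ := fun j => if t < u j then v j else 0 with hv'
    have h1 : ∀ z, (if t < w z then r z else 0) ≤ ‖(K z.1 *ᵥ v') z.2‖ ^ 2 := by
      intro z
      split_ifs with hz
      · refine le_of_eq ?_
        simp only [hr]
        congr 2
        refine Finset.sum_congr rfl fun j _ => ?_
        by_cases hj : K z.1 z.2 j = 0
        · simp [hj]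
        · simp only [hv', hz.trans_le (hwu z j hj), if_true]
      · exact sq_nonneg _
    refine (Finset.sum_le_sum fun z _ => h1 z).trans_eq ?_
    rw [Fintype.sum_prod_type, sum_norm_sq_kraus hK]
    refine Finset.sum_congr rfl fun j _ => ?_
    simp only [hv', hp]
    split_ifs <;> simp
  calc ∑ α, vecEntropy (K α *ᵥ v)
      ≤ ∑ α, ∑ y, r (α, y) * w (α, y) := by
        refine Finset.sum_le_sum fun α _ => ?_
        refine (massEntropy_le_cross (f := fun y => r (α, y)) (g := fun y => g (α, y))
          (fun y => sq_nonneg _) (fun y => hg0 _) fun y hy => hr0 _ hy).trans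
          (Finset.sum_le_sum fun y _ => ?_)
        by_cases hz : g (α, y) = 0
        · simp [hr0 _ hz]
        · simp only [hw, hz, if_false]
          refine mul_le_mul_of_nonneg_left ?_ (sq_nonneg _)
          refine sub_le_sub_right (Real.log_le_log ?_ (hgsum α)) _
          exact ((hg0 _).lt_of_ne' hz).trans_le (Finset.single_le_sum
            (f := fun y => g (α, y)) (fun y _ => hg0 _) (Finset.mem_univ y))
    _ = ∑ z, r z * w z := by rw [Fintype.sum_prod_type]
    _ ≤ ∑ j, p j * u j := sum_mul_le_of_tail_le hw0 hu0 htail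
    _ = vecEntropy v := by
        rw [vecEntropy, massEntropy_eq_sum]
        refine Finset.sum_congr rfl fun j _ => ?_
        by_cases hj : p j = 0
        · have : ‖v j‖ ^ 2 = 0 := hj
          rw [hj, this, zero_mul, zero_mul]
        · simp only [hu, hj, if_false]
          rfl

theorem IsEnsemble.kraus {V : κ → a → ℂ} {ρ : Matrix a a ℂ} (h : IsEnsemble V ρ)
    (K : ι → Matrix b a ℂ) :
    IsEnsemble (fun z : κ × ι => K z.2 *ᵥ V z.1) (∑ α, K α * ρ * (K α)ᴴ) := by
  rw [isEnsemble_iff] at h ⊢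
  rw [h, Fintype.sum_prod_type, Finset.sum_comm]
  refine Finset.sum_congr rfl fun α _ => ?_
  simp only [Matrix.mul_sum, Matrix.sum_mul, mul_pureState_mul]

theorem IsState.kraus {ρ : Matrix a a ℂ} (h : IsState ρ) {K : ι → Matrix b a ℂ}
    (hK : ∑ α, (K α)ᴴ * K α = 1) : IsState (∑ α, K α * ρ * (K α)ᴴ) := by
  refine ⟨posSemidef_sum _ fun α _ => h.1.mul_mul_conjTranspose_same _, ?_⟩
  have h1 : ∀ α, (K α * ρ * (K α)ᴴ).trace = ((K α)ᴴ * K α * ρ).trace := fun α => by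
    rw [trace_mul_comm, ← Matrix.mul_assoc]
  rw [trace_sum, Finset.sum_congr rfl fun α _ => h1 α, ← trace_sum, ← Finset.sum_mul, hK, one_mul,
    h.2]

theorem IsIncoherentOperation.isState {I : Matrix a a ℂ →ₗ[ℂ] Matrix b b ℂ}
    (hI : IsIncoherentOperation I) {ρ : Matrix a a ℂ} (hρ : IsState ρ) : IsState (I ρ) := by
  obtain ⟨m, K, hK, -, h⟩ := hI
  rw [h]
  exact hρ.kraus hK

/-- Incoherent operations do not increase the coherence of formation. -/
theorem coherenceOfFormation_monotone [DecidableEq b] {I : Matrix a a ℂ →ₗ[ℂ] Matrix b b ℂ}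
    (hI : IsIncoherentOperation I) {ρ : Matrix a a ℂ} (hρ : IsState ρ) :
    coherenceOfFormation (I ρ) ≤ coherenceOfFormation ρ := by
  refine le_of_forall_pos_lt_add fun η hη => ?_
  obtain ⟨l, V, hV, hV'⟩ := exists_isEnsemble_lt hρ hη
  have ht := (hI.isState hρ).2
  obtain ⟨m, K, hK, hK', h⟩ := hI
  rw [h] at ht ⊢
  refine (coherenceOfFormation_le (hV.kraus K) ht).trans_lt (lt_of_le_of_lt ?_ hV')
  rw [Fintype.sum_prod_type]
  exact div_le_div_of_nonneg_right
    (Finset.sum_le_sum fun j _ => sum_vecEntropy_kraus_le hK hK' (V j))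
    (Real.log_pos one_lt_two).le

end IncoherentOperations

/-! ### Spectral calculus, trace norm duality and the Powers–Størmer inequality. -/

section Diagonalization

variable {a b ι κ : Type*} [Fintype a] [DecidableEq a] [Fintype ι] [Fintype κ]

/-- `H = U diag(s) U†` with a unitary `U`. -/
structure IsDiagonalization (U : Matrix a a ℂ) (s : a → ℝ) (H : Matrix a a ℂ) : Prop where
  star_mul : Uᴴ * U = 1
  mul_star : U * Uᴴ = 1
  eq : H = U * diagonal (fun i => (s i : ℂ)) * Uᴴ

theorem exists_isDiagonalization {H : Matrix a a ℂ} (hH : H.IsHermitian) :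
    ∃ U s, IsDiagonalization U s H := by
  refine ⟨hH.eigenvectorUnitary, hH.eigenvalues, ?_, ?_, ?_⟩
  · exact Unitary.coe_star_mul_self hH.eigenvectorUnitary
  · exact Unitary.coe_mul_star_self hH.eigenvectorUnitary
  · exact hH.spectral_theorem

/-- Conjugation by a unitary is a star automorphism and commutes with the functional calculus; the
spectrum is finite, so every `f` is continuous on it. -/
theorem IsDiagonalization.cfc {U H : Matrix a a ℂ} {s : a → ℝ} (h : IsDiagonalization U s H)
    (f : ℝ → ℝ) : IsDiagonalization U (fun i => f (s i)) (cfc f H) := by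
  refine ⟨h.star_mul, h.mul_star, ?_⟩
  set D : Matrix a a ℂ := diagonal fun i => (s i : ℂ) with hD
  let u : unitary (Matrix a a ℂ) := ⟨U, Unitary.mem_iff.2 ⟨h.star_mul, h.mul_star⟩⟩
  have hsa : IsSelfAdjoint D := by
    rw [IsSelfAdjoint, star_eq_conjTranspose, diagonal_conjTranspose]
    congr 1
    ext i
    simp
  have hfin : (spectrum ℝ D).Finite := by
    have : spectrum ℝ D = (algebraMap ℝ ℂ) ⁻¹' spectrum ℂ D :=
      (spectrum.preimage_algebraMap ℂ).symm
    rw [this, spectrum_diagonal]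
    exact (Set.finite_range _).preimage (FaithfulSMul.algebraMap_injective ℝ ℂ).injOn
  have hcont : Continuous (Unitary.conjStarAlgAut ℝ (Matrix a a ℂ) u) := by
    have : (Unitary.conjStarAlgAut ℝ (Matrix a a ℂ) u : Matrix a a ℂ → Matrix a a ℂ) =
        fun x => U * x * Uᴴ := rfl
    rw [this]
    fun_prop
  have key := StarAlgHomClass.map_cfc (Unitary.conjStarAlgAut ℝ (Matrix a a ℂ) u) f D
    (hfin.continuousOn f) hcont hsa (hsa.map _)
  rw [h.eq]
  have h2 : Unitary.conjStarAlgAut ℝ (Matrix a a ℂ) u D = U * D * Uᴴ := rfl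
  rw [h2] at key
  rw [← key, hD, cfc_diagonal_ofReal]
  rfl

theorem IsDiagonalization.conj_eq {U H : Matrix a a ℂ} {s : a → ℝ} (h : IsDiagonalization U s H) :
    Uᴴ * H * U = diagonal fun i => (s i : ℂ) := by
  calc Uᴴ * H * U = (Uᴴ * U) * diagonal (fun i => (s i : ℂ)) * (Uᴴ * U) := by
        rw [h.eq]; simp only [Matrix.mul_assoc]
    _ = _ := by rw [h.star_mul, one_mul, mul_one]

theorem IsDiagonalization.nonneg {U H : Matrix a a ℂ} {s : a → ℝ} (h : IsDiagonalization U s H)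
    (hH : H.PosSemidef) (i : a) : 0 ≤ s i := by
  have h1 := hH.conjTranspose_mul_mul_same U
  rw [h.conj_eq] at h1
  have := h1.diag_nonneg (i := i)
  simpa using this

theorem IsDiagonalization.trace {U H : Matrix a a ℂ} {s : a → ℝ} (h : IsDiagonalization U s H) :
    H.trace = ((∑ i, s i : ℝ) : ℂ) := by
  rw [h.eq, trace_mul_comm, ← Matrix.mul_assoc, h.star_mul, one_mul, trace_diagonal,
    Complex.ofReal_sum]

theorem IsDiagonalization.apply {U H : Matrix a a ℂ} {s : a → ℝ} (h : IsDiagonalization U s H)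
    (x y : a) : H x y = ∑ i, U x i * s i * star (U y i) := by
  rw [h.eq, Matrix.mul_apply]
  simp only [mul_diagonal, conjTranspose_apply]

theorem sum_norm_sq_row {U : Matrix a a ℂ} (h : U * Uᴴ = 1) (x : a) :
    ∑ i, ‖U x i‖ ^ 2 = 1 := by
  have h1 := congrFun (congrFun h x) x
  rw [Matrix.mul_apply, one_apply_eq] at h1
  simp only [conjTranspose_apply, mul_star_self_eq] at h1
  exact_mod_cast h1

theorem sum_norm_sq_col {U : Matrix a a ℂ} (h : Uᴴ * U = 1) (i : a) :
    ∑ x, ‖U x i‖ ^ 2 = 1 := by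
  have h1 := congrFun (congrFun h i) i
  rw [Matrix.mul_apply, one_apply_eq] at h1
  simp only [conjTranspose_apply, mul_comm (star _), mul_star_self_eq] at h1
  exact_mod_cast h1

/-- The unitary functionals `|tr(U X)|` are all at most `ε`. -/
def UnitaryTraceLE (X : Matrix a a ℂ) (ε : ℝ) : Prop :=
  ∀ U : Matrix a a ℂ, Uᴴ * U = 1 → U * Uᴴ = 1 → ‖(U * X).trace‖ ≤ ε

/-- In an eigenbasis `V` of `X†X` the columns of `XV` have norms `√(s k)`, and the rows of `V†U` are
unit vectors; Cauchy–Schwarz row by row gives `∑ √(s k)`, the trace norm. -/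
theorem unitaryTraceLE_traceNorm (X : Matrix a a ℂ) : UnitaryTraceLE X (traceNorm X) := by
  intro U hU hU'
  have hM : (Xᴴ * X).PosSemidef := posSemidef_conjTranspose_mul_self X
  obtain ⟨V, s, h⟩ := exists_isDiagonalization hM.1
  have hs := h.nonneg hM
  have h1 : traceNorm X = ∑ i, Real.sqrt (s i) := by
    rw [traceNorm, (h.cfc Real.sqrt).trace, Complex.ofReal_re]
  have h2 : (U * X).trace = ∑ k, ∑ y, (Vᴴ * U) k y * (X * V) y k := by
    have : (U * X).trace = ((Vᴴ * U) * (X * V)).trace := by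
      rw [trace_mul_comm (Vᴴ * U), Matrix.mul_assoc X, ← Matrix.mul_assoc V, h.mul_star, one_mul,
        trace_mul_comm]
    rw [this]
    simp only [Matrix.trace, diag_apply, Matrix.mul_apply (M := Vᴴ * U)]
  have h3 : ∀ k, ∑ y, ‖(Vᴴ * U) k y‖ ^ 2 = 1 := by
    refine sum_norm_sq_row ?_
    rw [conjTranspose_mul, conjTranspose_conjTranspose, Matrix.mul_assoc, ← Matrix.mul_assoc U,
      hU', one_mul, h.star_mul]
  have h4 : ∀ k, ∑ y, ‖(X * V) y k‖ ^ 2 = s k := by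
    intro k
    have h5 : (X * V)ᴴ * (X * V) = diagonal fun i => (s i : ℂ) := by
      rw [← h.conj_eq, conjTranspose_mul]
      simp only [Matrix.mul_assoc]
    have h6 := congrFun (congrFun h5 k) k
    rw [Matrix.mul_apply, diagonal_apply_eq] at h6
    simp only [conjTranspose_apply, mul_comm (star _), mul_star_self_eq] at h6
    exact_mod_cast h6
  rw [h2, h1]
  refine (norm_sum_le _ _).trans (Finset.sum_le_sum fun k _ => (norm_sum_le _ _).trans ?_)
  simp only [norm_mul]
  have := Real.sum_mul_le_sqrt_mul_sqrt Finset.univ (fun y => ‖(Vᴴ * U) k y‖)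
    fun y => ‖(X * V) y k‖
  rwa [h3, h4, Real.sqrt_one, one_mul] at this

/-- The Powers–Størmer inequality. -/
theorem sum_norm_sq_sub_le_of_unitaryTraceLE {A B : Matrix a a ℂ} (hA : A.PosSemidef)
    (hB : B.PosSemidef) {ε : ℝ} (h : UnitaryTraceLE (A * A - B * B) ε) :
    ∑ x, ∑ y, ‖(A - B) x y‖ ^ 2 ≤ ε := by
  obtain ⟨W, s, hW⟩ := exists_isDiagonalization (hA.1.sub hB.1)
  set A' := Wᴴ * A * W with hA'
  set B' := Wᴴ * B * W with hB'
  have pA : A'.PosSemidef := hA.conjTranspose_mul_mul_same W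
  have pB : B'.PosSemidef := hB.conjTranspose_mul_mul_same W
  have hd : A' - B' = diagonal fun i => (s i : ℂ) := by
    rw [← hW.conj_eq, hA', hB', Matrix.mul_sub, Matrix.sub_mul]
  -- The sign of `A - B` in its eigenbasis; the hypothesis is tested on this single unitary.
  set e : a → ℝ := fun i => if 0 ≤ s i then 1 else -1 with he
  have he2 : ∀ i, e i * e i = 1 := fun i => by simp only [he]; split_ifs <;> norm_num
  set D : Matrix a a ℂ := diagonal fun i => (e i : ℂ) with hD
  have hDD : D * D = 1 := by
    rw [hD, diagonal_mul_diagonal, ← diagonal_one]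
    congr 1
    ext i
    exact_mod_cast he2 i
  have hDs : Dᴴ = D := by
    rw [hD, diagonal_conjTranspose]
    congr 1
    ext i
    simp
  have hsw : ∀ X Y : Matrix a a ℂ, (Wᴴ * X * W) * (Wᴴ * Y * W) = Wᴴ * (X * Y) * W := by
    intro X Y
    calc _ = Wᴴ * X * (W * Wᴴ) * Y * W := by simp only [Matrix.mul_assoc]
      _ = _ := by rw [hW.mul_star, mul_one]; simp only [Matrix.mul_assoc]
  have hUU : (W * D * Wᴴ) * (W * D * Wᴴ) = 1 := by
    calc _ = W * (D * (Wᴴ * W) * D) * Wᴴ := by simp only [Matrix.mul_assoc]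
      _ = 1 := by rw [hW.star_mul, mul_one, hDD, mul_one, hW.mul_star]
  have hUs : (W * D * Wᴴ)ᴴ = W * D * Wᴴ := by
    simp only [conjTranspose_mul, conjTranspose_conjTranspose, hDs, Matrix.mul_assoc]
  have h1 := h (W * D * Wᴴ) (by rw [hUs, hUU]) (by rw [hUs, hUU])
  have h2 : ((W * D * Wᴴ) * (A * A - B * B)).trace = (D * (A' * A' - B' * B')).trace := by
    rw [hA', hB', hsw, hsw, ← Matrix.sub_mul, ← Matrix.mul_sub, Matrix.mul_assoc W,
      Matrix.mul_assoc W, trace_mul_comm W]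
    simp only [Matrix.mul_assoc]
  have hsq : ∀ {X : Matrix a a ℂ}, X.PosSemidef → ∀ k, (X * X) k k =
      ((∑ l, ‖X k l‖ ^ 2 : ℝ) : ℂ) := by
    intro X hX k
    rw [Matrix.mul_apply, Complex.ofReal_sum]
    refine Finset.sum_congr rfl fun l _ => ?_
    rw [← hX.1.apply l k, mul_star_self_eq]
  have hre : ∀ {X : Matrix a a ℂ}, X.PosSemidef → ∀ k, 0 ≤ (X k k).re ∧
      ‖X k k‖ = (X k k).re := by
    intro X hX k
    have := Complex.le_def.1 (hX.diag_nonneg (i := k))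
    refine ⟨this.1, ?_⟩
    have h3 : X k k = ((X k k).re : ℂ) := by apply Complex.ext <;> simp [← this.2]
    rw [h3, Complex.norm_real, Real.norm_eq_abs, Complex.ofReal_re, abs_of_nonneg this.1]
  have hoff : ∀ k l, k ≠ l → A' k l = B' k l := by
    intro k l hkl
    have := congrFun (congrFun hd k) l
    rw [diagonal_apply_ne _ hkl] at this
    exact sub_eq_zero.1 this
  have hdiag : ∀ k, (A' k k).re - (B' k k).re = s k := by
    intro k
    have := congrArg Complex.re (congrFun (congrFun hd k) k)
    rwa [diagonal_apply_eq] at this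
  -- Since `A'` and `B'` agree off the diagonal, only `A'_kk² - B'_kk² = s_k (A'_kk + B'_kk)`
  -- survives in each diagonal entry.
  have h3 : (D * (A' * A' - B' * B')).trace =
      ((∑ k, e k * (s k * ((A' k k).re + (B' k k).re)) : ℝ) : ℂ) := by
    rw [Matrix.trace, Complex.ofReal_sum]
    refine Finset.sum_congr rfl fun k _ => ?_
    rw [diag_apply, hD, diagonal_mul, Matrix.sub_apply, hsq pA, hsq pB, ← Complex.ofReal_sub,
      ← Complex.ofReal_mul]
    congr 2
    rw [← Finset.sum_sub_distrib, Finset.sum_eq_single k, (hre pA k).2, (hre pB k).2, ← hdiag k]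
    · ring
    · intro l _ hl
      rw [hoff k l hl.symm, sub_self]
    · simp
  -- Positivity of both diagonals gives `|s_k| = |A'_kk - B'_kk| ≤ A'_kk + B'_kk`.
  have h4 : ∑ k, s k ^ 2 ≤ ∑ k, e k * (s k * ((A' k k).re + (B' k k).re)) := by
    refine Finset.sum_le_sum fun k _ => ?_
    have ha := (hre pA k).1
    have hb := (hre pB k).1
    have hs := hdiag k
    simp only [he]
    split_ifs with h0 <;> nlinarith
  have h5 : ∑ x, ∑ y, ‖(A - B) x y‖ ^ 2 = ∑ k, s k ^ 2 := by
    have h6 : ((A - B) * (A - B)).trace = ((∑ x, ∑ y, ‖(A - B) x y‖ ^ 2 : ℝ) : ℂ) := by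
      rw [Matrix.trace, Complex.ofReal_sum]
      refine Finset.sum_congr rfl fun k _ => ?_
      rw [diag_apply, Matrix.mul_apply, Complex.ofReal_sum]
      refine Finset.sum_congr rfl fun l _ => ?_
      rw [← (hA.1.sub hB.1).apply l k, mul_star_self_eq]
    have h7 : ((A - B) * (A - B)).trace = ((∑ k, s k ^ 2 : ℝ) : ℂ) := by
      have h8 : ((Wᴴ * (A - B) * W) * (Wᴴ * (A - B) * W)).trace = ((A - B) * (A - B)).trace := by
        rw [hsw, trace_mul_comm, ← Matrix.mul_assoc, hW.mul_star, one_mul]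
      rw [← h8, hW.conj_eq, diagonal_mul_diagonal, trace_diagonal, Complex.ofReal_sum]
      exact Finset.sum_congr rfl fun k _ => by rw [sq, Complex.ofReal_mul]
    exact_mod_cast h6.symm.trans h7
  rw [h5]
  refine h4.trans (le_trans ?_ h1)
  rw [h2, h3, Complex.norm_real, Real.norm_eq_abs]
  exact le_abs_self _

end Diagonalization

/-! ### Asymptotic continuity of the coherence of formation. -/

section FormationContinuity

variable {a b ι κ : Type*} [Fintype a] [DecidableEq a] [Fintype ι] [Fintype κ]

theorem IsEnsemble.map [Fintype b] {V : κ → a → ℂ} {ρ : Matrix a a ℂ} (h : IsEnsemble V ρ)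
    (K : Matrix b a ℂ) : IsEnsemble (fun z => K *ᵥ V z) (K * ρ * Kᴴ) := by
  rw [isEnsemble_iff] at h ⊢
  rw [h]
  simp only [Matrix.mul_sum, Matrix.sum_mul, mul_pureState_mul]

theorem IsEnsemble.sum_norm_sq_eq_trace {V : κ → a → ℂ} {ρ : Matrix a a ℂ} (h : IsEnsemble V ρ) :
    ((∑ j, ∑ x, ‖V j x‖ ^ 2 : ℝ) : ℂ) = ρ.trace := by
  rw [Finset.sum_comm, Matrix.trace, Complex.ofReal_sum]
  exact Finset.sum_congr rfl fun x _ => (h.diag_eq x).symm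

theorem IsDiagonalization.of_diagonal {U : Matrix a a ℂ} (h1 : Uᴴ * U = 1) (h2 : U * Uᴴ = 1)
    (s : a → ℝ) : IsDiagonalization U s (U * diagonal (fun i => (s i : ℂ)) * Uᴴ) :=
  ⟨h1, h2, rfl⟩

theorem IsDiagonalization.mul {U H G : Matrix a a ℂ} {s t : a → ℝ} (h : IsDiagonalization U s H)
    (h' : IsDiagonalization U t G) : IsDiagonalization U (fun i => s i * t i) (H * G) := by
  refine ⟨h.star_mul, h.mul_star, ?_⟩
  calc H * G = U * (diagonal (fun i => (s i : ℂ)) * (Uᴴ * U) * diagonal fun i => (t i : ℂ)) *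
        Uᴴ := by rw [h.eq, h'.eq]; simp only [Matrix.mul_assoc]
    _ = _ := by
      rw [h.star_mul, mul_one, diagonal_mul_diagonal]
      simp only [Complex.ofReal_mul]

theorem IsDiagonalization.isHermitian {U H : Matrix a a ℂ} {s : a → ℝ}
    (h : IsDiagonalization U s H) : H.IsHermitian := by
  rw [IsHermitian, h.eq]
  simp only [conjTranspose_mul, conjTranspose_conjTranspose, diagonal_conjTranspose,
    Matrix.mul_assoc]
  congr 3
  ext i
  simp

theorem IsDiagonalization.ext {U H G : Matrix a a ℂ} {s t : a → ℝ} (h : IsDiagonalization U s H)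
    (h' : IsDiagonalization U t G) (hst : ∀ i, s i = t i) : H = G := by
  rw [h.eq, h'.eq, funext hst]

theorem IsDiagonalization.posSemidef {U H : Matrix a a ℂ} {s : a → ℝ}
    (h : IsDiagonalization U s H) (hs : ∀ i, 0 ≤ s i) : H.PosSemidef := by
  rw [h.eq]
  exact (PosSemidef.diagonal fun i => Complex.zero_le_real.2 (hs i)).mul_mul_conjTranspose_same U

theorem exists_sqrt {ρ : Matrix a a ℂ} (hρ : ρ.PosSemidef) :
    ∃ R : Matrix a a ℂ, R.PosSemidef ∧ R * R = ρ := by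
  obtain ⟨U, s, h⟩ := exists_isDiagonalization hρ.1
  have hR := IsDiagonalization.of_diagonal h.star_mul h.mul_star fun i => Real.sqrt (s i)
  exact ⟨_, hR.posSemidef fun i => Real.sqrt_nonneg _,
    (hR.mul hR).ext h fun i => Real.mul_self_sqrt (h.nonneg hρ i)⟩

/-- Every ensemble of `R²` is the image under `R` of an ensemble of the identity, up to zero
vectors. -/
theorem IsEnsemble.exists_lift {V : ι → a → ℂ} {R : Matrix a a ℂ} (hR : R.PosSemidef)
    (hV : IsEnsemble V (R * R)) :
    ∃ e : ι ⊕ a → a → ℂ, IsEnsemble e 1 ∧ (∀ j, R *ᵥ e (Sum.inl j) = V j) ∧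
      ∀ x, R *ᵥ e (Sum.inr x) = 0 := by
  obtain ⟨U, s, h⟩ := exists_isDiagonalization hR.1
  have hQ := IsDiagonalization.of_diagonal h.star_mul h.mul_star fun i => (s i)⁻¹
  have hP := IsDiagonalization.of_diagonal h.star_mul h.mul_star fun i => if s i = 0 then 0 else 1
  have hN := IsDiagonalization.of_diagonal h.star_mul h.mul_star fun i => if s i = 0 then 1 else 0
  have hZ := IsDiagonalization.of_diagonal h.star_mul h.mul_star fun _ => 0
  -- `Q` is the pseudoinverse of `R` (with `0⁻¹ = 0`), `P` the projection on its support and `N` the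
  -- projection on its kernel. The lift consists of the vectors `Q V_j`, an ensemble of `P`, and of
  -- `N` applied to the basis, an ensemble of `N`.
  set Q := U * diagonal (fun i => (((s i)⁻¹ : ℝ) : ℂ)) * Uᴴ with hQd
  set P := U * diagonal (fun i => ((if s i = 0 then 0 else 1 : ℝ) : ℂ)) * Uᴴ with hPd
  set N := U * diagonal (fun i => ((if s i = 0 then 1 else 0 : ℝ) : ℂ)) * Uᴴ with hNd
  have hZ0 : U * diagonal (fun _ => ((0 : ℝ) : ℂ)) * Uᴴ = 0 := by simp
  rw [hZ0] at hZ
  have hPN : P + N = 1 := by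
    rw [hPd, hNd, ← Matrix.add_mul, ← Matrix.mul_add, diagonal_add, ← h.mul_star]
    congr 1
    conv_rhs => rw [← mul_one U]
    congr 1
    rw [← diagonal_one]
    congr 1
    ext i
    split_ifs <;> simp
  have hRQ : R * Q = P := (h.mul hQ).ext hP fun i => by
    by_cases hi : s i = 0 <;> simp [hi]
  have hRN : R * N = 0 := (h.mul hN).ext hZ fun i => by
    by_cases hi : s i = 0 <;> simp [hi]
  have hNR : N * (R * R) * Nᴴ = 0 := by
    rw [hN.isHermitian.eq, Matrix.mul_assoc N, Matrix.mul_assoc R, hRN, mul_zero, mul_zero]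
  have hQQ : Q * (R * R) * Qᴴ = P := by
    rw [hQ.isHermitian.eq]
    refine ((hQ.mul (h.mul h)).mul hQ).ext hP fun i => ?_
    by_cases hi : s i = 0
    · simp [hi]
    · simp only [hi, if_false]
      field_simp
  have hNN : N * 1 * Nᴴ = N := by
    rw [mul_one, hN.isHermitian.eq]
    exact (hN.mul hN).ext hN fun i => by by_cases hi : s i = 0 <;> simp [hi]
  have h1 : IsEnsemble (fun x : a => Pi.single x (1 : ℂ)) (1 : Matrix a a ℂ) := by
    intro x y
    simp [Pi.single_apply, Matrix.one_apply]
  have hNV : ∀ j, N *ᵥ V j = 0 := by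
    intro j
    have h2 := hV.map N
    rw [hNR] at h2
    ext x
    have h3 := h2.diag_eq x
    rw [Matrix.zero_apply] at h3
    have h4 : ∑ j, ‖(N *ᵥ V j) x‖ ^ 2 = 0 := by exact_mod_cast h3.symm
    have := (Finset.sum_eq_zero_iff_of_nonneg fun j _ => sq_nonneg ‖(N *ᵥ V j) x‖).1 h4 j
      (Finset.mem_univ j)
    simpa using this
  refine ⟨Sum.elim (fun j => Q *ᵥ V j) fun x => N *ᵥ Pi.single x 1, ?_, fun j => ?_, fun x => ?_⟩
  · intro x y
    rw [Fintype.sum_sum_type, ← hPN, Matrix.add_apply]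
    have h2 := hV.map Q
    have h3 := h1.map N
    rw [hQQ] at h2
    rw [hNN] at h3
    exact congrArg₂ _ (h2 x y) (h3 x y)
  · rw [Sum.elim_inl, mulVec_mulVec, hRQ]
    have h2 := congrArg (· *ᵥ V j) hPN
    simpa [add_mulVec, hNV j] using h2
  · rw [Sum.elim_inr, mulVec_mulVec, hRN, zero_mulVec]

/-- Factor the difference of squares and apply Cauchy–Schwarz; the factor 2 bounds the norm of `‖w‖
+ ‖v‖` for unit vectors. -/
theorem sum_abs_sq_sub_sq_le {v w : κ → ℂ} (hv : ∑ i, ‖v i‖ ^ 2 = 1) (hw : ∑ i, ‖w i‖ ^ 2 = 1)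
    {ε : ℝ} (h : ∑ i, ‖w i - v i‖ ^ 2 ≤ ε) : ∑ i, |‖w i‖ ^ 2 - ‖v i‖ ^ 2| ≤ 2 * Real.sqrt ε := by
  have h1 : ∀ i, |‖w i‖ ^ 2 - ‖v i‖ ^ 2| ≤ ‖w i - v i‖ * (‖w i‖ + ‖v i‖) := by
    intro i
    rw [sq_sub_sq, abs_mul, mul_comm, abs_of_nonneg (by positivity : 0 ≤ ‖w i‖ + ‖v i‖)]
    exact mul_le_mul_of_nonneg_right (abs_norm_sub_norm_le _ _) (by positivity)
  have h2 : ∑ i, (‖w i‖ + ‖v i‖) ^ 2 ≤ 2 ^ 2 := by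
    have : ∀ i, (‖w i‖ + ‖v i‖) ^ 2 ≤ 2 * ‖w i‖ ^ 2 + 2 * ‖v i‖ ^ 2 := fun i => by
      nlinarith [sq_nonneg (‖w i‖ - ‖v i‖)]
    refine (Finset.sum_le_sum fun i _ => this i).trans ?_
    rw [Finset.sum_add_distrib, ← Finset.mul_sum, ← Finset.mul_sum, hv, hw]
    norm_num
  refine (Finset.sum_le_sum fun i _ => h1 i).trans
    ((Real.sum_mul_le_sqrt_mul_sqrt Finset.univ _ _).trans ?_)
  rw [mul_comm]
  refine mul_le_mul ?_ (Real.sqrt_le_sqrt h) (Real.sqrt_nonneg _) zero_le_two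
  exact (Real.sqrt_le_sqrt h2).trans_eq (Real.sqrt_sq zero_le_two)

/-- With `ρ = R²` and `σ = S²`, lift a nearly optimal ensemble of `ρ` to an ensemble `e` of the
identity. Then `S e_j` is an ensemble of `σ`, and its total squared distance to `R e_j` is `tr (S -
R)² ≤ ε` by Powers–Størmer. Continuity of the conditional Shannon entropy of the joint distribution
of ensemble label and basis label finishes the estimate. -/
theorem coherenceOfFormation_le_of_close {ρ σ : Matrix a a ℂ} (hρ : IsState ρ) (hσ : IsState σ)
    {ε : ℝ} (h : UnitaryTraceLE (σ - ρ) ε) :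
    coherenceOfFormation σ ≤ coherenceOfFormation ρ +
      2 * Real.sqrt ε * Real.logb 2 (Fintype.card a) + (1 + 2 * Real.sqrt ε) := by
  have hlog2 : 0 < Real.log 2 := Real.log_pos one_lt_two
  have ha : Nonempty a := by
    by_contra hc
    rw [not_nonempty_iff] at hc
    simpa [Matrix.trace] using hρ.2
  refine le_of_forall_pos_lt_add fun η hη => ?_
  obtain ⟨l, V, hV, hV'⟩ := exists_isEnsemble_lt hρ hη
  obtain ⟨R, hR, rfl⟩ := exists_sqrt hρ.1
  obtain ⟨S, hS, rfl⟩ := exists_sqrt hσ.1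
  obtain ⟨e, he, he1, he2⟩ := hV.exists_lift hR
  have hv := he.map R
  have hw := he.map S
  have hd := he.map (S - R)
  rw [mul_one, hR.1.eq] at hv
  rw [mul_one, hS.1.eq] at hw
  rw [mul_one, (hS.1.sub hR.1).eq] at hd
  have hdist : ∑ z : _ × a, ‖(S *ᵥ e z.1) z.2 - (R *ᵥ e z.1) z.2‖ ^ 2 ≤ ε := by
    refine le_trans (le_of_eq ?_) (sum_norm_sq_sub_le_of_unitaryTraceLE hS hR h)
    have h1 := hd.sum_norm_sq_eq_trace
    have h2 : ((S - R) * (S - R)).trace = ((∑ x, ∑ y, ‖(S - R) x y‖ ^ 2 : ℝ) : ℂ) := by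
      rw [Matrix.trace, Complex.ofReal_sum]
      refine Finset.sum_congr rfl fun k _ => ?_
      rw [diag_apply, Matrix.mul_apply, Complex.ofReal_sum]
      refine Finset.sum_congr rfl fun l _ => ?_
      rw [← (hS.1.sub hR.1).apply l k, mul_star_self_eq]
    rw [h2, Complex.ofReal_inj] at h1
    rw [← h1, Fintype.sum_prod_type]
    simp only [sub_mulVec, Pi.sub_apply]
  have h1 := sum_abs_sq_sub_sq_le
    (by rw [Fintype.sum_prod_type]; exact hv.sum_norm_sq hρ.2)
    (by rw [Fintype.sum_prod_type]; exact hw.sum_norm_sq hσ.2) hdist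
  rw [Fintype.sum_prod_type] at h1
  have h2 := sum_massEntropy_le_of_close (fun _ _ => sq_nonneg _) (fun _ _ => sq_nonneg _) h1
    (hv.sum_norm_sq hρ.2)
  have h3 := coherenceOfFormation_le hw hσ.2
  have h4 : ∑ j, vecEntropy (R *ᵥ e j) = ∑ j, vecEntropy (V j) := by
    rw [Fintype.sum_sum_type]
    simp [he1, he2, vecEntropy, massEntropy]
  have h5 : (∑ j, vecEntropy (S *ᵥ e j)) / Real.log 2 ≤ (∑ j, vecEntropy (V j)) / Real.log 2 +
      2 * Real.sqrt ε * Real.logb 2 (Fintype.card a) + (1 + 2 * Real.sqrt ε) := by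
    rw [← h4, div_le_iff₀ hlog2, Real.logb]
    refine h2.trans_eq ?_
    simp only [vecEntropy]
    field_simp
  linarith

end FormationContinuity

/-! ### Additivity and continuity of the relative entropy of coherence. -/

section QuantumEntropy

variable {a b ι κ : Type*} [Fintype a] [DecidableEq a] [Fintype b] [DecidableEq b]
  [Fintype ι] [Fintype κ]

theorem IsDiagonalization.entropy {U ρ : Matrix a a ℂ} {s : a → ℝ} (h : IsDiagonalization U s ρ) :
    entropy ρ = (∑ i, Real.negMulLog (s i)) / Real.log 2 := by
  rw [CoherenceTheory.entropy, (h.mul (h.cfc Real.log)).trace, Complex.ofReal_re,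
    ← Finset.sum_neg_distrib]
  simp only [Real.negMulLog, neg_mul]

theorem IsState.entropy_dephase {ρ : Matrix a a ℂ} (h : IsState ρ) :
    entropy (CoherenceTheory.dephase ρ) = (massEntropy fun i => (ρ i i).re) / Real.log 2 := by
  rw [CoherenceTheory.entropy_dephase h, massEntropy_of_sum_eq_one h.sum_diag,
    ← Finset.sum_neg_distrib]
  simp only [Real.negMulLog, neg_mul]

theorem IsDiagonalization.kronecker {U ρ : Matrix a a ℂ} {V σ : Matrix b b ℂ} {s : a → ℝ}
    {t : b → ℝ} (h : IsDiagonalization U s ρ) (h' : IsDiagonalization V t σ) :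
    IsDiagonalization (U ⊗ₖ V) (fun z => s z.1 * t z.2) (ρ ⊗ₖ σ) := by
  refine ⟨?_, ?_, ?_⟩
  · rw [conjTranspose_kronecker, ← mul_kronecker_mul, h.star_mul, h'.star_mul, one_kronecker_one]
  · rw [conjTranspose_kronecker, ← mul_kronecker_mul, h.mul_star, h'.mul_star, one_kronecker_one]
  · simp only [Complex.ofReal_mul]
    have hd := diagonal_kronecker_diagonal (fun i => (s i : ℂ)) fun j => (t j : ℂ)
    rw [conjTranspose_kronecker, ← hd, ← mul_kronecker_mul,
      ← mul_kronecker_mul, ← h.eq, ← h'.eq]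

theorem IsDiagonalization.sum_eq_one {U ρ : Matrix a a ℂ} {s : a → ℝ}
    (h : IsDiagonalization U s ρ) (hρ : IsState ρ) : ∑ i, s i = 1 := by
  have := h.trace
  rw [hρ.2] at this
  exact_mod_cast this.symm

theorem entropy_kronecker {ρ : Matrix a a ℂ} {σ : Matrix b b ℂ} (hρ : IsState ρ)
    (hσ : IsState σ) : entropy (ρ ⊗ₖ σ) = entropy ρ + entropy σ := by
  obtain ⟨U, s, h⟩ := exists_isDiagonalization hρ.1.1
  obtain ⟨V, t, h'⟩ := exists_isDiagonalization hσ.1.1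
  rw [(h.kronecker h').entropy, h.entropy, h'.entropy, ← add_div, Fintype.sum_prod_type]
  simp only [Real.negMulLog_mul, Finset.sum_add_distrib, ← Finset.sum_mul, ← Finset.mul_sum,
    h.sum_eq_one hρ, h'.sum_eq_one hσ, one_mul]

theorem relEntropyCoherence_kronecker {ρ : Matrix a a ℂ} {σ : Matrix b b ℂ} (hρ : IsState ρ)
    (hσ : IsState σ) :
    relEntropyCoherence (ρ ⊗ₖ σ) = relEntropyCoherence ρ + relEntropyCoherence σ := by
  have h := hρ.kronecker hσ
  have h1 : ∀ z : a × b, ((ρ ⊗ₖ σ) z z).re = (ρ z.1 z.1).re * (σ z.2 z.2).re := fun z => by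
    rw [kroneckerMap_apply, hρ.diag_eq, hσ.diag_eq, ← Complex.ofReal_mul, Complex.ofReal_re,
      Complex.ofReal_re, Complex.ofReal_re]
  rw [relEntropyCoherence_eq h, relEntropyCoherence_eq hρ, relEntropyCoherence_eq hσ,
    entropy_kronecker hρ hσ, h.entropy_dephase, hρ.entropy_dephase, hσ.entropy_dephase]
  simp only [h1]
  rw [massEntropy_mul (fun x => (ρ x x).re) fun y => (σ y y).re, hρ.sum_diag, hσ.sum_diag, one_mul,
    one_mul]
  ring

theorem IsDiagonalization.diag_re {U ρ : Matrix a a ℂ} {s : a → ℝ} (h : IsDiagonalization U s ρ)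
    (x : a) : (ρ x x).re = ∑ i, ‖U x i‖ ^ 2 * s i := by
  rw [h.apply, Complex.re_sum]
  refine Finset.sum_congr rfl fun i _ => ?_
  rw [mul_right_comm, mul_star_self_eq, ← Complex.ofReal_mul, Complex.ofReal_re]

/-- Measuring in a basis does not decrease the entropy. -/
theorem IsDiagonalization.sum_negMulLog_le {U ρ : Matrix a a ℂ} {s : a → ℝ}
    (h : IsDiagonalization U s ρ) (hs : ∀ i, 0 ≤ s i) :
    ∑ i, Real.negMulLog (s i) ≤ ∑ x, Real.negMulLog (ρ x x).re := by
  have h1 : ∀ x, ∑ i, ‖U x i‖ ^ 2 * Real.negMulLog (s i) ≤ Real.negMulLog (ρ x x).re := by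
    intro x
    rw [h.diag_re]
    have := Real.concaveOn_negMulLog.le_map_sum (t := Finset.univ) (w := fun i => ‖U x i‖ ^ 2)
      (p := s) (fun i _ => sq_nonneg _) (sum_norm_sq_row h.mul_star x) fun i _ => hs i
    simpa only [smul_eq_mul] using this
  refine le_trans (le_of_eq ?_) (Finset.sum_le_sum fun x _ => h1 x)
  rw [Finset.sum_comm]
  refine Finset.sum_congr rfl fun i _ => ?_
  rw [← Finset.sum_mul, sum_norm_sq_col h.star_mul, one_mul]

theorem IsDiagonalization.conj {U V ρ : Matrix a a ℂ} {s : a → ℝ} (h : IsDiagonalization U s ρ)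
    (h1 : Vᴴ * V = 1) (h2 : V * Vᴴ = 1) : IsDiagonalization (Vᴴ * U) s (Vᴴ * ρ * V) := by
  refine ⟨?_, ?_, ?_⟩
  · rw [conjTranspose_mul, conjTranspose_conjTranspose, Matrix.mul_assoc, ← Matrix.mul_assoc V, h2,
      one_mul, h.star_mul]
  · rw [conjTranspose_mul, conjTranspose_conjTranspose, Matrix.mul_assoc, ← Matrix.mul_assoc U,
      h.mul_star, one_mul, h1]
  · rw [conjTranspose_mul, conjTranspose_conjTranspose, h.eq]
    simp only [Matrix.mul_assoc]

theorem IsState.conj {V ρ : Matrix a a ℂ} (h : IsState ρ) (h2 : V * Vᴴ = 1) :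
    IsState (Vᴴ * ρ * V) :=
  ⟨h.1.conjTranspose_mul_mul_same V, by
    rw [trace_mul_comm, ← Matrix.mul_assoc, h2, one_mul, h.2]⟩

/-- Test against the diagonal unitary of signs. -/
theorem UnitaryTraceLE.sum_abs_diag_le {X : Matrix a a ℂ} {ε : ℝ} (h : UnitaryTraceLE X ε) :
    ∑ i, |(X i i).re| ≤ ε := by
  set e : a → ℝ := fun i => if 0 ≤ (X i i).re then 1 else -1 with he
  have he2 : ∀ i, e i * e i = 1 := fun i => by simp only [he]; split_ifs <;> norm_num
  have hDs : (diagonal fun i => (e i : ℂ))ᴴ = diagonal fun i => (e i : ℂ) := by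
    rw [diagonal_conjTranspose]
    congr 1
    ext i
    simp
  have hDD : (diagonal fun i => (e i : ℂ)) * (diagonal fun i => (e i : ℂ)) = 1 := by
    rw [diagonal_mul_diagonal, ← diagonal_one]
    congr 1
    ext i
    exact_mod_cast he2 i
  have h1 := h (diagonal fun i => (e i : ℂ)) (by rw [hDs, hDD]) (by rw [hDs, hDD])
  refine le_trans (le_of_eq ?_) ((Complex.re_le_norm _).trans h1)
  rw [Matrix.trace, Complex.re_sum]
  refine Finset.sum_congr rfl fun i _ => ?_
  rw [diag_apply, diagonal_mul, Complex.re_ofReal_mul]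
  simp only [he]
  split_ifs with h0
  · rw [abs_of_nonneg h0, one_mul]
  · rw [abs_of_neg (not_le.1 h0), neg_one_mul]

theorem UnitaryTraceLE.conj {X V : Matrix a a ℂ} {ε : ℝ} (h : UnitaryTraceLE X ε)
    (h1 : Vᴴ * V = 1) (h2 : V * Vᴴ = 1) : UnitaryTraceLE (Vᴴ * X * V) ε := by
  intro U hU hU'
  have h3 := h (V * U * Vᴴ) ?_ ?_
  · have h4 : (V * U * Vᴴ * X).trace = (U * (Vᴴ * X * V)).trace := by
      rw [Matrix.mul_assoc, Matrix.mul_assoc, trace_mul_comm]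
      simp only [Matrix.mul_assoc]
    rwa [h4] at h3
  · calc _ = V * (Uᴴ * (Vᴴ * V) * U) * Vᴴ := by
          simp only [conjTranspose_mul, conjTranspose_conjTranspose, Matrix.mul_assoc]
      _ = 1 := by rw [h1, mul_one, hU, mul_one, h2]
  · calc _ = V * (U * (Vᴴ * V) * Uᴴ) * Vᴴ := by
          simp only [conjTranspose_mul, conjTranspose_conjTranspose, Matrix.mul_assoc]
      _ = 1 := by rw [h1, mul_one, hU', mul_one, h2]

theorem massEntropy_diag_le_of_close {ρ σ : Matrix a a ℂ} (hρ : IsState ρ) (hσ : IsState σ)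
    {ε : ℝ} (h : UnitaryTraceLE (σ - ρ) ε) :
    (massEntropy fun i => (σ i i).re) ≤ (massEntropy fun i => (ρ i i).re) +
      ε * Real.log (Fintype.card a) + (1 + ε) * Real.log 2 := by
  have ha : Nonempty a := by
    by_contra hc
    rw [not_nonempty_iff] at hc
    simpa [Matrix.trace] using hρ.2
  have h1 := h.sum_abs_diag_le
  simpa using sum_massEntropy_le_of_close (ι := Unit) (f := fun _ i => (ρ i i).re)
    (g := fun _ i => (σ i i).re) (fun _ => hρ.diag_nonneg) (fun _ => hσ.diag_nonneg)
    (by simpa using h1) (by simpa using hρ.sum_diag)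

theorem UnitaryTraceLE.symm {ρ σ : Matrix a a ℂ} {ε : ℝ} (h : UnitaryTraceLE (σ - ρ) ε) :
    UnitaryTraceLE (ρ - σ) ε := by
  intro U hU hU'
  rw [← neg_sub σ, Matrix.mul_neg, trace_neg, norm_neg]
  exact h U hU hU'

/-- Measure `σ` in an eigenbasis of `ρ`: this does not lower its entropy, and the resulting
distribution is `ε`-close to the spectrum of `ρ`, so the classical estimate applies. -/
theorem entropy_le_of_close {ρ σ : Matrix a a ℂ} (hρ : IsState ρ) (hσ : IsState σ)
    {ε : ℝ} (h : UnitaryTraceLE (σ - ρ) ε) :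
    entropy σ ≤ entropy ρ + ε * Real.logb 2 (Fintype.card a) + (1 + ε) := by
  have hlog2 : 0 < Real.log 2 := Real.log_pos one_lt_two
  obtain ⟨U, s, hU⟩ := exists_isDiagonalization hρ.1.1
  obtain ⟨V, t, hV⟩ := exists_isDiagonalization hσ.1.1
  have h1 := h.conj hU.star_mul hU.mul_star
  rw [Matrix.mul_sub, Matrix.sub_mul] at h1
  have hσ' := hσ.conj hU.mul_star
  have h2 := massEntropy_diag_le_of_close (hρ.conj hU.mul_star) hσ' h1
  have h3 := (hV.conj hU.star_mul hU.mul_star).sum_negMulLog_le (hV.nonneg hσ.1)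
  rw [← massEntropy_of_sum_eq_one hσ'.sum_diag] at h3
  rw [hU.conj_eq] at h2
  simp only [diagonal_apply_eq, Complex.ofReal_re] at h2
  rw [massEntropy_of_sum_eq_one (hU.sum_eq_one hρ)] at h2
  rw [hV.entropy, hU.entropy, div_le_iff₀ hlog2, Real.logb]
  refine (h3.trans h2).trans_eq ?_
  field_simp

theorem relEntropyCoherence_le_of_close {ρ σ : Matrix a a ℂ} (hρ : IsState ρ) (hσ : IsState σ)
    {ε : ℝ} (h : UnitaryTraceLE (σ - ρ) ε) :
    relEntropyCoherence σ ≤ relEntropyCoherence ρ +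
      2 * ε * Real.logb 2 (Fintype.card a) + 2 * (1 + ε) := by
  have hlog2 : 0 < Real.log 2 := Real.log_pos one_lt_two
  have h1 := entropy_le_of_close hσ hρ h.symm
  have h2 : entropy (dephase σ) ≤ entropy (dephase ρ) + ε * Real.logb 2 (Fintype.card a) +
      (1 + ε) := by
    rw [hσ.entropy_dephase, hρ.entropy_dephase, div_le_iff₀ hlog2, Real.logb]
    refine (massEntropy_diag_le_of_close hρ hσ h).trans_eq ?_
    field_simp
  rw [relEntropyCoherence_eq hσ, relEntropyCoherence_eq hρ]
  linarith

theorem relEntropyCoherence_maxCoherent_le {d : ℕ} (hd : 0 < d) :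
    relEntropyCoherence (pureState (maxCoherentVector d)) ≤ Real.logb 2 d := by
  have hlog2 : 0 < Real.log 2 := Real.log_pos one_lt_two
  have hs := (isUnitVector_maxCoherentVector hd).isState
  obtain ⟨U, s, hU⟩ := exists_isDiagonalization hs.1.1
  have h0 : 0 ≤ entropy (pureState (maxCoherentVector d)) := by
    rw [hU.entropy]
    have := massEntropy_nonneg (hU.nonneg hs.1)
    rw [massEntropy_of_sum_eq_one (hU.sum_eq_one hs)] at this
    positivity
  have h1 := massEntropy_le_log_card hs.diag_nonneg
  rw [hs.sum_diag, one_mul, Fintype.card_fin] at h1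
  rw [relEntropyCoherence_eq hs, hs.entropy_dephase, Real.logb]
  have := div_le_div_of_nonneg_right h1 hlog2.le
  linarith

end QuantumEntropy

/-! ### Recovering averaged logarithms from averaged resolvents. -/

section LogComparison

variable {ι κ : Type*} [Fintype ι] [Fintype κ]

theorem hasDerivAt_sum_log {c l x : ι → ℝ} (h : ∀ k, c k ≠ 0 → 0 < l k ∧ 0 < x k) {M : ℝ}
    (hM : 0 ≤ M) :
    HasDerivAt (fun M => ∑ k, c k * (Real.log (x k + M * l k) - Real.log (x k)))
      (∑ k, c k * (l k / (x k + M * l k))) M := by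
  refine HasDerivAt.fun_sum fun k _ => ?_
  by_cases hk : c k = 0
  · simpa [hk] using hasDerivAt_const M (0 : ℝ)
  · obtain ⟨hl, hx⟩ := h k hk
    have h1 : HasDerivAt (fun M => x k + M * l k) (l k) M := by
      simpa using ((hasDerivAt_id M).mul_const (l k)).const_add (x k)
    exact ((h1.log (by positivity)).sub_const _).const_mul _

/-- Because the weights sum to one, `log M` can be absorbed into each term, giving `log(x/M + l)`,
which tends to `log l`. -/
theorem tendsto_sum_log {c l x : ι → ℝ} (h : ∀ k, c k ≠ 0 → 0 < l k ∧ 0 < x k)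
    (h1 : ∑ k, c k = 1) :
    Tendsto (fun M => ∑ k, c k * (Real.log (x k + M * l k) - Real.log (x k)) - Real.log M) atTop
      (𝓝 (∑ k, c k * (Real.log (l k) - Real.log (x k)))) := by
  have h2 : Tendsto (fun M => ∑ k, c k * (Real.log (x k / M + l k) - Real.log (x k))) atTop
      (𝓝 (∑ k, c k * (Real.log (l k) - Real.log (x k)))) := by
    refine tendsto_finsetSum _ fun k _ => ?_
    by_cases hk : c k = 0
    · simp [hk]
    · obtain ⟨hl, hx⟩ := h k hk
      refine ((Tendsto.log ?_ hl.ne').sub_const _).const_mul _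
      simpa using (tendsto_const_nhds.div_atTop tendsto_id).add_const (l k)
  refine h2.congr' ?_
  filter_upwards [eventually_gt_atTop 0] with M hM
  have h3 : ∀ k, c k * (Real.log (x k / M + l k) - Real.log (x k)) =
      c k * (Real.log (x k + M * l k) - Real.log (x k)) - c k * Real.log M := by
    intro k
    by_cases hk : c k = 0
    · simp [hk]
    · obtain ⟨hl, hx⟩ := h k hk
      have : x k / M + l k = (x k + M * l k) / M := by field_simp
      rw [this, Real.log_div (by positivity) hM.ne']
      ring
  simp only [h3, Finset.sum_sub_distrib, ← Finset.sum_mul, h1, one_mul]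

/-- Two averages of logarithmic ratios can be compared through resolvents. -/
theorem sum_log_le_of_resolvent_le {c l x : ι → ℝ} {c' l' x' : κ → ℝ}
    (h : ∀ k, c k ≠ 0 → 0 < l k ∧ 0 < x k) (h' : ∀ k, c' k ≠ 0 → 0 < l' k ∧ 0 < x' k)
    (h1 : ∑ k, c k = 1) (h1' : ∑ k, c' k = 1)
    (hle : ∀ M, 0 < M → ∑ k, c' k * (l' k / (x' k + M * l' k)) ≤
      ∑ k, c k * (l k / (x k + M * l k))) :
    ∑ k, c' k * (Real.log (l' k) - Real.log (x' k)) ≤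
      ∑ k, c k * (Real.log (l k) - Real.log (x k)) := by
  refine le_of_tendsto_of_tendsto (tendsto_sum_log h' h1') (tendsto_sum_log h h1) ?_
  filter_upwards [eventually_ge_atTop 0] with M hM
  refine sub_le_sub_right ?_ _
  -- Both terms vanish at `M = 0` and have the resolvent averages as derivatives, so the resolvent
  -- inequality makes `φ` antitone and hence non-positive.
  set φ : ℝ → ℝ := fun M => ∑ k, c' k * (Real.log (x' k + M * l' k) - Real.log (x' k)) -
    ∑ k, c k * (Real.log (x k + M * l k) - Real.log (x k)) with hφ
  have hd : ∀ {t : ℝ}, 0 ≤ t → HasDerivAt φ (∑ k, c' k * (l' k / (x' k + t * l' k)) -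
      ∑ k, c k * (l k / (x k + t * l k))) t := fun ht =>
    (hasDerivAt_sum_log h' ht).sub (hasDerivAt_sum_log h ht)
  have hanti : AntitoneOn φ (Set.Ici 0) := by
    refine antitoneOn_of_deriv_nonpos (convex_Ici 0)
      (fun t ht => (hd ht).continuousAt.continuousWithinAt)
      (fun t ht => (hd (interior_subset ht)).differentiableAt.differentiableWithinAt) fun t ht => ?_
    rw [interior_Ici] at ht
    rw [(hd (le_of_lt ht)).deriv]
    exact sub_nonpos.2 (hle t ht)
  have h0 : φ 0 = 0 := by simp [hφ]
  have := hanti (Set.mem_Ici.2 le_rfl) (Set.mem_Ici.2 hM) hM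
  rw [h0] at this
  exact sub_nonpos.1 this

end LogComparison

/-! ### Data processing for relative entropy and monotonicity of `C_r`. -/

section DataProcessing

variable {a b ι κ : Type*} [Fintype a] [DecidableEq a] [Fintype b] [DecidableEq b]
  [Fintype ι] [Fintype κ]

/-- The quadratic functional whose maximum over `Z` is the resolvent form of `(ρ, σ)`. -/
noncomputable def resolventForm (t : ℝ) (ρ σ Z : Matrix a a ℂ) : ℝ :=
  2 * (Zᴴ * ρ).trace.re - (Zᴴ * σ * Z).trace.re - t * (Z * ρ * Zᴴ).trace.re

/-- Expressing the columns of `Z` in the eigenbasis of `ρ` decouples the form into independent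
scalar quadratics, one for each entry of `Z U`. -/
theorem resolventForm_eq {U ρ Z : Matrix a a ℂ} {l : a → ℝ} (h : IsDiagonalization U l ρ)
    (t : ℝ) (x : a → ℝ) :
    resolventForm t ρ (diagonal fun j => (x j : ℂ)) Z =
      ∑ z : a × a, (2 * (star ((Z * U) z.1 z.2) * U z.1 z.2).re * l z.2 -
        ‖(Z * U) z.1 z.2‖ ^ 2 * (x z.1 + t * l z.2)) := by
  set W := Z * U with hW
  have h1 : (Zᴴ * ρ).trace.re = ∑ j, ∑ i, (star (W j i) * U j i).re * l i := by
    have : (Zᴴ * ρ).trace = (Wᴴ * (U * diagonal fun i => (l i : ℂ))).trace := by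
      rw [hW, h.eq, conjTranspose_mul, trace_mul_comm, Matrix.mul_assoc, trace_mul_comm]
    rw [this, Matrix.trace, Complex.re_sum, Finset.sum_comm]
    refine Finset.sum_congr rfl fun i _ => ?_
    rw [diag_apply, Matrix.mul_apply, Complex.re_sum]
    refine Finset.sum_congr rfl fun j _ => ?_
    rw [conjTranspose_apply, mul_diagonal, ← mul_assoc, Complex.re_mul_ofReal]
  have h2 : (Zᴴ * diagonal (fun j => (x j : ℂ)) * Z).trace.re = ∑ j, ∑ i, ‖W j i‖ ^ 2 * x j := by
    have : (Zᴴ * diagonal (fun j => (x j : ℂ)) * Z).trace =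
        (W * Wᴴ * diagonal fun j => (x j : ℂ)).trace := by
      have h3 : W * Wᴴ = Z * Zᴴ := by
        rw [hW, conjTranspose_mul, Matrix.mul_assoc, ← Matrix.mul_assoc U, h.mul_star, one_mul]
      rw [h3, trace_mul_comm, ← Matrix.mul_assoc]
    rw [this, Matrix.trace, Complex.re_sum]
    refine Finset.sum_congr rfl fun j _ => ?_
    rw [diag_apply, mul_diagonal, Matrix.mul_apply, Complex.re_mul_ofReal, Complex.re_sum,
      Finset.sum_mul]
    refine Finset.sum_congr rfl fun i _ => ?_
    rw [conjTranspose_apply, mul_star_self_eq, Complex.ofReal_re]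
  have h3 : (Z * ρ * Zᴴ).trace.re = ∑ j, ∑ i, ‖W j i‖ ^ 2 * l i := by
    have : (Z * ρ * Zᴴ) = (W * (diagonal fun i => (l i : ℂ))) * Wᴴ := by
      rw [hW, h.eq, conjTranspose_mul]
      simp only [Matrix.mul_assoc]
    rw [this, Matrix.trace, Complex.re_sum]
    refine Finset.sum_congr rfl fun j _ => ?_
    rw [diag_apply, Matrix.mul_apply, Complex.re_sum]
    refine Finset.sum_congr rfl fun i _ => ?_
    rw [mul_diagonal, conjTranspose_apply, mul_right_comm, mul_star_self_eq, ← Complex.ofReal_mul,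
      Complex.ofReal_re]
  rw [resolventForm, h1, h2, h3, Fintype.sum_prod_type]
  simp only [Finset.mul_sum, ← Finset.sum_sub_distrib]
  refine Finset.sum_congr rfl fun j _ => Finset.sum_congr rfl fun i _ => ?_
  ring

theorem resolventForm_le {U ρ : Matrix a a ℂ} {l : a → ℝ} (h : IsDiagonalization U l ρ)
    (hl : ∀ i, 0 ≤ l i) {t : ℝ} (ht : 0 < t) {x : a → ℝ} (hx : ∀ j, 0 ≤ x j) (Z : Matrix a a ℂ) :
    resolventForm t ρ (diagonal fun j => (x j : ℂ)) Z ≤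
      ∑ z : a × a, ‖U z.1 z.2‖ ^ 2 * l z.2 * (l z.2 / (x z.1 + t * l z.2)) := by
  rw [resolventForm_eq h]
  refine Finset.sum_le_sum fun ⟨j, i⟩ _ => ?_
  simp only
  set w := (Z * U) j i
  set u := U j i
  rcases (hl i).eq_or_lt with hi | hi
  · rw [← hi]
    have := mul_nonneg (sq_nonneg ‖w‖) (hx j)
    simpa using this
  · have hc : 0 < x j + t * l i := by have := hx j; positivity
    have h1 : (star w * u).re ≤ ‖w‖ * ‖u‖ := by
      refine (Complex.re_le_norm _).trans_eq ?_
      rw [norm_mul, norm_star]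
    have h2 : ‖u‖ ^ 2 * l i * (l i / (x j + t * l i)) = (‖u‖ * l i) ^ 2 / (x j + t * l i) := by
      ring
    rw [h2, le_div_iff₀ hc]
    have h3 := mul_le_mul_of_nonneg_right h1 (mul_nonneg hi.le hc.le)
    nlinarith [sq_nonneg (‖w‖ * (x j + t * l i) - ‖u‖ * l i)]

theorem exists_resolventForm_eq {U ρ : Matrix a a ℂ} {l : a → ℝ} (h : IsDiagonalization U l ρ)
    (hl : ∀ i, 0 ≤ l i) {t : ℝ} (ht : 0 < t) {x : a → ℝ} (hx : ∀ j, 0 ≤ x j) :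
    ∃ Z, resolventForm t ρ (diagonal fun j => (x j : ℂ)) Z =
      ∑ z : a × a, ‖U z.1 z.2‖ ^ 2 * l z.2 * (l z.2 / (x z.1 + t * l z.2)) := by
  -- Entrywise maximizer of `2 Re(w̄ u) l - |w|² (x + t l)`, namely `w = u l / (x + t l)`.
  set M : Matrix a a ℂ := of fun j i => ((l i / (x j + t * l i) : ℝ) : ℂ) * U j i with hM
  refine ⟨M * Uᴴ, ?_⟩
  rw [resolventForm_eq h, Matrix.mul_assoc, h.star_mul, mul_one]
  refine Finset.sum_congr rfl fun ⟨j, i⟩ _ => ?_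
  simp only [hM, of_apply]
  have h1 : star (((l i / (x j + t * l i) : ℝ) : ℂ) * U j i) * U j i =
      star ((l i / (x j + t * l i) : ℝ) : ℂ) * (U j i * star (U j i)) := by
    rw [star_mul']
    ring
  rw [h1, mul_star_self_eq, norm_mul, Complex.norm_real, Complex.star_def, Complex.conj_ofReal, ← Complex.ofReal_mul, Complex.ofReal_re,
    Real.norm_eq_abs, mul_pow, sq_abs]
  rcases (hl i).eq_or_lt with hi | hi
  · simp [← hi]
  · have hc : 0 < x j + t * l i := by have := hx j; positivity
    field_simp
    ring

/-- The Kadison–Schwarz inequality for the dual map `Z ↦ ∑ K† Z K`, against a positive `τ`. -/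
theorem trace_schwarz {K : ι → Matrix b a ℂ} (hK : ∑ α, (K α)ᴴ * K α = 1) {τ : Matrix a a ℂ}
    (hτ : τ.PosSemidef) (Z : Matrix b b ℂ) :
    ((∑ α, (K α)ᴴ * Z * K α) * τ * (∑ α, (K α)ᴴ * Z * K α)ᴴ).trace.re ≤
      (Z * (∑ α, K α * τ * (K α)ᴴ) * Zᴴ).trace.re := by
  set W := ∑ α, (K α)ᴴ * Z * K α with hW
  -- The sum over `α` of these non-negative traces is exactly the difference of the two sides.
  have h0 : ∀ α, 0 ≤ ((Z * K α - K α * W) * τ * (Z * K α - K α * W)ᴴ).trace.re := fun α =>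
    (Complex.le_def.1 (hτ.mul_mul_conjTranspose_same _).trace_nonneg).1
  have h1 : ∀ α, ((Z * K α - K α * W) * τ * (Z * K α - K α * W)ᴴ).trace =
      (Z * (K α * τ * (K α)ᴴ) * Zᴴ).trace - (((K α)ᴴ * Z * K α) * τ * Wᴴ).trace -
      (W * τ * ((K α)ᴴ * Z * K α)ᴴ).trace + (((K α)ᴴ * K α) * (W * τ * Wᴴ)).trace := by
    intro α
    have e1 : (Z * K α * τ * (K α * W)ᴴ).trace = (((K α)ᴴ * Z * K α) * τ * Wᴴ).trace := by
      rw [conjTranspose_mul, ← Matrix.mul_assoc, trace_mul_comm]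
      simp only [Matrix.mul_assoc]
    have e2 : (K α * W * τ * (Z * K α)ᴴ).trace = (W * τ * ((K α)ᴴ * Z * K α)ᴴ).trace := by
      rw [Matrix.mul_assoc (K α), Matrix.mul_assoc (K α), trace_mul_comm]
      simp only [conjTranspose_mul, conjTranspose_conjTranspose, Matrix.mul_assoc]
    have e3 : (K α * W * τ * (K α * W)ᴴ).trace = (((K α)ᴴ * K α) * (W * τ * Wᴴ)).trace := by
      rw [conjTranspose_mul, ← Matrix.mul_assoc, trace_mul_comm]
      simp only [Matrix.mul_assoc]
    have e4 : (Z * K α * τ * (Z * K α)ᴴ).trace = (Z * (K α * τ * (K α)ᴴ) * Zᴴ).trace := by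
      simp only [conjTranspose_mul, Matrix.mul_assoc]
    rw [conjTranspose_sub, Matrix.mul_sub, Matrix.sub_mul, Matrix.sub_mul, Matrix.sub_mul,
      trace_sub, trace_sub, trace_sub, e1, e2, e3, e4]
    ring
  have h2 : ∑ α, ((Z * K α - K α * W) * τ * (Z * K α - K α * W)ᴴ).trace =
      (Z * (∑ α, K α * τ * (K α)ᴴ) * Zᴴ).trace - (W * τ * Wᴴ).trace := by
    rw [Finset.sum_congr rfl fun α _ => h1 α]
    simp only [Finset.sum_add_distrib, Finset.sum_sub_distrib, ← trace_sum, ← Matrix.sum_mul,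
      ← Matrix.mul_sum, ← conjTranspose_sum, hK, ← hW, one_mul]
    ring
  have h3 := Finset.sum_nonneg fun α (_ : α ∈ Finset.univ) => h0 α
  rw [← Complex.re_sum, h2, Complex.sub_re] at h3
  linarith

/-- Replacing `Z` by its dual image keeps the linear term and can only shrink the two subtracted
quadratic terms: Schwarz for `Z` handles `ρ`, Schwarz for `Z†` handles `σ`. -/
theorem resolventForm_kraus_le {K : ι → Matrix b a ℂ} (hK : ∑ α, (K α)ᴴ * K α = 1)
    {ρ σ : Matrix a a ℂ} (hρ : ρ.PosSemidef) (hσ : σ.PosSemidef) {t : ℝ} (ht : 0 < t)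
    (Z : Matrix b b ℂ) :
    resolventForm t (∑ α, K α * ρ * (K α)ᴴ) (∑ α, K α * σ * (K α)ᴴ) Z ≤
      resolventForm t ρ σ (∑ α, (K α)ᴴ * Z * K α) := by
  have h1 := trace_schwarz hK hρ Z
  have h2 := trace_schwarz hK hσ Zᴴ
  have hW : ∑ α, (K α)ᴴ * Zᴴ * K α = (∑ α, (K α)ᴴ * Z * K α)ᴴ := by
    simp only [conjTranspose_sum, conjTranspose_mul, conjTranspose_conjTranspose, Matrix.mul_assoc]
  rw [conjTranspose_conjTranspose, hW, conjTranspose_conjTranspose] at h2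
  have h3 : (Zᴴ * ∑ α, K α * ρ * (K α)ᴴ).trace = ((∑ α, (K α)ᴴ * Z * K α)ᴴ * ρ).trace := by
    rw [← hW, Matrix.mul_sum, Matrix.sum_mul, trace_sum, trace_sum]
    refine Finset.sum_congr rfl fun α _ => ?_
    rw [← Matrix.mul_assoc, ← Matrix.mul_assoc, trace_mul_comm]
    simp only [Matrix.mul_assoc]
  have h4 := mul_le_mul_of_nonneg_left h1 ht.le
  rw [resolventForm, resolventForm, h3]
  linarith

theorem IsDiagonalization.pos_of_overlap_ne_zero {U ρ : Matrix a a ℂ} {l x : a → ℝ}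
    (h : IsDiagonalization U l ρ) (hl : ∀ i, 0 ≤ l i) (hx : ∀ j, 0 ≤ x j)
    (hs : ∀ j, x j = 0 → (ρ j j).re = 0) (z : a × a) (hz : ‖U z.1 z.2‖ ^ 2 * l z.2 ≠ 0) :
    0 < l z.2 ∧ 0 < x z.1 := by
  refine ⟨(hl _).lt_of_ne' (right_ne_zero_of_mul hz), (hx _).lt_of_ne' fun h0 => hz ?_⟩
  have h1 := hs _ h0
  rw [h.diag_re] at h1
  exact (Finset.sum_eq_zero_iff_of_nonneg fun i _ => mul_nonneg (sq_nonneg _) (hl i)).1 h1 z.2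
    (Finset.mem_univ _)

theorem IsDiagonalization.sum_overlap {U ρ : Matrix a a ℂ} {l : a → ℝ}
    (h : IsDiagonalization U l ρ) (hρ : IsState ρ) :
    ∑ z : a × a, ‖U z.1 z.2‖ ^ 2 * l z.2 = 1 := by
  rw [Fintype.sum_prod_type, ← hρ.sum_diag]
  exact Finset.sum_congr rfl fun j _ => (h.diag_re j).symm

/-- The overlap weights `|U_ji|² l_i` write the quantum relative entropy against a diagonal
operator, in nats, as a classical average of log ratios. -/
theorem IsDiagonalization.sum_overlap_log {U ρ : Matrix a a ℂ} {l : a → ℝ}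
    (h : IsDiagonalization U l ρ) (x : a → ℝ) :
    ∑ z : a × a, ‖U z.1 z.2‖ ^ 2 * l z.2 * (Real.log (l z.2) - Real.log (x z.1)) =
      ∑ j, (ρ j j).re * -Real.log (x j) - ∑ i, Real.negMulLog (l i) := by
  simp only [mul_sub, Finset.sum_sub_distrib]
  have h1 : ∑ z : a × a, ‖U z.1 z.2‖ ^ 2 * l z.2 * Real.log (l z.2) =
      -∑ i, Real.negMulLog (l i) := by
    rw [Fintype.sum_prod_type, Finset.sum_comm, ← Finset.sum_neg_distrib]
    refine Finset.sum_congr rfl fun i _ => ?_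
    simp only [mul_assoc]
    rw [← Finset.sum_mul, sum_norm_sq_col h.star_mul, one_mul, Real.negMulLog, neg_mul, neg_neg]
  have h2 : ∑ z : a × a, ‖U z.1 z.2‖ ^ 2 * l z.2 * Real.log (x z.1) =
      -∑ j, (ρ j j).re * -Real.log (x j) := by
    rw [Fintype.sum_prod_type, ← Finset.sum_neg_distrib]
    refine Finset.sum_congr rfl fun j _ => ?_
    simp only
    rw [h.diag_re, ← Finset.sum_mul, mul_neg, neg_neg]
  rw [h1, h2]
  ring

/-- Incoherent operations do not increase the relative entropy of coherence. -/
theorem relEntropyCoherence_kraus_le {K : ι → Matrix b a ℂ} (hK : ∑ α, (K α)ᴴ * K α = 1)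
    (hI : ∀ α, IsIncoherentKraus (K α)) {ρ : Matrix a a ℂ} (hρ : IsState ρ) :
    relEntropyCoherence (∑ α, K α * ρ * (K α)ᴴ) ≤ relEntropyCoherence ρ := by
  have hlog2 : 0 < Real.log 2 := Real.log_pos one_lt_two
  set ρ' := ∑ α, K α * ρ * (K α)ᴴ with hρ'd
  have hρ' : IsState ρ' := hρ.kraus hK
  -- The comparison state is `Δ(ρ)`, for which the relative entropy equals `C_r(ρ)`; incoherence of
  -- the Kraus operators keeps its image diagonal.
  set x : a → ℝ := fun j => (ρ j j).re with hx
  have hx0 : ∀ j, 0 ≤ x j := hρ.diag_nonneg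
  set σ : Matrix a a ℂ := diagonal fun j => (x j : ℂ) with hσ
  have hσs : IsState σ := by
    refine ⟨PosSemidef.diagonal fun j => Complex.zero_le_real.2 (hx0 j), ?_⟩
    rw [hσ, trace_diagonal, ← Complex.ofReal_sum, hρ.sum_diag, Complex.ofReal_one]
  set σ' := ∑ α, K α * σ * (K α)ᴴ with hσ'd
  have hσ' : IsIncoherentState σ' := by
    refine ⟨hσs.kraus hK, fun y y' hne => ?_⟩
    change σ' y y' = 0
    rw [hσ'd, Matrix.sum_apply]
    exact Finset.sum_eq_zero fun α _ => hI α σ ⟨hσs, isDiag_diagonal _⟩ hne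
  set x' : b → ℝ := fun y => (σ' y y).re with hx'
  have hx'0 : ∀ y, 0 ≤ x' y := hσ'.1.diag_nonneg
  have hσ'e : σ' = diagonal fun y => (x' y : ℂ) := hσ'.eq_diagonal
  obtain ⟨U, l, h⟩ := exists_isDiagonalization hρ.1.1
  obtain ⟨U', l', h'⟩ := exists_isDiagonalization hρ'.1.1
  have hl := h.nonneg hρ.1
  have hl' := h'.nonneg hρ'.1
  have hsupp : ∀ y, x' y = 0 → (ρ' y y).re = 0 := by
    intro y hy
    obtain ⟨V, hV⟩ := exists_isEnsemble hρ.1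
    have h1 := (hV.kraus K).diag_eq y
    have h2 : ∀ α j, K α y j = 0 ∨ x j = 0 := by
      have h6 : ∑ α, ∑ j, ‖K α y j‖ ^ 2 * x j = 0 := by
        rw [← hy]
        simp only [hx', hσ'd, Matrix.sum_apply, Complex.re_sum, Matrix.mul_apply, hσ,
          conjTranspose_apply]
        refine Finset.sum_congr rfl fun α _ => Finset.sum_congr rfl fun j _ => ?_
        rw [← Matrix.mul_apply, mul_diagonal, mul_right_comm, mul_star_self_eq,
          ← Complex.ofReal_mul, Complex.ofReal_re]
      intro α j
      have h7 : ∀ α j, 0 ≤ ‖K α y j‖ ^ 2 * x j := fun α j => mul_nonneg (sq_nonneg _) (hx0 j)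
      have h8 := (Finset.sum_eq_zero_iff_of_nonneg fun α _ =>
        Finset.sum_nonneg fun j _ => h7 α j).1 h6 α (Finset.mem_univ α)
      have h9 := (Finset.sum_eq_zero_iff_of_nonneg fun j _ => h7 α j).1 h8 j (Finset.mem_univ j)
      simpa using h9
    have h3 : ∀ j, x j = 0 → ∀ k, V k j = 0 := by
      intro j hj k
      have h4 := hV.diag_eq j
      have h5 : ∑ k, ‖V k j‖ ^ 2 = 0 := by
        rw [← Complex.ofReal_re (∑ k, ‖V k j‖ ^ 2), ← h4]
        exact hj
      simpa using (Finset.sum_eq_zero_iff_of_nonneg fun k _ => sq_nonneg ‖V k j‖).1 h5 k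
        (Finset.mem_univ k)
    rw [hρ'd, h1, Complex.ofReal_re]
    refine Finset.sum_eq_zero fun z _ => ?_
    have : (K z.2 *ᵥ V z.1) y = 0 := by
      refine Finset.sum_eq_zero fun j _ => ?_
      rcases h2 z.2 j with h4 | h4
      · simp [h4]
      · simp [h3 j h4]
    rw [this, norm_zero, zero_pow two_ne_zero]
  have hle : ∀ M, 0 < M →
      ∑ z : b × b, ‖U' z.1 z.2‖ ^ 2 * l' z.2 * (l' z.2 / (x' z.1 + M * l' z.2)) ≤
        ∑ z : a × a, ‖U z.1 z.2‖ ^ 2 * l z.2 * (l z.2 / (x z.1 + M * l z.2)) := by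
    intro M hM
    obtain ⟨Z, hZ⟩ := exists_resolventForm_eq h' hl' hM hx'0
    rw [← hZ, ← hσ'e]
    exact (resolventForm_kraus_le hK hρ.1 hσs.1 hM Z).trans (resolventForm_le h hl hM hx0 _)
  have main := sum_log_le_of_resolvent_le (h.pos_of_overlap_ne_zero hl hx0 fun j hj => hj)
    (h'.pos_of_overlap_ne_zero hl' hx'0 hsupp) (h.sum_overlap hρ) (h'.sum_overlap hρ') hle
  rw [h.sum_overlap_log, h'.sum_overlap_log] at main
  -- The image `σ'` need not be `Δ(ρ')`; by Gibbs' inequality passing to `Δ(ρ')` only lowers the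
  -- relative entropy.
  have hgibbs := massEntropy_le_neg_log hρ'.diag_nonneg hx'0 hsupp hσ'.1.sum_diag.le
  rw [relEntropyCoherence_eq hρ, relEntropyCoherence_eq hρ', hρ.entropy_dephase,
    hρ'.entropy_dephase, h.entropy, h'.entropy, ← sub_div, ← sub_div]
  refine div_le_div_of_nonneg_right ?_ hlog2.le
  rw [massEntropy_of_sum_eq_one hρ.sum_diag]
  simp only [Real.negMulLog, hx] at main hgibbs ⊢
  simp only [mul_neg, neg_mul] at main hgibbs ⊢
  linarith

theorem relEntropyCoherence_monotone {I : Matrix a a ℂ →ₗ[ℂ] Matrix b b ℂ}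
    (hI : IsIncoherentOperation I) {ρ : Matrix a a ℂ} (hρ : IsState ρ) :
    relEntropyCoherence (I ρ) ≤ relEntropyCoherence ρ := by
  obtain ⟨m, K, hK, hK', h⟩ := hI
  rw [h]
  exact relEntropyCoherence_kraus_le hK hK' hρ

end DataProcessing

/-! ### Invariance under relabelling of the basis. -/

section Reindexing

variable {a b c d ι κ : Type*} [Fintype a] [DecidableEq a] [Fintype b] [DecidableEq b]
  [Fintype c] [DecidableEq c] [Fintype d] [DecidableEq d] [Fintype ι] [Fintype κ]

/-- A relabelling has a single permutation-like Kraus operator. Used in both directions, it makes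
any quantity that is monotone under incoherent operations invariant. -/
theorem isIncoherentOperation_reindex (e : a ≃ b) :
    IsIncoherentOperation (reindexLinearEquiv ℂ ℂ e e).toLinearMap := by
  refine isIncoherentOperation_of_kraus (ι := Unit) (K := fun _ => (1 : Matrix a a ℂ).submatrix
    e.symm id) ?_ (fun _ => isIncoherentKraus_iff.2 fun j y y' hy hy' => ?_) fun ρ => ?_
  · ext x y
    simp [Matrix.one_apply]
  · simp only [submatrix_apply, id, Matrix.one_apply, ne_eq, ite_eq_right_iff, one_ne_zero,
      imp_false, not_not] at hy hy'
    exact e.symm.injective (hy.trans hy'.symm)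
  · ext x y
    simp [Matrix.mul_apply, Matrix.one_apply]

theorem isState_submatrix {ρ : Matrix a a ℂ} (h : IsState ρ) (e : b ≃ a) :
    IsState (ρ.submatrix e e) :=
  (isIncoherentOperation_reindex e.symm).isState h

theorem coherenceOfFormation_submatrix_le {ρ : Matrix a a ℂ} (h : IsState ρ) (e : b ≃ a) :
    coherenceOfFormation (ρ.submatrix e e) ≤ coherenceOfFormation ρ :=
  coherenceOfFormation_monotone (isIncoherentOperation_reindex e.symm) h

theorem relEntropyCoherence_submatrix_le {ρ : Matrix a a ℂ} (h : IsState ρ) (e : b ≃ a) :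
    relEntropyCoherence (ρ.submatrix e e) ≤ relEntropyCoherence ρ :=
  relEntropyCoherence_monotone (isIncoherentOperation_reindex e.symm) h

theorem coherenceOfFormation_submatrix {ρ : Matrix a a ℂ} (h : IsState ρ) (e : b ≃ a) :
    coherenceOfFormation (ρ.submatrix e e) = coherenceOfFormation ρ := by
  refine le_antisymm (coherenceOfFormation_submatrix_le h e) ?_
  have := coherenceOfFormation_submatrix_le (isState_submatrix h e) e.symm
  simpa using this

theorem relEntropyCoherence_submatrix {ρ : Matrix a a ℂ} (h : IsState ρ) (e : b ≃ a) :
    relEntropyCoherence (ρ.submatrix e e) = relEntropyCoherence ρ := by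
  refine le_antisymm (relEntropyCoherence_submatrix_le h e) ?_
  have := relEntropyCoherence_submatrix_le (isState_submatrix h e) e.symm
  simpa using this

end Reindexing

/-! ### Tensor powers of states and of bipartite states. -/

section StatePowers

variable {a b c e : Type*} [Fintype a] [DecidableEq a] [Fintype b] [DecidableEq b]
  [Fintype c] [DecidableEq c] [Fintype e] [DecidableEq e]

/-- The power `ρ^{⊗n}` of a matrix. -/
def statePower (ρ : Matrix e e ℂ) (n : ℕ) : Matrix (Fin n → e) (Fin n → e) ℂ :=
  of fun i j => ∏ l, ρ (i l) (j l)

theorem statePower_one (ρ : Matrix e e ℂ) :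
    statePower ρ 1 = ρ.submatrix (Equiv.funUnique (Fin 1) e) (Equiv.funUnique (Fin 1) e) := by
  ext i j
  simp [statePower]

theorem statePower_succ (ρ : Matrix e e ℂ) (n : ℕ) :
    statePower ρ (n + 1) = (ρ ⊗ₖ statePower ρ n).submatrix (Fin.consEquiv fun _ => e).symm
      (Fin.consEquiv fun _ => e).symm := by
  ext i j
  simp [statePower, Fin.prod_univ_succ, Fin.consEquiv, Fin.tail]

theorem IsState.statePower {ρ : Matrix e e ℂ} (h : IsState ρ) {n : ℕ} (hn : 1 ≤ n) :
    IsState (statePower ρ n) := by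
  induction n, hn using Nat.le_induction with
  | base => rw [statePower_one]; exact isState_submatrix h _
  | succ n hn ih => rw [statePower_succ]; exact isState_submatrix (h.kronecker ih) _

theorem relEntropyCoherence_statePower {ρ : Matrix e e ℂ} (h : IsState ρ) {n : ℕ} (hn : 1 ≤ n) :
    relEntropyCoherence (statePower ρ n) = n * relEntropyCoherence ρ := by
  induction n, hn using Nat.le_induction with
  | base => rw [statePower_one, relEntropyCoherence_submatrix h]; simp
  | succ n hn ih =>
    rw [statePower_succ, relEntropyCoherence_submatrix (h.kronecker (h.statePower hn)),
      relEntropyCoherence_kronecker h (h.statePower hn), ih]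
    push_cast
    ring

theorem coherenceOfFormation_statePower_le {ρ : Matrix e e ℂ} (h : IsState ρ) {n : ℕ}
    (hn : 1 ≤ n) : coherenceOfFormation (statePower ρ n) ≤ n * coherenceOfFormation ρ := by
  induction n, hn using Nat.le_induction with
  | base => rw [statePower_one, coherenceOfFormation_submatrix h]; simp
  | succ n hn ih =>
    rw [statePower_succ, coherenceOfFormation_submatrix (h.kronecker (h.statePower hn))]
    have := coherenceOfFormation_kronecker_le h (h.statePower hn)
    push_cast
    linarith

theorem traceFst_kronecker (ρ : Matrix a a ℂ) (σ : Matrix c c ℂ) :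
    traceFst (ρ ⊗ₖ σ) = ρ.trace • σ := by
  ext x y
  simp [traceFst, Matrix.trace, Finset.sum_mul]

theorem traceSnd_kronecker (ρ : Matrix a a ℂ) (σ : Matrix c c ℂ) :
    traceSnd (ρ ⊗ₖ σ) = σ.trace • ρ := by
  ext x y
  simp [traceSnd, Matrix.trace, ← Finset.mul_sum, mul_comm]

/-- The partial traces of a product state are its factors, so strong superadditivity peels off one
copy at a time. -/
theorem le_coherenceOfFormation_statePower {ρ : Matrix e e ℂ} (h : IsState ρ) {n : ℕ}
    (hn : 1 ≤ n) : n * coherenceOfFormation ρ ≤ coherenceOfFormation (statePower ρ n) := by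
  induction n, hn using Nat.le_induction with
  | base => rw [statePower_one, coherenceOfFormation_submatrix h]; simp
  | succ n hn ih =>
    rw [statePower_succ, coherenceOfFormation_submatrix (h.kronecker (h.statePower hn))]
    have := coherenceOfFormation_superadditive (h.kronecker (h.statePower hn))
    rw [traceFst_kronecker, traceSnd_kronecker, h.2, (h.statePower hn).2, one_smul,
      one_smul] at this
    push_cast
    linarith

/-- The power `ρ^{⊗n}` of a bipartite matrix, with the first and the second systems collected. -/
def blockPower (ρ : Matrix (a × c) (a × c) ℂ) (n : ℕ) :
    Matrix ((Fin n → a) × (Fin n → c)) ((Fin n → a) × (Fin n → c)) ℂ :=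
  (statePower ρ n).submatrix (Equiv.arrowProdEquivProdArrow (Fin n) (fun _ => a) fun _ => c).symm
    (Equiv.arrowProdEquivProdArrow (Fin n) (fun _ => a) fun _ => c).symm

/-- For fixed ancilla labels the block of `ρ^{⊗n}` is a product operator, on which the tensor power
acts factor by factor. -/
theorem tensorId_blockPower (T : Matrix a a ℂ →ₗ[ℂ] Matrix b b ℂ) (ρ : Matrix (a × c) (a × c) ℂ)
    (n : ℕ) :
    tensorId (tensorPower T n) (Fin n → c) (blockPower ρ n) = blockPower (tensorId T c ρ) n := by
  ext x y
  have h := tensorPower_prod T n fun l => of fun i j => ρ (i, x.2 l) (j, y.2 l)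
  exact congrFun (congrFun h x.1) y.1

end StatePowers

/-! ### Channels with ancillas and the diamond norm. -/

section ExtendedMaps

variable {a b c d ι κ : Type*} [Fintype a] [DecidableEq a] [Fintype b] [DecidableEq b]
  [Fintype c] [DecidableEq c] [Fintype d] [DecidableEq d] [Fintype ι] [Fintype κ]

theorem kronecker_one_conj_apply (K : Matrix b a ℂ) (ρ : Matrix (a × c) (a × c) ℂ)
    (x y : b × c) :
    ((K ⊗ₖ (1 : Matrix c c ℂ)) * ρ * (K ⊗ₖ (1 : Matrix c c ℂ))ᴴ) x y =
      (K * (of fun i j => ρ (i, x.2) (j, y.2)) * Kᴴ) x.1 y.1 := by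
  simp only [Matrix.mul_apply, Fintype.sum_prod_type, conjTranspose_apply, kroneckerMap_apply,
    Matrix.one_apply, of_apply, mul_ite, mul_one, mul_zero, ite_mul, zero_mul, Finset.sum_ite_eq,
    Finset.mem_univ, if_true, apply_ite star, star_zero]

theorem isIncoherentOperation_tensorId {I : Matrix a a ℂ →ₗ[ℂ] Matrix b b ℂ}
    (hI : IsIncoherentOperation I) : IsIncoherentOperation (tensorId I c) := by
  obtain ⟨m, K, hK, hK', h⟩ := hI
  refine isIncoherentOperation_of_kraus (K := fun α => K α ⊗ₖ (1 : Matrix c c ℂ)) ?_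
    (fun α => isIncoherentKraus_iff.2 fun j y y' hy hy' => ?_) fun ρ => ?_
  · simp only [conjTranspose_kronecker, ← mul_kronecker_mul, conjTranspose_one, mul_one]
    rw [← one_kronecker_one, ← hK]
    ext x y
    simp only [Matrix.sum_apply, kroneckerMap_apply, Finset.sum_mul]
  · simp only [kroneckerMap_apply, Matrix.one_apply, mul_ite, mul_one, mul_zero, ne_eq,
      ite_eq_right_iff, Classical.not_imp] at hy hy'
    exact Prod.ext (isIncoherentKraus_iff.1 (hK' α) _ _ _ hy.2 hy'.2) (hy.1.trans hy'.1.symm)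
  · ext x y
    rw [Matrix.sum_apply]
    simp only [kronecker_one_conj_apply]
    rw [← Matrix.sum_apply, ← h]
    rfl

/-- The exchange of the last two factors of a product. -/
def rightCommEquiv (a d c : Type*) : (a × d) × c ≃ (a × c) × d where
  toFun z := ((z.1.1, z.2), z.1.2)
  invFun z := ((z.1.1, z.2), z.1.2)
  left_inv _ := rfl
  right_inv _ := rfl

theorem tensorId_withResource (I : Matrix (a × d) (a × d) ℂ →ₗ[ℂ] Matrix b b ℂ)
    (ω : Matrix d d ℂ) (ρ : Matrix (a × c) (a × c) ℂ) :
    tensorId (withResource I ω) c ρ = tensorId I c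
      ((ρ ⊗ₖ ω).submatrix (rightCommEquiv a d c) (rightCommEquiv a d c)) :=
  rfl

theorem trace_tensorId {T : Matrix a a ℂ →ₗ[ℂ] Matrix b b ℂ} (hT : ∀ ρ, (T ρ).trace = ρ.trace)
    (ρ : Matrix (a × c) (a × c) ℂ) : (tensorId T c ρ).trace = ρ.trace := by
  have h : ∀ z : c, ∑ y, tensorId T c ρ (y, z) (y, z) = ∑ x, ρ (x, z) (x, z) := fun z =>
    hT (of fun i j => ρ (i, z) (j, z))
  simp only [Matrix.trace, diag_apply, Fintype.sum_prod_type]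
  rw [Finset.sum_comm, Finset.sum_congr rfl fun z _ => h z, Finset.sum_comm]

theorem IsCPTP.isState_tensorId {T : Matrix a a ℂ →ₗ[ℂ] Matrix b b ℂ} (hT : IsCPTP T) {k : ℕ}
    {ρ : Matrix (a × Fin k) (a × Fin k) ℂ} (hρ : IsState ρ) : IsState (tensorId T (Fin k) ρ) :=
  ⟨hT.1 k ρ hρ.1, (trace_tensorId hT.2 ρ).trans hρ.2⟩

/-- The diamond norm only ranges over pure inputs with ancillas `Fin k`; convexity extends the bound
to mixed states, and relabelling to any finite ancilla. -/
theorem unitaryTraceLE_of_diamondNorm_le {Φ : Matrix a a ℂ →ₗ[ℂ] Matrix b b ℂ} {ε : ℝ}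
    (h : diamondNorm Φ ≤ (ε : EReal)) {ρ : Matrix (a × c) (a × c) ℂ} (hρ : IsState ρ) :
    UnitaryTraceLE (tensorId Φ c ρ) ε := by
  intro U hU hU'
  let e := (Fintype.equivFin c).symm
  obtain ⟨V, hV⟩ := exists_isEnsemble hρ.1
  obtain ⟨m, p, ψ, hp, hp1, hψ, hρe, -⟩ := hV.exists_normalized hρ.2
  have h1 : ∀ φ : a × c → ℂ, IsUnitVector φ → ‖(U * tensorId Φ c (pureState φ)).trace‖ ≤ ε := by
    intro φ hφ
    let f : a × Fin (Fintype.card c) ≃ a × c := (Equiv.refl a).prodCongr e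
    let g : b × Fin (Fintype.card c) ≃ b × c := (Equiv.refl b).prodCongr e
    have hφ' : IsUnitVector (φ ∘ f) := by
      rw [IsUnitVector, ← hφ]
      exact f.sum_comp fun x => ‖φ x‖ ^ 2
    have h2 : traceNorm (tensorId Φ (Fin (Fintype.card c)) (pureState (φ ∘ f))) ≤ ε := by
      have := (le_iSup₂ (f := fun (k : ℕ) (φ : {φ : a × Fin k → ℂ // IsUnitVector φ}) =>
        ((traceNorm (tensorId Φ (Fin k) (pureState φ.1)) : ℝ) : EReal)) (Fintype.card c)
        ⟨φ ∘ f, hφ'⟩).trans h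
      exact_mod_cast this
    have h3 : tensorId Φ (Fin (Fintype.card c)) (pureState (φ ∘ f)) =
        (tensorId Φ c (pureState φ)).submatrix g g := rfl
    have h4 := unitaryTraceLE_traceNorm (tensorId Φ (Fin (Fintype.card c)) (pureState (φ ∘ f)))
      (U.submatrix g g)
      (by rw [conjTranspose_submatrix, submatrix_mul_equiv, hU, submatrix_one_equiv])
      (by rw [conjTranspose_submatrix, submatrix_mul_equiv, hU', submatrix_one_equiv])
    rw [h3, submatrix_mul_equiv] at h4
    have h5 : ((U * tensorId Φ c (pureState φ)).submatrix g g).trace =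
        (U * tensorId Φ c (pureState φ)).trace := g.sum_comp fun x =>
      (U * tensorId Φ c (pureState φ)) x x
    rw [h5, ← h3] at h4
    exact h4.trans h2
  rw [hρe, map_sum, Matrix.mul_sum, trace_sum]
  refine (norm_sum_le _ _).trans ?_
  rw [← one_mul ε, ← hp1, Finset.sum_mul]
  refine Finset.sum_le_sum fun j _ => ?_
  rw [map_smul, Matrix.mul_smul, trace_smul, norm_smul, Complex.norm_real, Real.norm_eq_abs,
    abs_of_nonneg (hp j)]
  exact mul_le_mul_of_nonneg_left (h1 _ (hψ j)) (hp j)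

end ExtendedMaps

/-! ### Coherence powers bound the simulation cost from below. -/

section SimulationBound

variable {a b : Type*} [Fintype a] [DecidableEq a] [Fintype b] [DecidableEq b]

/-- A simulation of `T^{⊗n}` yields, from `ρ^{⊗n}`, a state close to `(T ⊗ id)(ρ)^{⊗n}` whose
coherence is limited by that of `ρ` and of the resource. -/
theorem HasSimulation.exists_state {T : Matrix a a ℂ →ₗ[ℂ] Matrix b b ℂ} {n d : ℕ} {ε : ℝ}
    (h : HasSimulation T n d ε) (hn : 1 ≤ n) (hd : 0 < d) {k : ℕ}
    {ρ : Matrix (a × Fin k) (a × Fin k) ℂ} (hρ : IsState ρ) :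
    ∃ τ : Matrix ((Fin n → b) × (Fin n → Fin k)) ((Fin n → b) × (Fin n → Fin k)) ℂ,
      IsState τ ∧ UnitaryTraceLE (blockPower (tensorId T (Fin k) ρ) n - τ) ε ∧
      relEntropyCoherence τ ≤ n * relEntropyCoherence ρ + Real.logb 2 d ∧
      coherenceOfFormation τ ≤ n * coherenceOfFormation ρ + Real.logb 2 d := by
  obtain ⟨I, hI, hdiam⟩ := h
  set ω := pureState (maxCoherentVector d) with hω
  have hωs : IsState ω := (isUnitVector_maxCoherentVector hd).isState
  have hpow : IsState (statePower ρ n) := hρ.statePower hn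
  have hblock : IsState (blockPower ρ n) := isState_submatrix hpow _
  have hin := hblock.kronecker hωs
  have hin' := isState_submatrix hin (rightCommEquiv (Fin n → a) (Fin d) (Fin n → Fin k))
  have hJ := isIncoherentOperation_tensorId (c := Fin n → Fin k) hI
  refine ⟨tensorId (withResource I ω) (Fin n → Fin k) (blockPower ρ n), ?_, ?_, ?_, ?_⟩
  · rw [tensorId_withResource]
    exact hJ.isState hin'
  · have h1 := unitaryTraceLE_of_diamondNorm_le hdiam hblock
    have h2 : tensorId (withResource I ω - tensorPower T n) (Fin n → Fin k) (blockPower ρ n) =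
        tensorId (withResource I ω) (Fin n → Fin k) (blockPower ρ n) -
          blockPower (tensorId T (Fin k) ρ) n := by
      rw [← tensorId_blockPower]
      rfl
    rw [h2] at h1
    exact h1.symm
  · rw [tensorId_withResource]
    refine (relEntropyCoherence_monotone hJ hin').trans ?_
    rw [relEntropyCoherence_submatrix hin, relEntropyCoherence_kronecker hblock hωs, blockPower,
      relEntropyCoherence_submatrix hpow, relEntropyCoherence_statePower hρ hn]
    have := relEntropyCoherence_maxCoherent_le hd
    linarith
  · rw [tensorId_withResource]
    refine (coherenceOfFormation_monotone hJ hin').trans ?_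
    rw [coherenceOfFormation_submatrix hin]
    refine (coherenceOfFormation_kronecker_le hblock hωs).trans ?_
    rw [blockPower, coherenceOfFormation_submatrix hpow]
    have h1 := coherenceOfFormation_maxCoherent_le hd
    have h2 := coherenceOfFormation_statePower_le hρ hn
    linarith

theorem logb_card_block (n k : ℕ) :
    Real.logb 2 (Fintype.card ((Fin n → b) × (Fin n → Fin k))) =
      n * Real.logb 2 (Fintype.card b * k) := by
  rw [Fintype.card_prod, Fintype.card_fun, Fintype.card_fun, Fintype.card_fin, Fintype.card_fin,
    ← Nat.mul_pow, Nat.cast_pow, Real.logb_pow, Nat.cast_mul]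

/-- Division by `n`: the continuity error is `g n` times the log-dimension `n L`, hence still
vanishes per copy when `g` tends to 0. -/
theorem le_add_of_linear_bound {x y R L h₀ : ℝ} {d g h : ℕ → ℝ}
    (hb : ∀ n : ℕ, 1 ≤ n → n * x ≤ n * y + d n + g n * (n * L) + h n)
    (hg : Tendsto g atTop (𝓝 0)) (hh : Tendsto h atTop (𝓝 h₀))
    (hd : Tendsto (fun n => d n / n) atTop (𝓝 R)) : x ≤ y + R := by
  have h1 : Tendsto (fun n : ℕ => y + d n / n + g n * L + h n / n) atTop
      (𝓝 (y + R + 0 * L + 0)) :=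
    ((tendsto_const_nhds.add hd).add (hg.mul_const L)).add
      (hh.div_atTop tendsto_natCast_atTop_atTop)
  rw [zero_mul, add_zero, add_zero] at h1
  refine ge_of_tendsto h1 ?_
  filter_upwards [eventually_ge_atTop 1] with n hn
  have hn' : (0 : ℝ) < n := by exact_mod_cast hn
  have h2 := hb n hn
  rw [mul_comm (n : ℝ) x, ← le_div_iff₀ hn'] at h2
  refine h2.trans_eq ?_
  field_simp

theorem relEntropyCoherence_tensorId_le {T : Matrix a a ℂ →ₗ[ℂ] Matrix b b ℂ} (hT : IsCPTP T)
    {R : ℝ} (hR : IsSimulationRate T R) {k : ℕ} {ρ : Matrix (a × Fin k) (a × Fin k) ℂ}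
    (hρ : IsState ρ) :
    relEntropyCoherence (tensorId T (Fin k) ρ) ≤ relEntropyCoherence ρ + R := by
  obtain ⟨d, ε, hd, hsim, hε, hrate⟩ := hR
  have hTρ := hT.isState_tensorId hρ
  refine le_add_of_linear_bound (L := Real.logb 2 (Fintype.card b * k)) (g := fun n => 2 * ε n)
    (h := fun n => 2 * (1 + ε n)) (h₀ := 2 * (1 + 0)) (fun n hn => ?_)
    (by simpa using hε.const_mul 2) ((hε.const_add 1).const_mul 2) hrate
  obtain ⟨τ, hτ, hclose, hr, -⟩ := (hsim n hn).exists_state hn (hd n) hρ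
  have h1 := relEntropyCoherence_le_of_close hτ (isState_submatrix (hTρ.statePower hn) _) hclose
  rw [relEntropyCoherence_submatrix (hTρ.statePower hn), relEntropyCoherence_statePower hTρ hn,
    logb_card_block] at h1
  linarith

theorem coherenceOfFormation_tensorId_le {T : Matrix a a ℂ →ₗ[ℂ] Matrix b b ℂ} (hT : IsCPTP T)
    {R : ℝ} (hR : IsSimulationRate T R) {k : ℕ} {ρ : Matrix (a × Fin k) (a × Fin k) ℂ}
    (hρ : IsState ρ) :
    coherenceOfFormation (tensorId T (Fin k) ρ) ≤ coherenceOfFormation ρ + R := by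
  obtain ⟨d, ε, hd, hsim, hε, hrate⟩ := hR
  have hTρ := hT.isState_tensorId hρ
  have hs : Tendsto (fun n => 2 * Real.sqrt (ε n)) atTop (𝓝 0) := by
    simpa using (hε.sqrt).const_mul 2
  refine le_add_of_linear_bound (L := Real.logb 2 (Fintype.card b * k)) (h₀ := 1 + 0)
    (fun n hn => ?_) hs (hs.const_add 1) hrate
  obtain ⟨τ, hτ, hclose, -, hf⟩ := (hsim n hn).exists_state hn (hd n) hρ
  have h1 := coherenceOfFormation_le_of_close hτ (isState_submatrix (hTρ.statePower hn) _) hclose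
  rw [coherenceOfFormation_submatrix (hTρ.statePower hn), logb_card_block] at h1
  have h2 := le_coherenceOfFormation_statePower hTρ hn
  linarith

theorem completeRelEntropyPower_le_simulationCost {T : Matrix a a ℂ →ₗ[ℂ] Matrix b b ℂ}
    (hT : IsCPTP T) : completeRelEntropyPower T ≤ simulationCost T := by
  refine iSup_le fun k => iSup_le fun ρ => le_iInf fun R => ?_
  rw [EReal.coe_le_coe_iff]
  have := relEntropyCoherence_tensorId_le hT R.2 ρ.2
  linarith

theorem completeFormationPower_le_simulationCost {T : Matrix a a ℂ →ₗ[ℂ] Matrix b b ℂ}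
    (hT : IsCPTP T) : completeFormationPower T ≤ simulationCost T := by
  refine iSup_le fun k => iSup_le fun ρ => le_iInf fun R => ?_
  rw [EReal.coe_le_coe_iff]
  have := coherenceOfFormation_tensorId_le hT R.2 ρ.2
  linarith

end SimulationBound

/-! ### The formation power bounds the generating capacity. -/

section GenerationBound

variable {a b c : Type*} [Fintype a] [DecidableEq a] [Fintype b] [DecidableEq b] [Fintype c]
  [DecidableEq c]

theorem coherenceOfFormation_nonneg (ρ : Matrix a a ℂ) : 0 ≤ coherenceOfFormation ρ := by
  refine Real.sInf_nonneg ?_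
  rintro x ⟨m, q, φ, hq, -, hφ, -, rfl⟩
  refine Finset.sum_nonneg fun j _ => mul_nonneg (hq j) ?_
  rw [(hφ j).entropyOfCoherence]
  exact div_nonneg (vecEntropy_nonneg _) (Real.log_pos one_lt_two).le

theorem coherenceOfFormation_eq_zero_of_isDiag {ρ : Matrix a a ℂ} (hρ : IsIncoherentState ρ) :
    coherenceOfFormation ρ = 0 := by
  refine le_antisymm ?_ (coherenceOfFormation_nonneg ρ)
  have h : IsEnsemble (fun j => ((Real.sqrt (ρ j j).re : ℝ) : ℂ) • (Pi.single j 1 : a → ℂ)) ρ := by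
    intro x y
    by_cases hxy : x = y
    · subst hxy
      rw [Finset.sum_eq_single x]
      · simp only [Pi.smul_apply, Pi.single_eq_same, smul_eq_mul, mul_one, mul_star_self_eq,
          Complex.norm_real, Real.norm_eq_abs, sq_abs, Real.sq_sqrt (hρ.1.diag_nonneg x)]
        exact hρ.1.diag_eq x
      · intro j _ hj
        simp [hj.symm]
      · simp
    · rw [hρ.2 hxy, eq_comm]
      refine Finset.sum_eq_zero fun j _ => ?_
      by_cases hx : x = j
      · subst hx
        simp [Ne.symm hxy]
      · simp [hx]
  refine (coherenceOfFormation_le h hρ.1.2).trans_eq ?_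
  have h0 : ∀ j : a, vecEntropy (Pi.single j 1 : a → ℂ) = 0 := by
    intro j
    have h1 : ∀ i, ‖(Pi.single j 1 : a → ℂ) i‖ ^ 2 = (Pi.single j 1 : a → ℝ) i := by
      intro i
      by_cases hi : i = j
      · subst hi; simp
      · simp [hi]
    simp only [vecEntropy, h1]
    rw [massEntropy_of_sum_eq_one (by simp)]
    refine Finset.sum_eq_zero fun i _ => ?_
    by_cases hi : i = j
    · subst hi; simp
    · simp [hi]
  rw [Finset.sum_eq_zero fun j _ => by rw [vecEntropy_smul, h0, mul_zero], zero_div]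

theorem Generates.isState {T : Matrix a a ℂ →ₗ[ℂ] Matrix b b ℂ} (hT : IsCPTP T) {t k : ℕ}
    {ρ : Matrix (a × Fin k) (a × Fin k) ℂ} (h : Generates T t k ρ) : IsState ρ := by
  induction h with
  | init k ρ hρ => exact hρ.1
  | step t k k' ρ _ I hI ih => exact hI.isState (hT.isState_tensorId ih)

theorem Generates.coherenceOfFormation_le {T : Matrix a a ℂ →ₗ[ℂ] Matrix b b ℂ} (hT : IsCPTP T)
    {P : ℝ} (hP : ∀ (k : ℕ) (ρ : Matrix (a × Fin k) (a × Fin k) ℂ), IsState ρ →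
      coherenceOfFormation (tensorId T (Fin k) ρ) - coherenceOfFormation ρ ≤ P) {t k : ℕ}
    {ρ : Matrix (a × Fin k) (a × Fin k) ℂ} (h : Generates T t k ρ) :
    coherenceOfFormation ρ ≤ t * P := by
  induction h with
  | init k ρ hρ => simp [coherenceOfFormation_eq_zero_of_isDiag hρ]
  | step t k k' ρ hρ I hI ih =>
    have hs := hρ.isState hT
    have h1 := coherenceOfFormation_monotone hI (hT.isState_tensorId hs)
    have h2 := hP k ρ hs
    push_cast
    linarith

theorem norm_maxCoherent_overlap_le {d : ℕ} (v : Fin d → ℂ) :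
    ‖star (maxCoherentVector d) ⬝ᵥ v‖ ≤ ∑ i, (1 / Real.sqrt d) * ‖v i‖ := by
  refine (norm_sum_le _ _).trans_eq (Finset.sum_congr rfl fun i _ => ?_)
  rw [Pi.star_apply, norm_mul, norm_star, maxCoherentVector, Complex.norm_real, Real.norm_eq_abs,
    abs_of_nonneg (by positivity)]

theorem IsEnsemble.overlap_eq {ι : Type*} [Fintype ι] {V : ι → a → ℂ} {ω : Matrix a a ℂ}
    (h : IsEnsemble V ω) (u : a → ℂ) :
    (star u ⬝ᵥ (ω *ᵥ u)).re = ∑ j, ‖star u ⬝ᵥ V j‖ ^ 2 := by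
  rw [isEnsemble_iff.1 h, sum_mulVec, dotProduct_sum, Complex.re_sum]
  refine Finset.sum_congr rfl fun j _ => ?_
  have h1 : star (V j) ⬝ᵥ u = star (star u ⬝ᵥ V j) := by
    rw [star_dotProduct]
  have h2 : star u ⬝ᵥ (pureState (V j) *ᵥ u) = (star u ⬝ᵥ V j) * (star (V j) ⬝ᵥ u) := by
    rw [pureState, vecMulVec_mulVec, dotProduct_smul]
    simp
  rw [h2, h1, mul_star_self_eq, Complex.ofReal_re]

/-- A lower bound for the coherence of formation in terms of the overlap with `Ψ_d`. -/
theorem logb_le_coherenceOfFormation {d : ℕ} (hd : 0 < d) {ω : Matrix (Fin d) (Fin d) ℂ}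
    (hω : IsState ω) {ε : ℝ}
    (h : 1 - ε ≤ (star (maxCoherentVector d) ⬝ᵥ (ω *ᵥ maxCoherentVector d)).re) :
    Real.logb 2 d ≤ coherenceOfFormation ω + 2 * Real.sqrt (2 * ε) * Real.logb 2 d +
      (1 + 2 * Real.sqrt (2 * ε)) := by
  have hlog2 : 0 < Real.log 2 := Real.log_pos one_lt_two
  have hd' : (0 : ℝ) < d := by exact_mod_cast hd
  have : Nonempty (Fin d) := ⟨⟨0, hd⟩⟩
  refine le_of_forall_pos_lt_add fun η hη => ?_
  obtain ⟨m, V, hV, hV'⟩ := exists_isEnsemble_lt hω hη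
  rw [hV.overlap_eq] at h
  set p : Fin m → ℝ := fun j => ∑ i, ‖V j i‖ ^ 2 with hp
  have hp0 : ∀ j, 0 ≤ p j := fun j => Finset.sum_nonneg fun i _ => sq_nonneg _
  have hp1 : ∑ j, p j = 1 := hV.sum_norm_sq hω.2
  set q : ℝ := 1 / Real.sqrt d with hq
  have hq2 : q ^ 2 = 1 / d := by rw [hq, div_pow, one_pow, Real.sq_sqrt hd'.le]
  set s : Fin m → ℝ := fun j => ∑ i, q * ‖V j i‖ with hs
  have hs0 : ∀ j, 0 ≤ s j := fun j => Finset.sum_nonneg fun i _ => by positivity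
  have hsp : ∀ j, s j ≤ Real.sqrt (p j) := by
    intro j
    have h1 := Real.sum_mul_le_sqrt_mul_sqrt Finset.univ (fun _ : Fin d => q) fun i => ‖V j i‖
    have h2 : ∑ _i : Fin d, q ^ 2 = 1 := by
      rw [hq2]
      simp [hd'.ne']
    rwa [h2, Real.sqrt_one, one_mul] at h1
  -- The moduli of the ensemble vectors are compared with flat vectors of the same norms `√(p j)`.
  -- The fidelity bounds `∑ √(p j) s j` below by `1 - ε`, so the squared distance `2 - 2 ∑ √(p j) s
  -- j` is at most `2ε`, and the flat family has average entropy exactly `log d`.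
  set v : Fin m × Fin d → ℂ := fun z => ((‖V z.1 z.2‖ : ℝ) : ℂ) with hv
  set w : Fin m × Fin d → ℂ := fun z => ((Real.sqrt (p z.1) * q : ℝ) : ℂ) with hw
  have hvn : ∀ z, ‖v z‖ ^ 2 = ‖V z.1 z.2‖ ^ 2 := fun z => by simp [hv]
  have hwn : ∀ z, ‖w z‖ ^ 2 = p z.1 * (1 / d) := fun z => by
    rw [hw, Complex.norm_real, Real.norm_eq_abs, sq_abs, mul_pow, Real.sq_sqrt (hp0 _), hq2]
  have hv1 : ∑ z, ‖v z‖ ^ 2 = 1 := by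
    simp only [hvn, Fintype.sum_prod_type]
    exact hp1
  have hw1 : ∑ z, ‖w z‖ ^ 2 = 1 := by
    simp only [hwn, Fintype.sum_prod_type, Finset.sum_const, Finset.card_univ, Fintype.card_fin,
      nsmul_eq_mul]
    refine (Finset.sum_congr rfl fun j _ => ?_).trans hp1
    field_simp
  have hdist : ∑ z, ‖w z - v z‖ ^ 2 ≤ 2 * ε := by
    have h1 : ∀ z, ‖w z - v z‖ ^ 2 =
        ‖w z‖ ^ 2 + ‖v z‖ ^ 2 - 2 * (Real.sqrt (p z.1) * (q * ‖V z.1 z.2‖)) := by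
      intro z
      rw [hvn, hw, hv]
      simp only
      rw [← Complex.ofReal_sub, Complex.norm_real, Complex.norm_real, Real.norm_eq_abs,
        Real.norm_eq_abs, sq_abs, sq_abs]
      ring
    have h2 : ∑ z : Fin m × Fin d, Real.sqrt (p z.1) * (q * ‖V z.1 z.2‖) =
        ∑ j, Real.sqrt (p j) * s j := by
      simp only [Fintype.sum_prod_type, hs, Finset.mul_sum]
    simp only [h1, Finset.sum_sub_distrib, Finset.sum_add_distrib, hv1, hw1, ← Finset.mul_sum, h2]
    have h3 : ∑ j, ‖star (maxCoherentVector d) ⬝ᵥ V j‖ ^ 2 ≤ ∑ j, Real.sqrt (p j) * s j := by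
      refine Finset.sum_le_sum fun j _ => ?_
      have h4 : ‖star (maxCoherentVector d) ⬝ᵥ V j‖ ≤ s j := norm_maxCoherent_overlap_le (V j)
      rw [sq]
      exact mul_le_mul (h4.trans (hsp j)) h4 (norm_nonneg _) (Real.sqrt_nonneg _)
    linarith
  have h1 := sum_abs_sq_sub_sq_le hv1 hw1 hdist
  rw [Fintype.sum_prod_type] at h1 hv1
  have h2 := sum_massEntropy_le_of_close (fun _ _ => sq_nonneg _) (fun _ _ => sq_nonneg _) h1 hv1
  have h3 : ∀ j, (massEntropy fun i => ‖w (j, i)‖ ^ 2) = p j * Real.log d := by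
    intro j
    simp only [hwn, massEntropy_const_mul]
    rw [massEntropy_of_sum_eq_one (by simp [hd'.ne'])]
    simp [Real.negMulLog, hd'.ne']
  simp only [h3, hvn, ← Finset.sum_mul, hp1, one_mul, Fintype.card_fin] at h2
  have h4 : Real.logb 2 d ≤ (∑ j, vecEntropy (V j)) / Real.log 2 +
      2 * Real.sqrt (2 * ε) * Real.logb 2 d + (1 + 2 * Real.sqrt (2 * ε)) := by
    rw [Real.logb, div_le_iff₀ hlog2]
    refine h2.trans_eq ?_
    simp only [vecEntropy]
    field_simp
  linarith

/-- After `n` uses `C_f ≤ nP`; strong superadditivity and non-negativity pass this bound to the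
output register, where closeness to `Ψ_d` forces `C_f` to be nearly `log d`. -/
theorem generatingCapacity_le_completeFormationPower
    {T : Matrix a a ℂ →ₗ[ℂ] Matrix b b ℂ} (hT : IsCPTP T) :
    generatingCapacity T ≤ completeFormationPower T := by
  refine iSup_le fun ⟨R, d, ε, hd, hgen, hε, hrate⟩ => ?_
  by_contra hlt
  -- The power is an extended real, so a real bound `P` below the rate is interpolated before the
  -- induction over uses.
  obtain ⟨P, hP1, hP2⟩ := EReal.lt_iff_exists_real_btwn.1 (not_le.1 hlt)
  rw [EReal.coe_lt_coe_iff] at hP2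
  have hP : ∀ (k : ℕ) (ρ : Matrix (a × Fin k) (a × Fin k) ℂ), IsState ρ →
      coherenceOfFormation (tensorId T (Fin k) ρ) - coherenceOfFormation ρ ≤ P := by
    intro k ρ hρ
    have h1 : ((coherenceOfFormation (tensorId T (Fin k) ρ) - coherenceOfFormation ρ : ℝ) : EReal)
        ≤ completeFormationPower T :=
      le_iSup_of_le (f := fun k => formationPower (tensorId T (Fin k))) k
        (le_iSup (fun ρ : {ρ : Matrix (a × Fin k) (a × Fin k) ℂ // IsState ρ} =>
          ((coherenceOfFormation (tensorId T (Fin k) ρ.1) - coherenceOfFormation ρ.1 : ℝ) :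
            EReal)) ⟨ρ, hρ⟩)
    exact_mod_cast h1.trans hP1.le
  have hs : Tendsto (fun n => 2 * Real.sqrt (2 * ε n)) atTop (𝓝 0) := by
    simpa using ((hε.const_mul 2).sqrt).const_mul 2
  have hbound : ∀ n : ℕ, 1 ≤ n → Real.logb 2 (d n) * (1 - 2 * Real.sqrt (2 * ε n)) / n ≤
      P + (1 + 2 * Real.sqrt (2 * ε n)) / n := by
    intro n hn
    obtain ⟨ρ, hρ, hov⟩ := hgen n hn
    have hρs := hρ.isState hT
    have htr : IsState (traceFst ρ) := by
      obtain ⟨V, hV⟩ := exists_isEnsemble hρs.1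
      exact ⟨hV.traceFst.posSemidef, (trace_traceFst ρ).trans hρs.2⟩
    have h1 := logb_le_coherenceOfFormation (hd n) htr hov
    have h2 := coherenceOfFormation_superadditive hρs
    have h3 := coherenceOfFormation_nonneg (traceSnd ρ)
    have h4 := hρ.coherenceOfFormation_le hT hP
    have hn' : (0 : ℝ) < n := by exact_mod_cast hn
    rw [div_le_iff₀ hn', add_mul, div_mul_cancel₀ _ hn'.ne']
    linarith
  have hl : Tendsto (fun n : ℕ => Real.logb 2 (d n) * (1 - 2 * Real.sqrt (2 * ε n)) / n) atTop
      (𝓝 (R * (1 - 0))) := by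
    refine (hrate.mul (hs.const_sub 1)).congr fun n => ?_
    ring
  have hr : Tendsto (fun n : ℕ => P + (1 + 2 * Real.sqrt (2 * ε n)) / n) atTop (𝓝 (P + 0)) :=
    ((hs.const_add 1).div_atTop tendsto_natCast_atTop_atTop).const_add P
  have := le_of_tendsto_of_tendsto hl hr
    (by filter_upwards [eventually_ge_atTop 1] with n hn using hbound n hn)
  linarith

end GenerationBound

/-! ### Kraus representations and their tensor powers. -/

section KrausMaps

variable {a b ι : Type*} [Fintype a] [DecidableEq a] [Fintype b] [DecidableEq b] [Fintype ι]

/-- The completely positive map with Kraus operators `K`. -/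
def krausMap (K : ι → Matrix b a ℂ) : Matrix a a ℂ →ₗ[ℂ] Matrix b b ℂ where
  toFun ρ := ∑ α, K α * ρ * (K α)ᴴ
  map_add' ρ σ := by simp only [Matrix.mul_add, Matrix.add_mul, Finset.sum_add_distrib]
  map_smul' r ρ := by
    simp only [Matrix.mul_smul, Matrix.smul_mul, Finset.smul_sum, RingHom.id_apply]

theorem krausMap_apply_apply (K : ι → Matrix b a ℂ) (ρ : Matrix a a ℂ) (y y' : b) :
    krausMap K ρ y y' = ∑ α, ∑ x, ∑ x', ρ x x' * (K α y x * star (K α y' x')) := by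
  simp only [krausMap, LinearMap.coe_mk, AddHom.coe_mk, Matrix.sum_apply, Matrix.mul_apply,
    conjTranspose_apply, Finset.sum_mul]
  refine Finset.sum_congr rfl fun α _ => ?_
  rw [Finset.sum_comm]
  refine Finset.sum_congr rfl fun x _ => Finset.sum_congr rfl fun x' _ => ?_
  ring

theorem krausMap_single_apply (K : ι → Matrix b a ℂ) (x x' : a) (y y' : b) :
    krausMap K (single x x' 1) y y' = ∑ α, K α y x * star (K α y' x') := by
  rw [krausMap_apply_apply]
  refine Finset.sum_congr rfl fun α _ => ?_
  rw [Finset.sum_eq_single x, Finset.sum_eq_single x']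
  · simp
  · intro z _ hz
    simp [hz.symm]
  · simp
  · intro z _ hz
    refine Finset.sum_eq_zero fun z' _ => ?_
    simp [hz.symm]
  · simp

theorem eq_krausMap {T : Matrix a a ℂ →ₗ[ℂ] Matrix b b ℂ} {K : ι → Matrix b a ℂ}
    (h : ∀ x x' y y', T (single x x' 1) y y' = ∑ α, K α y x * star (K α y' x')) :
    T = krausMap K := by
  refine Matrix.ext_linearMap _ fun x x' => LinearMap.ext_ring ?_
  ext y y'
  exact (h x x' y y').trans (krausMap_single_apply K x x' y y').symm

theorem sum_conjTranspose_mul_eq_one {K : ι → Matrix b a ℂ}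
    (h : ∀ ρ, (krausMap K ρ).trace = ρ.trace) : ∑ α, (K α)ᴴ * K α = 1 := by
  refine Matrix.ext_iff_trace_mul_right.2 fun ρ => ?_
  rw [one_mul, ← h ρ, Finset.sum_mul, trace_sum]
  change _ = (∑ α, K α * ρ * (K α)ᴴ).trace
  rw [trace_sum]
  refine Finset.sum_congr rfl fun α _ => ?_
  rw [trace_mul_comm (K α * ρ), ← Matrix.mul_assoc]

/-- The Choi–Kraus theorem. -/
theorem IsCPTP.exists_kraus {T : Matrix a a ℂ →ₗ[ℂ] Matrix b b ℂ} (hT : IsCPTP T) :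
    ∃ (m : ℕ) (K : Fin m → Matrix b a ℂ), ∑ α, (K α)ᴴ * K α = 1 ∧ T = krausMap K := by
  let e := Fintype.equivFin a
  -- The unnormalized maximally entangled vector: its image under `T ⊗ id` is the Choi matrix, and
  -- the vectors of any ensemble of that matrix, reshaped, are Kraus operators.
  set w : a × Fin (Fintype.card a) → ℂ := fun z => if e z.1 = z.2 then 1 else 0 with hw
  have hC := hT.1 _ (pureState w) (posSemidef_vecMulVec_self_star w)
  obtain ⟨V, hV⟩ := exists_isEnsemble hC
  let f := (Fintype.equivFin (b × Fin (Fintype.card a))).symm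
  have hK : T = krausMap fun α => of fun y x => V (f α) (y, e x) := by
    refine eq_krausMap fun x x' y y' => ?_
    have h1 := hV (y, e x) (y', e x')
    have h2 : (of fun i j => pureState w (i, e x) (j, e x') : Matrix a a ℂ) = single x x' 1 := by
      ext i j
      simp only [pureState, vecMulVec_apply, hw, single_apply, of_apply, Pi.star_apply,
        e.injective.eq_iff]
      by_cases h : i = x <;> by_cases h' : j = x' <;> simp [h, h', Ne.symm]
    have h3 : tensorId T (Fin (Fintype.card a)) (pureState w) (y, e x) (y', e x') =
        T (of fun i j => pureState w (i, e x) (j, e x')) y y' := rfl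
    rw [h3, h2] at h1
    rw [h1, ← f.sum_comp]
    rfl
  refine ⟨_, _, ?_, hK⟩
  refine sum_conjTranspose_mul_eq_one fun ρ => ?_
  rw [← hK, hT.2]

/-- The Kraus operators of a tensor power. -/
def krausPower (K : ι → Matrix b a ℂ) (n : ℕ) (α : Fin n → ι) :
    Matrix (Fin n → b) (Fin n → a) ℂ :=
  of fun y x => ∏ l, K (α l) (y l) (x l)

theorem tensorPower_krausMap [DecidableEq ι] (K : ι → Matrix b a ℂ) (n : ℕ) :
    tensorPower (krausMap K) n = krausMap (krausPower K n) := by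
  refine LinearMap.ext fun ρ => ?_
  ext y y'
  rw [krausMap_apply_apply]
  change ∑ i, ∑ j, ρ i j * ∏ l, krausMap K (single (i l) (j l) 1) (y l) (y' l) = _
  simp only [krausMap_single_apply, Fintype.prod_sum, Finset.mul_sum]
  rw [eq_comm, Finset.sum_comm]
  refine Finset.sum_congr rfl fun i _ => ?_
  rw [Finset.sum_comm]
  refine Finset.sum_congr rfl fun j _ => Finset.sum_congr rfl fun α _ => ?_
  simp only [krausPower, of_apply, star_prod, Finset.prod_mul_distrib]

theorem sum_krausPower [DecidableEq ι] {K : ι → Matrix b a ℂ} (hK : ∑ α, (K α)ᴴ * K α = 1)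
    (n : ℕ) : ∑ α, (krausPower K n α)ᴴ * krausPower K n α = 1 := by
  ext x x'
  have h1 : ∀ l, ∑ α, ∑ y, star (K α y (x l)) * K α y (x' l) = if x l = x' l then 1 else 0 := by
    intro l
    have := congrFun (congrFun hK (x l)) (x' l)
    simpa only [Matrix.sum_apply, Matrix.mul_apply, conjTranspose_apply, Matrix.one_apply] using this
  simp only [Matrix.sum_apply, Matrix.mul_apply, conjTranspose_apply, krausPower, of_apply,
    star_prod, ← Finset.prod_mul_distrib]
  have h2 : ∀ α : Fin n → ι, ∑ y : Fin n → b, ∏ l, star (K (α l) (y l) (x l)) *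
      K (α l) (y l) (x' l) = ∏ l, ∑ y, star (K (α l) y (x l)) * K (α l) y (x' l) := fun α =>
    (Fintype.prod_sum fun l y => star (K (α l) y (x l)) * K (α l) y (x' l)).symm
  rw [Finset.sum_congr rfl fun α _ => h2 α,
    ← Fintype.prod_sum fun l α => ∑ y, star (K α y (x l)) * K α y (x' l)]
  simp only [h1, Matrix.one_apply, funext_iff]
  rw [Finset.prod_ite_zero]
  simp

end KrausMaps

/-! ### Exact simulation with `log |B|` bits of coherence per use. -/

section ExactSimulation

variable {a b ι : Type*} [Fintype a] [DecidableEq a] [Fintype b] [DecidableEq b] [Fintype ι]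
variable {d : ℕ} [NeZero d]

/-- The incoherent Kraus operators that implement `K` with the resource `Ψ_d`: they read off the
output from the resource system, up to a cyclic shift. -/
def shiftKraus (e : b ≃ Fin d) (K : ι → Matrix b a ℂ) (z : ι × Fin d) :
    Matrix b (a × Fin d) ℂ :=
  of fun y x => if x.2 = e y + z.2 then K z.1 y x.1 else 0

theorem isIncoherentKraus_shiftKraus (e : b ≃ Fin d) (K : ι → Matrix b a ℂ) (z : ι × Fin d) :
    IsIncoherentKraus (shiftKraus e K z) := by
  refine isIncoherentKraus_iff.2 fun j y y' hy hy' => ?_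
  simp only [shiftKraus, of_apply, ne_eq, ite_eq_right_iff, Classical.not_imp] at hy hy'
  exact e.injective (add_right_cancel (hy.1.symm.trans hy'.1))

theorem sum_shiftKraus (e : b ≃ Fin d) {K : ι → Matrix b a ℂ} (hK : ∑ α, (K α)ᴴ * K α = 1) :
    ∑ z, (shiftKraus e K z)ᴴ * shiftKraus e K z = 1 := by
  ext x x'
  have h1 := congrFun (congrFun hK x.1) x'.1
  simp only [Matrix.sum_apply, Matrix.mul_apply, conjTranspose_apply] at h1
  have h2 : ∀ α y, ∑ s, star (shiftKraus e K (α, s) y x) * shiftKraus e K (α, s) y x' =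
      if x.2 = x'.2 then star (K α y x.1) * K α y x'.1 else 0 := by
    intro α y
    -- For given `y` and resource label exactly one cyclic shift contributes, which is why the
    -- shifts complete the family to a trace preserving one.
    rw [Finset.sum_eq_single (x.2 - e y)]
    · simp [shiftKraus, eq_comm]
    · intro s _ hs
      have : x.2 ≠ e y + s := fun h => hs (by rw [h]; abel)
      simp [shiftKraus, this]
    · simp
  simp only [Matrix.sum_apply, Matrix.mul_apply, conjTranspose_apply, Fintype.sum_prod_type]
  have h3 : ∀ α, ∑ s, ∑ y, star (shiftKraus e K (α, s) y x) * shiftKraus e K (α, s) y x' =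
      ∑ y, if x.2 = x'.2 then star (K α y x.1) * K α y x'.1 else 0 := fun α => by
    rw [Finset.sum_comm]
    exact Finset.sum_congr rfl fun y _ => h2 α y
  rw [Finset.sum_congr rfl fun α _ => h3 α]
  by_cases h : x.2 = x'.2
  · simp only [h, if_true, h1, Matrix.one_apply, Prod.ext_iff, and_true]
  · have : x ≠ x' := fun hx => h (by rw [hx])
    simp [h, this]

/-- All entries of `Ψ_d` equal `1/d`, so each shift contributes `1/d` of the channel regardless of
which labels it reads; there are `d` shifts. -/
theorem withResource_shiftKraus (e : b ≃ Fin d) (K : ι → Matrix b a ℂ) :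
    withResource (krausMap (shiftKraus e K)) (pureState (maxCoherentVector d)) = krausMap K := by
  have hd : (d : ℝ) ≠ 0 := Nat.cast_ne_zero.2 (NeZero.ne d)
  have hω : ∀ m m', pureState (maxCoherentVector d) m m' = (d : ℂ)⁻¹ := by
    intro m m'
    rw [pureState, vecMulVec_apply, Pi.star_apply]
    change ((1 / Real.sqrt d : ℝ) : ℂ) * star ((1 / Real.sqrt d : ℝ) : ℂ) = _
    rw [mul_star_self_eq, Complex.norm_real, Real.norm_eq_abs, sq_abs, div_pow, one_pow,
      Real.sq_sqrt (Nat.cast_nonneg d)]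
    simp
  refine LinearMap.ext fun ρ => ?_
  ext y y'
  change krausMap (shiftKraus e K) (ρ ⊗ₖ _) y y' = _
  rw [krausMap_apply_apply, krausMap_apply_apply, Fintype.sum_prod_type]
  refine Finset.sum_congr rfl fun α _ => ?_
  have h1 : ∀ s : Fin d, ∑ x : a × Fin d, ∑ x' : a × Fin d,
      (ρ ⊗ₖ pureState (maxCoherentVector d)) x x' *
        (shiftKraus e K (α, s) y x * star (shiftKraus e K (α, s) y' x')) =
      (d : ℂ)⁻¹ * ∑ x, ∑ x', ρ x x' * (K α y x * star (K α y' x')) := by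
    intro s
    simp only [Fintype.sum_prod_type, kroneckerMap_apply, hω, shiftKraus, of_apply,
      apply_ite star, star_zero, mul_ite, mul_zero, ite_mul, zero_mul, Finset.sum_ite_eq',
      Finset.mem_univ, if_true, Finset.mul_sum]
    refine Finset.sum_congr rfl fun x _ => ?_
    rw [Finset.sum_comm]
    refine Finset.sum_congr rfl fun x' _ => ?_
    rw [Finset.sum_ite_eq', if_pos (Finset.mem_univ _)]
    ring
  rw [Finset.sum_congr rfl fun s _ => h1 s, Finset.sum_const, Finset.card_univ, Fintype.card_fin,
    nsmul_eq_mul, ← mul_assoc, mul_inv_cancel₀ (by exact_mod_cast hd), one_mul]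

theorem diamondNorm_zero_le : diamondNorm (0 : Matrix a a ℂ →ₗ[ℂ] Matrix b b ℂ) ≤ 0 := by
  refine iSup₂_le fun k φ => le_of_eq ?_
  have h : tensorId (0 : Matrix a a ℂ →ₗ[ℂ] Matrix b b ℂ) (Fin k) (pureState φ.1) = 0 := rfl
  have h2 : cfc Real.sqrt (0 : Matrix (b × Fin k) (b × Fin k) ℂ) = 0 := by
    have := cfc_diagonal_ofReal (a := b × Fin k) Real.sqrt fun _ => 0
    simpa only [Complex.ofReal_zero, diagonal_zero, Real.sqrt_zero] using this
  rw [h, traceNorm, Matrix.mul_zero, h2]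
  simp

theorem hasSimulation_card_pow {T : Matrix a a ℂ →ₗ[ℂ] Matrix b b ℂ} (hT : IsCPTP T) [Nonempty b]
    (n : ℕ) : HasSimulation T n (Fintype.card b ^ n) 0 := by
  obtain ⟨m, K, hK, rfl⟩ := hT.exists_kraus
  have : NeZero (Fintype.card b ^ n) := ⟨pow_ne_zero n Fintype.card_ne_zero⟩
  let e : (Fin n → b) ≃ Fin (Fintype.card b ^ n) := Fintype.equivFinOfCardEq (by simp)
  refine ⟨krausMap (shiftKraus e (krausPower K n)), ?_, ?_⟩
  · exact isIncoherentOperation_of_kraus (sum_shiftKraus e (sum_krausPower hK n))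
      (isIncoherentKraus_shiftKraus e _) fun ρ => rfl
  · rw [withResource_shiftKraus, tensorPower_krausMap, sub_self]
    exact diamondNorm_zero_le

theorem IsCPTP.nonempty {T : Matrix a a ℂ →ₗ[ℂ] Matrix b b ℂ} (hT : IsCPTP T) [Nonempty a] :
    Nonempty b := by
  by_contra hb
  rw [not_nonempty_iff] at hb
  have := hT.2 1
  simp [Matrix.trace, eq_comm] at this

theorem simulationCost_le_logb_card {T : Matrix a a ℂ →ₗ[ℂ] Matrix b b ℂ} (hT : IsCPTP T)
    [Nonempty a] : simulationCost T ≤ ((Real.logb 2 (Fintype.card b) : ℝ) : EReal) := by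
  have := hT.nonempty
  refine iInf_le_of_le ⟨Real.logb 2 (Fintype.card b), fun n => Fintype.card b ^ n, fun _ => 0,
    fun n => pow_pos Fintype.card_pos n, fun n _ => hasSimulation_card_pow hT n,
    tendsto_const_nhds, ?_⟩ le_rfl
  refine tendsto_const_nhds.congr' ?_
  filter_upwards [eventually_ge_atTop 1] with n hn
  have hn' : (n : ℝ) ≠ 0 := by positivity
  rw [Nat.cast_pow, Real.logb_pow, mul_div_cancel_left₀ _ hn']

end ExactSimulation

end CoherenceTheory

theorem mainTheorem2 {A B : Type*} [Fintype A] [DecidableEq A] [Nonempty A]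
    [Fintype B] [DecidableEq B]
    (T : Matrix A A ℂ →ₗ[ℂ] Matrix B B ℂ) (hT : CoherenceTheory.IsCPTP T) :
    CoherenceTheory.generatingCapacity T ≤ CoherenceTheory.simulationCost T ∧
    CoherenceTheory.simulationCost T ≤ ((Real.logb 2 (Fintype.card B) : ℝ) : EReal) ∧
    max (CoherenceTheory.completeRelEntropyPower T) (CoherenceTheory.completeFormationPower T) ≤
      CoherenceTheory.simulationCost T :=
  ⟨(CoherenceTheory.generatingCapacity_le_completeFormationPower hT).trans
      (CoherenceTheory.completeFormationPower_le_simulationCost hT),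
    CoherenceTheory.simulationCost_le_logb_card hT,
    max_le (CoherenceTheory.completeRelEntropyPower_le_simulationCost hT)
      (CoherenceTheory.completeFormationPower_le_simulationCost hT)⟩
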